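/- **Definitions.** Let $0<\theta\le\pi$. A sequence $a=(a_n)_{n\in\mathbb N}$ of nonzero complex numbers is called *$\theta$-admissible* if (1) for some $\varepsilon>0$ all $a_n$ satisfy $|\arg a_n|<\theta-\varepsilon$; (2) $\sum_n |a_n|^{-k}<\infty$ for some $k\in\mathbb N$; (3) the theta series $\Theta_a(t)=\sum_n e^{-ta_n}$ converges absolutely for every $t>0$ and has an asymptotic expansion $\Theta_a(t)\sim\sum_{\nu\ge 0}c_\nu t^{\alpha_\nu}$ as $t\downarrow 0$ with $c_\nu\in\mathbb C$ and real $\alpha_0\le\alpha_1\le\dots\to+\infty$, that is, for every $N$ there is $C$ with $|\Theta_a(t)-\sum_{\nu\le N}c_\nu t^{\alpha_\nu}|\le C\,t^{\alpha_{N+1}}$ for $0<t<1$. *Admissible* means $\pi$-admissible. Write $\zeta_a$ for the meromorphic continuation to $\mathbb C$ of $\sum_n a_n^{-s}$ (principal branch). A densely defined operator $A$ on a complex Hilbert space $\mathcal H$ is *regular* if there are pairwise orthogonal finite-dimensional $A$-stable subspaces $H_i\subset\operatorname{dom}A$ with dense sum such that $Af=\sum_i Af_i$ whenever $f=\sum_i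 f_i\in\operatorname{dom} A$ with $f_i\in H_i$. A regular operator whose sequence $(a_n)$ of eigenvalues, listed with algebraic multiplicity, is $\theta$-admissible has *determinant* $\det A=\exp(-\zeta_a'(0))$, and we put $\log\det A=-\zeta_a'(0)$; such an $A$ is called $\theta$-admissible with trivial kernel. In general, let $\ker(A^\infty)=\bigcup_n\ker(A^n)$ and let $P$ be the orthogonal projection onto its orthogonal complement; $A$ is called *$\theta$-admissible* if $A$ is regular, $\ker(A^\infty)$ is finite-dimensional, and $A'=PA$ on $(\ker(A^\infty))^\perp$ is $\theta$-admissible with trivial kernel. **Proposition.** Let $A$ be an admissible operator. 1. If $\lambda\in\mathbb C$ and $A+\lambda$ has no eigenvalue in $(-\infty,0]$ (in particular, if $\operatorname{Re}\lambda>0$ and all eigenvalues of $A$ have real part $\ge 0$), then $A+\lambda$ is admissible with trivial kernel. If $A$ is moreover $\frac\pi2$-admissible, then $A+\lambda$ is $\frac\pi2$-admissible with trivial kernel for every $\lambda$ with $\operatorname{Re}\lambda>0$. 2. There is an entire function $F$ with $F(\lambda)=\det(A+\lambda)$ for every $\lambda$ for which $A+\lambda$ is admissible with trivial kernel. The zeros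 of $F$ are exactly the eigenvalues of $-A$, and the order of each zero is its algebraic multiplicity as an eigenvalue of $-A$. 3. Let $(b_n)_{n\in\mathbb N}$ be the sequence of all eigenvalues of $A$, including $0$ if it occurs, with algebraic multiplicity. Its theta series $\Theta_A(t)=\sum_n e^{-tb_n}$ has an expansion $\sum_\nu c_\nu t^{\alpha_\nu}$ as in (3). For every such expansion put $$E_\nu(u)=\begin{cases}c_\nu\,\Gamma(\alpha_\nu)\,u^{-\alpha_\nu}&\text{if }\alpha_\nu\notin\{0,-1,-2,\dots\},\\[1mm] c_\nu\,\dfrac{(-1)^k}{k!}\Big(\sum_{j=1}^k\dfrac1j-\log u\Big)u^k&\text{if }\alpha_\nu=-k\in\{0,-1,-2,\dots\},\end{cases}$$ with principal branches. Then, as $\lambda\to+\infty$ through real values, $$-\log\det(A+\lambda)\sim\sum_\nu E_\nu(\lambda),$$ that is, $-\log\det(A+\lambda)-\sum_{\nu<N}E_\nu(\lambda)=O(\lambda^{-\alpha_N}\log\lambda)$ for every $N\ge 0$. Moreover, for every $N$ with $\alpha_N>0$, $$-\log\det(A\pm i\lambda)=\sum_{\nu<N}E_\nu(\pm i\lambda)+o(1)\qquad(\lambda\to+\infty),$$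 where $E_\nu(\pm i\lambda)=c_\nu\Gamma(\alpha_\nu)(\pm i)^{-\alpha_\nu}\lambda^{-\alpha_\nu}$ if $\alpha_\nu\notin\{0,-1,\dots\}$, and $E_\nu(\pm i\lambda)=c_\nu\frac{(\mp i)^k}{k!}\big(\sum_{j=1}^k\frac1j-\log\lambda\mp\frac{i\pi}2\big)\lambda^k$ if $\alpha_\nu=-k$. -/

import Mathlib

noncomputable section

namespace RegDet

/-! ### Admissible sequences and regularized products -/

/-- The theta series `Θ_a(t) = ∑ₙ exp (-t aₙ)`. -/
def theta (a : ℕ → ℂ) (t : ℝ) : ℂ := ∑' n, Complex.exp (-(t : ℂ) * a n)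

/-- `Θ_a(t) ∼ ∑_ν c_ν t ^ α_ν` as `t ↓ 0`, with real exponents in increasing order tending to
`+∞`: the remainder after the terms `ν = 0, …, N` is at most `C t ^ α_{N+1}` on `]0,1[`. -/
structure HasHeatExpansion (a : ℕ → ℂ) (c : ℕ → ℂ) (α : ℕ → ℝ) : Prop where
  mono : Monotone α
  tendsto : Filter.Tendsto α Filter.atTop Filter.atTop
  bound : ∀ N : ℕ, ∃ C : ℝ, ∀ t ∈ Set.Ioo (0 : ℝ) 1,
    ‖theta a t - ∑ ν ∈ Finset.range (N + 1), c ν * ((t ^ α ν : ℝ) : ℂ)‖ ≤ C * t ^ α (N + 1)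

/-- Admissible sequences of nonzero complex numbers, all lying in an open angle
`|arg z| < θ - ε` for some `ε > 0`. -/
structure IsAdmissibleSeq (θ : ℝ) (a : ℕ → ℂ) : Prop where
  ne_zero : ∀ n, a n ≠ 0
  sector : ∃ ε > 0, ∀ n, |(a n).arg| < θ - ε
  summable_inv_pow : ∃ k : ℕ, Summable fun n => ‖((a n) ^ k)⁻¹‖
  summable_theta : ∀ t : ℝ, 0 < t → Summable fun n => Complex.exp (-(t : ℂ) * a n)
  expansion : ∃ c α, HasHeatExpansion a c α

/-- `Z` is the meromorphic continuation to `ℂ` of the zeta series `∑ₙ aₙ ^ (-s)` (principal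
branch), the series being convergent in some right half plane. Normal form means that removable
singularities have been removed and that the value at a pole is `0`; it makes `Z` unique. -/
def IsZetaContinuation (a : ℕ → ℂ) (Z : ℂ → ℂ) : Prop :=
  MeromorphicNFOn Z Set.univ ∧
    ∃ σ : ℝ, ∀ s : ℂ, σ < s.re → HasSum (fun n => (a n) ^ (-s)) (Z s)

open Classical in
/-- The meromorphically continued zeta function of a sequence. -/
def zeta (a : ℕ → ℂ) : ℂ → ℂ :=
  if h : ∃ Z, IsZetaContinuation a Z then h.choose else 0

/-- The logarithm `-ζ_a'(0)` of the regularized product. -/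
def logRegProd (a : ℕ → ℂ) : ℂ := -deriv (zeta a) 0

/-- The regularized product `exp (-ζ_a'(0))`. -/
def regProd (a : ℕ → ℂ) : ℂ := Complex.exp (logRegProd a)

/-! ### Operators -/

variable {H : Type*} [NormedAddCommGroup H] [InnerProductSpace ℂ H]

/-- The operator `A + l`, with the domain of `A`. -/
def shift (A : H →ₗ.[ℂ] H) (l : ℂ) : H →ₗ.[ℂ] H where
  domain := A.domain
  toFun := A.toFun + l • A.domain.subtype

/-- `μ` is an eigenvalue of `A`. -/
def IsEigenvalue (A : H →ₗ.[ℂ] H) (μ : ℂ) : Prop :=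
  ∃ x : A.domain, (x : H) ≠ 0 ∧ A x = μ • (x : H)

/-- `ker ((A - μ) ^ n)`, on the natural domain of the power: `x` lies in the `(n+1)`-st kernel
iff `x ∈ dom A` and `A x - μ x` lies in the `n`-th one. -/
def kerPow (A : H →ₗ.[ℂ] H) (μ : ℂ) : ℕ → Submodule ℂ H
  | 0 => ⊥
  | n + 1 => ((kerPow A μ n).comap (A.toFun - μ • A.domain.subtype)).map A.domain.subtype

/-- The generalized eigenspace `⋃ₙ ker ((A - μ) ^ n)` (an increasing union). -/
def genEigenspace (A : H →ₗ.[ℂ] H) (μ : ℂ) : Submodule ℂ H := ⨆ n, kerPow A μ n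

/-- The generalized kernel `⋃ₙ ker (A ^ n)`. -/
def genKer (A : H →ₗ.[ℂ] H) : Submodule ℂ H := genEigenspace A 0

/-- The algebraic multiplicity of `μ` as an eigenvalue of `A` (zero if it is none). -/
def algMult (A : H →ₗ.[ℂ] H) (μ : ℂ) : ℕ∞ :=
  Cardinal.toENat (Module.rank ℂ (genEigenspace A μ))

/-- `a` lists the eigenvalues of `A`, each as often as its algebraic multiplicity says. -/
def IsEigenvalueSeq (A : H →ₗ.[ℂ] H) (a : ℕ → ℂ) : Prop :=
  ∀ μ : ℂ, {n | a n = μ}.encard = algMult A μ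

/-- `S` is a set of pairwise orthogonal finite dimensional `A`-stable subspaces of `dom A` with
dense sum, and `A f = ∑ A f_V` whenever `f ∈ dom A` is a sum `f = ∑ f_V` with `f_V ∈ V ∈ S`. -/
structure IsRegularDecomposition (A : H →ₗ.[ℂ] H) (S : Set (Submodule ℂ H)) : Prop where
  finiteDimensional : ∀ V ∈ S, FiniteDimensional ℂ V
  orthogonal : S.Pairwise fun V W => V ⟂ W
  le_domain : ∀ V ∈ S, V ≤ A.domain
  stable : ∀ V ∈ S, ∀ x : A.domain, (x : H) ∈ V → A x ∈ V
  dense : Dense ((sSup S : Submodule ℂ H) : Set H)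
  map_sum : ∀ (f : A.domain) (g : S → A.domain), (∀ V : S, (g V : H) ∈ (V : Submodule ℂ H)) →
    HasSum (fun V => (g V : H)) (f : H) → HasSum (fun V => A (g V)) (A f)

/-- Regular operators. -/
def IsRegular (A : H →ₗ.[ℂ] H) : Prop := ∃ S, IsRegularDecomposition A S

/-- Regular operators (without kernel) whose sequence of eigenvalues is admissible. -/
def IsAdmissible (θ : ℝ) (A : H →ₗ.[ℂ] H) : Prop :=
  IsRegular A ∧ ∃ a, IsEigenvalueSeq A a ∧ IsAdmissibleSeq θ a

open Classical in
/-- An enumeration of the eigenvalues of `A` with algebraic multiplicity (if there is one). -/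
def eigenvalueSeq (A : H →ₗ.[ℂ] H) : ℕ → ℂ :=
  if h : ∃ a, IsEigenvalueSeq A a then h.choose else fun _ => 1

/-- `log det A = -ζ_A'(0)`. -/
def logDet (A : H →ₗ.[ℂ] H) : ℂ := logRegProd (eigenvalueSeq A)

/-- The regularized determinant `det A = exp (-ζ_A'(0))`. -/
def det (A : H →ₗ.[ℂ] H) : ℂ := regProd (eigenvalueSeq A)

/-- The operator `A' = P A` on the orthogonal complement of the generalized kernel of `A`, where
`P` is the orthogonal projection onto that complement. -/
def reduced [CompleteSpace H] (A : H →ₗ.[ℂ] H) : (genKer A)ᗮ →ₗ.[ℂ] (genKer A)ᗮ where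
  domain := A.domain.comap (genKer A)ᗮ.subtype
  toFun := ((genKer A)ᗮ.orthogonalProjectionOnto : H →ₗ[ℂ] (genKer A)ᗮ) ∘ₗ A.toFun ∘ₗ
    (genKer A)ᗮ.subtype.restrict (fun _ hx => hx)

/-- Admissibility of an operator that may have a kernel. -/
def IsAdmissibleModKer [CompleteSpace H] (θ : ℝ) (A : H →ₗ.[ℂ] H) : Prop :=
  IsAdmissible θ (reduced A)

/-- The contribution of a heat term `c t ^ α` to the expansion of `-log det (A + u)`: it is
`c (-1)^k / k! (∑_{j=1}^k 1/j - log u) u^k` if `α = -k` with `k = 0, 1, 2, …`, and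
`c Γ(α) u ^ (-α)` otherwise (principal branches). -/
def detTerm (c : ℂ) (α : ℝ) (u : ℂ) : ℂ :=
  if α = -(⌊-α⌋₊ : ℝ) then
    c * ((-1) ^ ⌊-α⌋₊ / (Nat.factorial ⌊-α⌋₊ : ℂ)) *
      ((∑ j ∈ Finset.Icc 1 ⌊-α⌋₊, (1 : ℂ) / (j : ℂ)) - Complex.log u) * u ^ ⌊-α⌋₊
  else c * Complex.Gamma (α : ℂ) * u ^ (-(α : ℂ))

end RegDet

end

/-! ### Generalized eigenspaces, translations and regularity. -/

noncomputable section
namespace RegDet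

variable {H : Type*} [NormedAddCommGroup H] [InnerProductSpace ℂ H]

/-! Everything is a statement about the sequence `b` of eigenvalues. On the operator side, passing
from `A` to `A + l` translates `b` by `l`, and passing to `reduced A` only discards finitely many
zeros, because `genKer A` is stable under `A` and `A - μ` is bijective on it for `μ ≠ 0`
(`algMult_reduced`). Two enumerations with the same multiplicities differ by a permutation, which
affects neither theta nor zeta series.

On the sequence side, `IsThetaSeq` drops the sector condition and survives translation and the
removal of terms: `Θ_{b+l}(t) = e^{-tl} Θ_b(t)`, and the functions with an expansion in real powers
form a ring containing the exponentials. Convergence of the theta series forces `Re b_n → +∞`, so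
for `θ = π` only finitely many terms can endanger the sector condition.

The core is an exact formula, `IsThetaSeq.neg_logRegProd_add_const`. For `Re l` large, `Γ(s) ∑ (b_n
+ l)^{-s}` is the Mellin transform of `e^{-tl} Θ_b(t)`. Splitting off a term `c t^α` of the theta
series contributes `c Γ(s+α)/Γ(s) l^{-s-α}` to the zeta function, with derivative `detTerm c α l` at
`s = 0`. Once the remainder `ρ_N = Θ_b - ∑_{ν<N} c_ν t^{α_ν}` is `O(t^r)` with `r > 0`, its Mellin
integral is analytic at `s = 0`; since `1/Γ(s)` has a simple zero there with derivative `1`, `-log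
det(A + l) = ∑_{ν<N} detTerm (c_ν) (α_ν) l + ∫₀^∞ e^{-tl} ρ_N(t) dt/t`.

This gives analyticity in `l`, the real expansion by estimating the integral, and the expansion on
the imaginary axis by the Riemann–Lebesgue lemma. To reach other `l`, finitely many factors are
split off (`logRegProd_eq_sum_log_add`): the determinant is `∏_{n<M} (b_n + l)` times a nonvanishing
analytic function. These local descriptions agree, which yields the entire function, its zeros and
their orders. -/

theorem mem_kerPow_succ {A : H →ₗ.[ℂ] H} {μ : ℂ} {n : ℕ} {x : H} :
    x ∈ kerPow A μ (n + 1) ↔ ∃ y : A.domain, A y - μ • (y : H) ∈ kerPow A μ n ∧ (y : H) = x := by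
  rw [kerPow, Submodule.mem_map]
  rfl

theorem kerPow_mono (A : H →ₗ.[ℂ] H) (μ : ℂ) : Monotone (kerPow A μ) := by
  refine monotone_nat_of_le_succ fun n => ?_
  induction n with
  | zero => exact bot_le
  | succ n ih =>
    intro x hx
    obtain ⟨y, hy, rfl⟩ := mem_kerPow_succ.1 hx
    exact mem_kerPow_succ.2 ⟨y, ih hy, rfl⟩

theorem mem_genEigenspace {A : H →ₗ.[ℂ] H} {μ : ℂ} {x : H} :
    x ∈ genEigenspace A μ ↔ ∃ n, x ∈ kerPow A μ n :=
  Submodule.mem_iSup_of_directed _ (kerPow_mono A μ).directed_le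

theorem kerPow_shift (A : H →ₗ.[ℂ] H) (l μ : ℂ) (n : ℕ) :
    kerPow (shift A l) μ n = kerPow A (μ - l) n := by
  induction n with
  | zero => rfl
  | succ n ih =>
    ext x
    rw [mem_kerPow_succ, mem_kerPow_succ, ih]
    refine exists_congr fun y : A.domain => ?_
    have : shift A l y - μ • (y : H) = A y - (μ - l) • (y : H) := by
      change (A y + l • (y : H)) - μ • (y : H) = _
      rw [sub_smul]; abel
    rw [← this]

theorem algMult_shift (A : H →ₗ.[ℂ] H) (l μ : ℂ) :
    algMult (shift A l) μ = algMult A (μ - l) := by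
  rw [algMult, algMult, genEigenspace, genEigenspace, funext (kerPow_shift A l μ)]

theorem kerPow_neg (A : H →ₗ.[ℂ] H) (μ : ℂ) (n : ℕ) :
    kerPow (-A) μ n = kerPow A (-μ) n := by
  induction n with
  | zero => rfl
  | succ n ih =>
    ext x
    rw [mem_kerPow_succ, mem_kerPow_succ, ih]
    refine exists_congr fun y : A.domain => ?_
    have : (-A) y - μ • (y : H) = -(A y - (-μ) • (y : H)) := by
      change -(A y) - μ • (y : H) = _
      rw [neg_smul]; abel
    have h2 : (-A) y - μ • (y : H) ∈ kerPow A (-μ) n ↔ A y - (-μ) • (y : H) ∈ kerPow A (-μ) n := by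
      rw [this, neg_mem_iff]
    exact and_congr h2 Iff.rfl

theorem algMult_neg (A : H →ₗ.[ℂ] H) (μ : ℂ) : algMult (-A) μ = algMult A (-μ) := by
  rw [algMult, algMult, genEigenspace, genEigenspace, funext (kerPow_neg A μ)]

/-- If `A - μ` is injective, the chain of kernels never leaves `⊥`; hence the generalized eigenspace
vanishes as soon as its first step does. -/
theorem isEigenvalue_iff_algMult_ne_zero (A : H →ₗ.[ℂ] H) (μ : ℂ) :
    IsEigenvalue A μ ↔ algMult A μ ≠ 0 := by
  have h0 : algMult A μ = 0 ↔ genEigenspace A μ = ⊥ := by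
    rw [algMult, Cardinal.toENat_eq_zero, Submodule.rank_eq_zero]
  have h1 : genEigenspace A μ = ⊥ ↔ kerPow A μ 1 = ⊥ := by
    constructor
    · intro h
      exact le_bot_iff.1 ((le_iSup (kerPow A μ) 1).trans h.le)
    · intro h
      have : ∀ n, kerPow A μ n = ⊥ := by
        intro n
        induction n with
        | zero => rfl
        | succ n ih =>
          rw [← h]
          ext x
          rw [mem_kerPow_succ, mem_kerPow_succ, ih]
          rfl
      simp [genEigenspace, this]
  rw [Ne, h0, h1, ← Ne, Submodule.ne_bot_iff]
  constructor
  · rintro ⟨x, hx, h⟩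
    exact ⟨x, mem_kerPow_succ.2 ⟨x, (Submodule.mem_bot ℂ).2 (sub_eq_zero.2 h), rfl⟩, hx⟩
  · rintro ⟨x, hx, h⟩
    obtain ⟨y, hy, rfl⟩ := mem_kerPow_succ.1 hx
    exact ⟨y, h, sub_eq_zero.1 ((Submodule.mem_bot ℂ).1 hy)⟩

theorem IsRegular.shift {A : H →ₗ.[ℂ] H} (hA : IsRegular A) (l : ℂ) : IsRegular (shift A l) := by
  obtain ⟨S, hS⟩ := hA
  refine ⟨S, hS.finiteDimensional, hS.orthogonal, hS.le_domain, ?_, hS.dense, ?_⟩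
  · intro V hV x hx
    exact V.add_mem (hS.stable V hV x hx) (V.smul_mem l hx)
  · intro f g hg hs
    exact (hS.map_sum f g hg hs).add (hs.const_smul l)

/-! ### Comparison of `A` with its reduction modulo the generalized kernel. -/

section reduced

theorem genKer_le_domain (A : H →ₗ.[ℂ] H) : genKer A ≤ A.domain := by
  intro x hx
  obtain ⟨n, hn⟩ := mem_genEigenspace.1 hx
  obtain ⟨y, -, rfl⟩ := mem_kerPow_succ.1 (kerPow_mono A 0 n.le_succ hn)
  exact y.2

theorem map_mem_genKer {A : H →ₗ.[ℂ] H} (x : A.domain) (hx : (x : H) ∈ genKer A) :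
    A x ∈ genKer A := by
  obtain ⟨n, hn⟩ := mem_genEigenspace.1 hx
  obtain ⟨y, hy, hxy⟩ := mem_kerPow_succ.1 (kerPow_mono A 0 n.le_succ hn)
  obtain rfl : y = x := Subtype.ext hxy
  rw [zero_smul, sub_zero] at hy
  exact mem_genEigenspace.2 ⟨n, hy⟩

theorem eq_zero_of_mem_genKer {A : H →ₗ.[ℂ] H} {μ : ℂ} (hμ : μ ≠ 0) (x : A.domain)
    (hx : (x : H) ∈ genKer A) (h : A x = μ • (x : H)) : (x : H) = 0 := by
  obtain ⟨n, hn⟩ := mem_genEigenspace.1 hx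
  clear hx
  induction n with
  | zero => exact (Submodule.mem_bot ℂ).1 hn
  | succ n ih =>
    obtain ⟨y, hy, hxy⟩ := mem_kerPow_succ.1 hn
    obtain rfl : y = x := Subtype.ext hxy
    rw [zero_smul, sub_zero, h] at hy
    exact ih (((kerPow A 0 n).smul_mem_iff hμ).1 hy)

/-- `A - μ` lowers the level in the `μ`-chain and preserves `genKer A`. By induction it kills `x`,
so `x` would be an honest eigenvector for `μ ≠ 0` inside the generalized kernel. -/
theorem genEigenspace_disjoint_genKer (A : H →ₗ.[ℂ] H) {μ : ℂ} (hμ : μ ≠ 0) {x : H}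
    (hx : x ∈ genEigenspace A μ) (hx0 : x ∈ genKer A) : x = 0 := by
  obtain ⟨n, hn⟩ := mem_genEigenspace.1 hx
  clear hx
  induction n generalizing x with
  | zero => exact (Submodule.mem_bot ℂ).1 hn
  | succ n ih =>
    obtain ⟨y, hy, rfl⟩ := mem_kerPow_succ.1 hn
    have := ih (sub_mem (map_mem_genKer y hx0) (Submodule.smul_mem _ μ hx0)) hy
    exact eq_zero_of_mem_genKer hμ y hx0 (sub_eq_zero.1 this)

/-- On the finite dimensional generalized kernel, `A - μ` is onto for `μ ≠ 0`. -/
theorem exists_sub_smul_eq_of_mem_genKer {A : H →ₗ.[ℂ] H} [FiniteDimensional ℂ (genKer A)] {μ : ℂ}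
    (hμ : μ ≠ 0) {k : H} (hk : k ∈ genKer A) :
    ∃ x : A.domain, (x : H) ∈ genKer A ∧ A x - μ • (x : H) = k := by
  let T : genKer A →ₗ[ℂ] genKer A :=
    ((A.toFun - μ • A.domain.subtype) ∘ₗ Submodule.inclusion (genKer_le_domain A)).codRestrict
      (genKer A) fun x => sub_mem (map_mem_genKer _ x.2) (Submodule.smul_mem _ _ x.2)
  have hT : Function.Injective T := by
    rw [injective_iff_map_eq_zero]
    intro x hx
    have h : A ⟨x, genKer_le_domain A x.2⟩ - μ • (x : H) = 0 := congrArg Subtype.val hx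
    have h' := eq_zero_of_mem_genKer (A := A) hμ ⟨x, genKer_le_domain A x.2⟩ x.2 (sub_eq_zero.1 h)
    exact Subtype.ext h'
  obtain ⟨x, hx⟩ := LinearMap.injective_iff_surjective.1 hT ⟨k, hk⟩
  exact ⟨⟨x, genKer_le_domain A x.2⟩, x.2, congrArg Subtype.val hx⟩

theorem sub_projection_mem (K : Submodule ℂ H) [FiniteDimensional ℂ K] (x : H) :
    x - (Kᗮ.orthogonalProjectionOnto x : H) ∈ K := by
  have := Kᗮ.sub_starProjection_mem_orthogonal x
  rwa [Submodule.orthogonal_orthogonal] at this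

theorem projection_eq_zero_iff (K : Submodule ℂ H) [FiniteDimensional ℂ K] (x : H) :
    Kᗮ.orthogonalProjectionOnto x = 0 ↔ x ∈ K := by
  rw [Submodule.orthogonalProjectionOnto_eq_zero_iff, Submodule.orthogonal_orthogonal]

theorem projection_mem_domain (A : H →ₗ.[ℂ] H) [FiniteDimensional ℂ (genKer A)] (x : A.domain) :
    ((genKer A)ᗮ.orthogonalProjectionOnto (x : H) : H) ∈ A.domain := by
  have := sub_mem x.2 (genKer_le_domain A (sub_projection_mem (genKer A) (x : H)))
  rwa [sub_sub_cancel] at this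

variable [CompleteSpace H]

theorem reduced_apply (A : H →ₗ.[ℂ] H) (y : (reduced A).domain) :
    reduced A y = (genKer A)ᗮ.orthogonalProjectionOnto (A ⟨y, y.2⟩) := rfl

/-- Since `genKer A` is `A`-stable, the projection intertwines `A` with `reduced A`, which therefore
behaves like the operator induced on the quotient by `genKer A`. -/
theorem reduced_projection (A : H →ₗ.[ℂ] H) [FiniteDimensional ℂ (genKer A)] (x : A.domain) :
    reduced A ⟨(genKer A)ᗮ.orthogonalProjectionOnto (x : H), projection_mem_domain A x⟩ =
      (genKer A)ᗮ.orthogonalProjectionOnto (A x) := by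
  rw [reduced_apply, ← sub_eq_zero, ← map_sub, projection_eq_zero_iff, ← A.map_sub]
  apply map_mem_genKer
  have := neg_mem (sub_projection_mem (genKer A) (x : H))
  rwa [neg_sub] at this

/-- One inclusion is the intertwining property. For the other, a chain in the complement lifts only
up to an error in `genKer A`; as `A - μ` is onto there, a correction `k` from `genKer A` removes the
error. -/
theorem map_kerPow (A : H →ₗ.[ℂ] H) [FiniteDimensional ℂ (genKer A)] {μ : ℂ} (hμ : μ ≠ 0) (n : ℕ) :
    (kerPow A μ n).map ((genKer A)ᗮ.orthogonalProjectionOnto : H →ₗ[ℂ] (genKer A)ᗮ) =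
      kerPow (reduced A) μ n := by
  induction n with
  | zero => exact Submodule.map_bot _
  | succ n ih =>
    ext y
    rw [mem_kerPow_succ, Submodule.mem_map, ← ih]
    constructor
    · rintro ⟨x, hx, rfl⟩
      obtain ⟨x, h, rfl⟩ := mem_kerPow_succ.1 hx
      refine ⟨⟨_, projection_mem_domain A x⟩, ?_, rfl⟩
      rw [reduced_projection]
      exact ⟨_, h, by simp⟩
    · rintro ⟨y, hy, rfl⟩
      obtain ⟨z, hz, h⟩ := hy
      obtain ⟨w, hw⟩ : ∃ w : A.domain, (w : H) = ((y : (genKer A)ᗮ) : H) := ⟨⟨y, y.2⟩, rfl⟩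
      have hyw : reduced A y = (genKer A)ᗮ.orthogonalProjectionOnto (A w) := by
        rw [reduced_apply]
        congr 2
        exact Subtype.ext hw.symm
      have hk : z - (A w - μ • (w : H)) ∈ genKer A := by
        rw [← projection_eq_zero_iff, map_sub, sub_eq_zero]
        refine h.trans ?_
        rw [hyw, map_sub, map_smul, hw,
          Submodule.orthogonalProjectionOnto_mem_subspace_eq_self]
      obtain ⟨k, hkK, hk⟩ := exists_sub_smul_eq_of_mem_genKer hμ hk
      refine ⟨((w + k : A.domain) : H), mem_kerPow_succ.2 ⟨_, ?_, rfl⟩, ?_⟩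
      · have : A (w + k) - μ • ((w + k : A.domain) : H) = z := by
          rw [A.map_add, Submodule.coe_add, smul_add]
          rw [eq_sub_iff_add_eq] at hk
          rw [← hk]; abel
        rwa [this]
      · change (genKer A)ᗮ.orthogonalProjectionOnto ((w : H) + (k : H)) = _
        rw [map_add, hw, Submodule.orthogonalProjectionOnto_mem_subspace_eq_self,
          (projection_eq_zero_iff _ _).2 hkK, add_zero]

/-- The projection has kernel `genKer A`, which meets the generalized eigenspace trivially for `μ ≠
0`, so it is an isomorphism between the two generalized eigenspaces. -/
theorem algMult_reduced (A : H →ₗ.[ℂ] H) [FiniteDimensional ℂ (genKer A)] {μ : ℂ} (hμ : μ ≠ 0) :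
    algMult (reduced A) μ = algMult A μ := by
  set P := ((genKer A)ᗮ.orthogonalProjectionOnto : H →ₗ[ℂ] (genKer A)ᗮ) with hP
  have h1 : genEigenspace (reduced A) μ = (genEigenspace A μ).map P := by
    simp only [genEigenspace, Submodule.map_iSup, hP, map_kerPow A hμ]
  have h2 : Function.Injective (P.domRestrict (genEigenspace A μ)) := by
    rw [injective_iff_map_eq_zero]
    intro x hx
    exact Subtype.ext (genEigenspace_disjoint_genKer A hμ x.2
      ((projection_eq_zero_iff _ _).1 hx))
  have h3 := (LinearEquiv.ofInjective _ h2).rank_eq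
  rw [LinearMap.range_domRestrict, ← h1] at h3
  rw [algMult, algMult, h3]

end reduced

/-! ### Enumerations of eigenvalues -/

theorem exists_perm_of_encard_fiber_eq {β : Type*} {a b : ℕ → β}
    (h : ∀ μ, {n | a n = μ}.encard = {n | b n = μ}.encard) :
    ∃ σ : Equiv.Perm ℕ, a = b ∘ σ := by
  have e : ∀ μ, Nonempty ({n // a n = μ} ≃ {n // b n = μ}) := by
    intro μ
    have h' := h μ
    rw [Set.encard, Set.encard, ENat.card, ENat.card] at h'
    -- `encard` loses information only about infinite sets. The fibres are countable, so it still
    -- determines their cardinals, and bijections of fibres glue to a permutation.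
    rcases finite_or_infinite {n // a n = μ} with hf | hf
    · have hc : Cardinal.mk {n // a n = μ} < Cardinal.aleph0 := Cardinal.lt_aleph0_of_finite _
      exact Cardinal.eq.1 (((Cardinal.toENat_eq_iff_of_le_aleph0 hc.le
        (Cardinal.mk_le_aleph0)).1 h'))
    · exact Cardinal.eq.1 (((Cardinal.toENat_eq_iff_of_le_aleph0 (Cardinal.mk_le_aleph0)
        (Cardinal.mk_le_aleph0)).1 h'))
  replace e := fun μ => (e μ).some
  refine ⟨(Equiv.sigmaFiberEquiv a).symm.trans ((Equiv.sigmaCongrRight fun μ => e μ).trans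
    (Equiv.sigmaFiberEquiv b)), ?_⟩
  funext n
  exact ((e (a n) ⟨n, rfl⟩).2).symm

theorem IsEigenvalueSeq.exists_perm {A : H →ₗ.[ℂ] H} {a b : ℕ → ℂ} (ha : IsEigenvalueSeq A a)
    (hb : IsEigenvalueSeq A b) : ∃ σ : Equiv.Perm ℕ, a = b ∘ σ :=
  exists_perm_of_encard_fiber_eq fun μ => (ha μ).trans (hb μ).symm

theorem IsEigenvalueSeq.shift {A : H →ₗ.[ℂ] H} {b : ℕ → ℂ} (hb : IsEigenvalueSeq A b) (l : ℂ) :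
    IsEigenvalueSeq (shift A l) fun n => b n + l := by
  intro μ
  rw [algMult_shift, ← hb (μ - l)]
  simp only [eq_sub_iff_add_eq]

theorem IsEigenvalueSeq.isEigenvalue {A : H →ₗ.[ℂ] H} {b : ℕ → ℂ} (hb : IsEigenvalueSeq A b)
    (n : ℕ) : IsEigenvalue A (b n) := by
  rw [isEigenvalue_iff_algMult_ne_zero, ← hb, Set.encard_ne_zero]
  exact ⟨n, rfl⟩

theorem eigenvalueSeq_spec {A : H →ₗ.[ℂ] H} {b : ℕ → ℂ} (hb : IsEigenvalueSeq A b) :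
    IsEigenvalueSeq A (eigenvalueSeq A) := by
  have h : ∃ a, IsEigenvalueSeq A a := ⟨b, hb⟩
  rw [eigenvalueSeq, dif_pos h]
  exact h.choose_spec

/-- The eigenvalues of `A` are those of `reduced A`, preceded by finitely many zeros. -/
theorem exists_isEigenvalueSeq_of_reduced [CompleteSpace H] {A : H →ₗ.[ℂ] H}
    [FiniteDimensional ℂ (genKer A)] {a : ℕ → ℂ} (ha : IsEigenvalueSeq (reduced A) a)
    (h0 : ∀ n, a n ≠ 0) :
    ∃ (m : ℕ) (b : ℕ → ℂ), IsEigenvalueSeq A b ∧ (∀ n < m, b n = 0) ∧ ∀ n, b (n + m) = a n := by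
  obtain ⟨m, hm⟩ : ∃ m : ℕ, algMult A 0 = m :=
    ⟨Module.finrank ℂ (genKer A), by
      rw [algMult, ← genKer, ← Module.finrank_eq_rank]; simp⟩
  refine ⟨m, fun n => if n < m then 0 else a (n - m), ?_, fun n hn => if_pos hn, fun n => by simp⟩
  intro μ
  by_cases hμ : μ = 0
  · have : {n | (if n < m then 0 else a (n - m)) = μ} = ↑(Finset.range m) := by
      ext n
      simp only [Set.mem_ofPred_eq, Finset.coe_range, Set.mem_Iio, hμ]
      split_ifs with h <;> simp [h, h0]
    rw [this, Set.encard_coe_eq_coe_finsetCard, Finset.card_range, hμ, hm]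
  · rw [← algMult_reduced A hμ, ← ha μ]
    have : {n | (if n < m then 0 else a (n - m)) = μ} = (fun n => n + m) '' {n | a n = μ} := by
      ext n
      simp only [Set.mem_ofPred_eq, Set.mem_image]
      constructor
      · intro h
        split_ifs at h with h'
        · exact absurd h.symm hμ
        · exact ⟨n - m, h, by omega⟩
      · rintro ⟨k, hk, rfl⟩
        simpa using hk
    rw [this, Function.Injective.encard_image (add_left_injective m)]

end RegDet
end

noncomputable section
namespace RegDet
open Filter Topology

/-! ### Generalized power expansions at `0` -/

/-- Evaluation of a finite sum `∑ c_a X ^ a` with real exponents. -/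
def evalPow (t : ℝ) : AddMonoidAlgebra ℂ ℝ →ₐ[ℂ] ℂ :=
  AddMonoidAlgebra.lift ℂ ℂ ℝ
    { toFun := fun a => Complex.exp ((a.toAdd * Real.log t : ℝ) : ℂ)
      map_one' := by simp
      map_mul' := fun a b => by
        rw [toAdd_mul, add_mul, Complex.ofReal_add, Complex.exp_add] }

theorem evalPow_single {t : ℝ} (ht : 0 < t) (a : ℝ) (c : ℂ) :
    evalPow t (AddMonoidAlgebra.single a c) = c * ((t ^ a : ℝ) : ℂ) := by
  rw [evalPow, AddMonoidAlgebra.lift_single, Real.rpow_def_of_pos ht, mul_comm (Real.log t)]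
  simp

theorem evalPow_apply {t : ℝ} (ht : 0 < t) (p : AddMonoidAlgebra ℂ ℝ) :
    evalPow t p = ∑ a ∈ p.coeff.support, p.coeff a * ((t ^ a : ℝ) : ℂ) := by
  rw [evalPow, AddMonoidAlgebra.lift_apply, Finsupp.sum]
  refine Finset.sum_congr rfl fun a _ => ?_
  rw [Real.rpow_def_of_pos ht, mul_comm (Real.log t)]
  simp

theorem norm_sum_pow_le {s : Finset ℝ} (d : ℝ → ℂ) {r : ℝ} (h : ∀ a ∈ s, r ≤ a) {t : ℝ}
    (ht : t ∈ Set.Ioo (0 : ℝ) 1) :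
    ‖∑ a ∈ s, d a * ((t ^ a : ℝ) : ℂ)‖ ≤ (∑ a ∈ s, ‖d a‖) * t ^ r := by
  rw [Finset.sum_mul]
  refine (norm_sum_le _ _).trans (Finset.sum_le_sum fun a ha => ?_)
  rw [norm_mul, Complex.norm_real, Real.norm_of_nonneg (Real.rpow_nonneg ht.1.le _)]
  exact mul_le_mul_of_nonneg_left (Real.rpow_le_rpow_of_exponent_ge ht.1 ht.2.le (h a ha))
    (norm_nonneg _)

theorem norm_evalPow_le (p : AddMonoidAlgebra ℂ ℝ) {r : ℝ} (h : ∀ a ∈ p.coeff.support, r ≤ a)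
    {t : ℝ} (ht : t ∈ Set.Ioo (0 : ℝ) 1) :
    ‖evalPow t p‖ ≤ (∑ a ∈ p.coeff.support, ‖p.coeff a‖) * t ^ r := by
  rw [evalPow_apply ht.1]
  exact norm_sum_pow_le _ h ht

theorem exists_norm_evalPow_le (p : AddMonoidAlgebra ℂ ℝ) :
    ∃ r C : ℝ, 0 ≤ C ∧ ∀ t ∈ Set.Ioo (0 : ℝ) 1, ‖evalPow t p‖ ≤ C * t ^ r := by
  obtain ⟨r, hr⟩ := p.coeff.support.bddBelow
  exact ⟨r, _, Finset.sum_nonneg fun _ _ => norm_nonneg _,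
    fun t ht => norm_evalPow_le p (fun a ha => hr ha) ht⟩

/-- A generalized polynomial that is `O(t ^ r)` has no exponent below `r`. -/
theorem le_of_norm_evalPow_le {p : AddMonoidAlgebra ℂ ℝ} {r C : ℝ}
    (h : ∀ t ∈ Set.Ioo (0 : ℝ) 1, ‖evalPow t p‖ ≤ C * t ^ r) {a : ℝ} (ha : a ∈ p.coeff.support) :
    r ≤ a := by
  -- `m` is the lowest exponent. If `m < r`, dividing by `t ^ m` and letting `t → 0` isolates the
  -- coefficient at `m` and forces it to vanish.
  set m := p.coeff.support.min' ⟨a, ha⟩ with hm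
  have hmem : m ∈ p.coeff.support := Finset.min'_mem _ _
  suffices r ≤ m from this.trans (Finset.min'_le _ _ ha)
  by_contra! hlt
  have hIoo : Set.Ioo (0 : ℝ) 1 ∈ 𝓝[>] (0 : ℝ) := Ioo_mem_nhdsGT one_pos
  have hpow : ∀ e : ℝ, 0 < e → Tendsto (fun t : ℝ => t ^ e) (𝓝[>] 0) (𝓝 0) := fun e he => by
    have := (Real.continuousAt_rpow_const 0 e (Or.inr he.le)).tendsto
    rw [Real.zero_rpow he.ne'] at this
    exact this.mono_left nhdsWithin_le_nhds
  have key : ∀ t ∈ Set.Ioo (0 : ℝ) 1, ‖p.coeff m‖ ≤ C * t ^ (r - m) +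
      ∑ a ∈ p.coeff.support.erase m, ‖p.coeff a‖ * t ^ (a - m) := by
    intro t ht
    have h1 := h t ht
    rw [evalPow_apply ht.1, ← Finset.add_sum_erase _ _ hmem] at h1
    have h2 : ‖p.coeff m‖ * t ^ m ≤ C * t ^ r +
        ∑ a ∈ p.coeff.support.erase m, ‖p.coeff a‖ * t ^ a := by
      have h3 : ‖p.coeff m * ((t ^ m : ℝ) : ℂ)‖ = ‖p.coeff m‖ * t ^ m := by
        rw [norm_mul, Complex.norm_real, Real.norm_of_nonneg (Real.rpow_nonneg ht.1.le _)]
      have h4 : ‖∑ a ∈ p.coeff.support.erase m, p.coeff a * ((t ^ a : ℝ) : ℂ)‖ ≤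
          ∑ a ∈ p.coeff.support.erase m, ‖p.coeff a‖ * t ^ a := by
        refine (norm_sum_le _ _).trans (Finset.sum_le_sum fun a _ => ?_)
        rw [norm_mul, Complex.norm_real, Real.norm_of_nonneg (Real.rpow_nonneg ht.1.le _)]
      have h5 := norm_sub_le (p.coeff m * ((t ^ m : ℝ) : ℂ) +
        ∑ a ∈ p.coeff.support.erase m, p.coeff a * ((t ^ a : ℝ) : ℂ))
        (∑ a ∈ p.coeff.support.erase m, p.coeff a * ((t ^ a : ℝ) : ℂ))
      rw [add_sub_cancel_right, h3] at h5
      linarith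
    have htm : 0 < t ^ m := Real.rpow_pos_of_pos ht.1 _
    rw [← le_div_iff₀ htm] at h2
    refine h2.trans (le_of_eq ?_)
    rw [add_div, mul_div_assoc, Real.rpow_sub ht.1, Finset.sum_div]
    simp_rw [mul_div_assoc, ← Real.rpow_sub ht.1]
  by_cases hCneg : r - m ≤ 0
  · have : r - m < 0 := by linarith
    clear key
    linarith
  have hr : 0 < r - m := by linarith
  have hlim : Tendsto (fun t : ℝ => C * t ^ (r - m) +
      ∑ a ∈ p.coeff.support.erase m, ‖p.coeff a‖ * t ^ (a - m)) (𝓝[>] 0) (𝓝 (C * 0 +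
      ∑ a ∈ p.coeff.support.erase m, ‖p.coeff a‖ * 0)) := by
    refine ((hpow _ hr).const_mul C).add (tendsto_finsetSum _ fun a ha => ?_)
    refine (hpow _ ?_).const_mul _
    have := Finset.min'_le _ _ (Finset.mem_of_mem_erase ha)
    have := lt_of_le_of_ne (hm ▸ this) (Finset.ne_of_mem_erase ha).symm
    linarith
  have := ge_of_tendsto hlim (by filter_upwards [hIoo] with t ht using key t ht)
  simp only [mul_zero, Finset.sum_const_zero, add_zero] at this
  exact Finsupp.mem_support_iff.1 hmem (norm_le_zero_iff.1 this)

/-- `f` has an asymptotic expansion in real powers of `t` at `0`. -/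
def HasPowerExp (f : ℝ → ℂ) : Prop :=
  ∀ r : ℝ, ∃ (p : AddMonoidAlgebra ℂ ℝ) (C : ℝ), ∀ t ∈ Set.Ioo (0 : ℝ) 1,
    ‖f t - evalPow t p‖ ≤ C * t ^ r

theorem HasPowerExp.congr {f g : ℝ → ℂ} (hf : HasPowerExp f) (h : ∀ t, 0 < t → f t = g t) :
    HasPowerExp g := fun r => by
  obtain ⟨p, C, hp⟩ := hf r
  exact ⟨p, C, fun t ht => by rw [← h t ht.1]; exact hp t ht⟩

theorem HasPowerExp.add {f g : ℝ → ℂ} (hf : HasPowerExp f) (hg : HasPowerExp g) :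
    HasPowerExp (fun t => f t + g t) := fun r => by
  obtain ⟨p, C, hp⟩ := hf r
  obtain ⟨q, D, hq⟩ := hg r
  refine ⟨p + q, C + D, fun t ht => ?_⟩
  rw [map_add, add_sub_add_comm, add_mul]
  exact (norm_add_le _ _).trans (add_le_add (hp t ht) (hq t ht))

theorem HasPowerExp.exists_norm_le {f : ℝ → ℂ} (hf : HasPowerExp f) :
    ∃ r C : ℝ, 0 ≤ C ∧ ∀ t ∈ Set.Ioo (0 : ℝ) 1, ‖f t‖ ≤ C * t ^ r := by
  obtain ⟨p, C, hp⟩ := hf 0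
  obtain ⟨r, D, hD, hr⟩ := exists_norm_evalPow_le p
  refine ⟨min r 0, |C| + D, by positivity, fun t ht => ?_⟩
  have h1 : t ^ r ≤ t ^ min r 0 :=
    Real.rpow_le_rpow_of_exponent_ge ht.1 ht.2.le (min_le_left _ _)
  have h2 : t ^ (0 : ℝ) ≤ t ^ min r 0 :=
    Real.rpow_le_rpow_of_exponent_ge ht.1 ht.2.le (min_le_right _ _)
  calc ‖f t‖ = ‖(f t - evalPow t p) + evalPow t p‖ := by rw [sub_add_cancel]
    _ ≤ C * t ^ (0 : ℝ) + D * t ^ r := (norm_add_le _ _).trans (add_le_add (hp t ht) (hr t ht))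
    _ ≤ |C| * t ^ min r 0 + D * t ^ min r 0 := by
        refine add_le_add (mul_le_mul (le_abs_self C) h2 ?_ (abs_nonneg C))
          (mul_le_mul_of_nonneg_left h1 hD)
        exact Real.rpow_nonneg ht.1.le _
    _ = _ := by ring

theorem HasPowerExp.mul {f g : ℝ → ℂ} (hf : HasPowerExp f) (hg : HasPowerExp g) :
    HasPowerExp (fun t => f t * g t) := fun r => by
  obtain ⟨a, A, hA, ha⟩ := hf.exists_norm_le
  -- Each factor is approximated to an order that compensates the possible blow-up of the other: `g`
  -- to order `r - a` against `f = O(t ^ a)`, then `f` to order `r - b` against `q = O(t ^ b)`.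
  obtain ⟨q, D, hq⟩ := hg (r - a)
  obtain ⟨b, B, hB, hb⟩ := exists_norm_evalPow_le q
  obtain ⟨p, C, hp⟩ := hf (r - b)
  refine ⟨p * q, A * D + C * B, fun t ht => ?_⟩
  have h1 : f t * g t - evalPow t (p * q) =
      f t * (g t - evalPow t q) + (f t - evalPow t p) * evalPow t q := by
    rw [map_mul]; ring
  rw [h1, add_mul]
  refine (norm_add_le _ _).trans (add_le_add ?_ ?_)
  · rw [norm_mul]
    calc _ ≤ (A * t ^ a) * (D * t ^ (r - a)) :=
          mul_le_mul (ha t ht) (hq t ht) (norm_nonneg _)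
            (mul_nonneg hA (Real.rpow_nonneg ht.1.le _))
      _ = A * D * (t ^ a * t ^ (r - a)) := by ring
      _ = _ := by rw [← Real.rpow_add ht.1, add_sub_cancel]
  · rw [norm_mul]
    calc _ ≤ (C * t ^ (r - b)) * (B * t ^ b) :=
          mul_le_mul (hp t ht) (hb t ht) (norm_nonneg _) ((norm_nonneg _).trans (hp t ht))
      _ = C * B * (t ^ (r - b) * t ^ b) := by ring
      _ = _ := by rw [← Real.rpow_add ht.1, sub_add_cancel]

theorem hasPowerExp_const (c : ℂ) : HasPowerExp fun _ => c := fun r =>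
  ⟨AddMonoidAlgebra.single 0 c, 0, fun t ht => by simp [evalPow_single ht.1]⟩

theorem hasPowerExp_exp (l : ℂ) : HasPowerExp fun t => Complex.exp (-(t : ℂ) * l) := fun r => by
  obtain ⟨n, hn⟩ := exists_nat_ge r
  refine ⟨∑ m ∈ Finset.range n, AddMonoidAlgebra.single (m : ℝ) ((-l) ^ m / (m.factorial : ℂ)),
    ‖l‖ ^ n * Real.exp ‖l‖, fun t ht => ?_⟩
  have h1 : evalPow t (∑ m ∈ Finset.range n,
      AddMonoidAlgebra.single (m : ℝ) ((-l) ^ m / (m.factorial : ℂ))) =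
      ∑ m ∈ Finset.range n, (-(t : ℂ) * l) ^ m / (m.factorial : ℂ) := by
    rw [map_sum]
    refine Finset.sum_congr rfl fun m _ => ?_
    rw [evalPow_single ht.1, Real.rpow_natCast]
    push_cast
    rw [neg_mul, ← mul_neg, mul_pow]
    ring
  rw [h1]
  refine (Complex.norm_exp_sub_sum_le_norm_mul_exp _ n).trans ?_
  have h2 : ‖-(t : ℂ) * l‖ = t * ‖l‖ := by
    rw [norm_mul, norm_neg, Complex.norm_real, Real.norm_of_nonneg ht.1.le]
  rw [h2, mul_pow]
  have h3 : t ^ n ≤ t ^ r := by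
    rw [← Real.rpow_natCast]
    exact Real.rpow_le_rpow_of_exponent_ge ht.1 ht.2.le hn
  have h4 : Real.exp (t * ‖l‖) ≤ Real.exp ‖l‖ :=
    Real.exp_le_exp.2 (mul_le_of_le_one_left (norm_nonneg _) ht.2.le)
  calc t ^ n * ‖l‖ ^ n * Real.exp (t * ‖l‖) ≤ t ^ r * ‖l‖ ^ n * Real.exp ‖l‖ := by
        have := Real.rpow_nonneg ht.1.le r
        gcongr
    _ = _ := by ring

theorem HasHeatExpansion.hasPowerExp {a : ℕ → ℂ} {c : ℕ → ℂ} {α : ℕ → ℝ}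
    (h : HasHeatExpansion a c α) : HasPowerExp (theta a) := fun r => by
  obtain ⟨N, hN⟩ := ((h.tendsto.comp (tendsto_add_atTop_nat 1)).eventually_ge_atTop r).exists
  obtain ⟨C, hC⟩ := h.bound N
  refine ⟨∑ ν ∈ Finset.range (N + 1), AddMonoidAlgebra.single (α ν) (c ν), |C|, fun t ht => ?_⟩
  rw [map_sum, Finset.sum_congr rfl fun ν _ => evalPow_single ht.1 (α ν) (c ν)]
  refine (hC t ht).trans (mul_le_mul (le_abs_self C) ?_ (Real.rpow_nonneg ht.1.le _)
    (abs_nonneg C))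
  exact Real.rpow_le_rpow_of_exponent_ge ht.1 ht.2.le hN

/-- An unbounded set of reals that is finite below every bound is the range of an increasing
sequence. -/
theorem exists_strictMono_range_eq {S : Set ℝ} (hfin : ∀ r : ℝ, (S ∩ Set.Iio r).Finite)
    (hunb : ∀ r : ℝ, ∃ x ∈ S, r < x) :
    ∃ α : ℕ → ℝ, StrictMono α ∧ Tendsto α atTop atTop ∧ Set.range α = S := by
  -- Discreteness from below provides a successor in `S` of every real number; iterating it from a
  -- point `x₀` below `S` enumerates `S`.
  have hnext : ∀ r : ℝ, ∃ x ∈ S, r < x ∧ ∀ y ∈ S, r < y → x ≤ y := by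
    intro r
    obtain ⟨z, hz, hrz⟩ := hunb r
    have hF : (S ∩ Set.Ioc r z).Finite :=
      (hfin (z + 1)).subset fun y hy => ⟨hy.1, by have := hy.2.2; simp; linarith⟩
    obtain ⟨x, hx, hmin⟩ := Set.exists_min_image _ id hF ⟨z, hz, hrz, le_rfl⟩
    refine ⟨x, hx.1, hx.2.1, fun y hy hry => ?_⟩
    by_cases hyz : y ≤ z
    · exact hmin y ⟨hy, hry, hyz⟩
    · exact hx.2.2.trans (not_le.1 hyz).le
  choose next hS hlt hmin using hnext
  obtain ⟨x₀, hx₀⟩ : ∃ x₀, ∀ y ∈ S, x₀ < y := by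
    obtain ⟨m, hm⟩ := (hfin 0).bddBelow
    refine ⟨min m 0 - 1, fun y hy => ?_⟩
    by_cases h : y < 0
    · have := hm ⟨hy, h⟩; have := min_le_left m 0; linarith
    · have := min_le_right m 0; linarith
  let α : ℕ → ℝ := fun n => Nat.rec (next x₀) (fun _ x => next x) n
  have hα : ∀ n, α n ∈ S := by
    intro n; cases n <;> exact hS _
  have hmono : StrictMono α := strictMono_nat_of_lt_succ fun n => hlt (α n)
  have htend : Tendsto α atTop atTop := by
    refine tendsto_atTop_atTop_of_monotone hmono.monotone fun r => ?_
    by_contra! h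
    exact Set.infinite_of_injective_forall_mem hmono.injective
      (s := S ∩ Set.Iio r) (fun n => ⟨hα n, h n⟩) (hfin r)
  refine ⟨α, hmono, htend, Set.Subset.antisymm (Set.range_subset_iff.2 hα) fun y hy => ?_⟩
  have hex : ∃ n, y ≤ α n := (htend.eventually_ge_atTop y).exists
  obtain ⟨k, hk, hkmin⟩ : ∃ k, y ≤ α k ∧ ∀ m < k, α m < y := by
    classical
    exact ⟨Nat.find hex, Nat.find_spec hex, fun m hm => not_le.1 (Nat.find_min hex hm)⟩
  refine ⟨k, le_antisymm ?_ hk⟩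
  cases k with
  | zero => exact hmin x₀ y hy (hx₀ y hy)
  | succ m => exact hmin (α m) y hy (hkmin m m.lt_succ_self)

/-- Converse of `HasHeatExpansion.hasPowerExp`. Two approximants of orders `m ≤ n` have the same
coefficients below `m`, since a generalized polynomial that is `O(t ^ m)` has no lower exponents;
the stable coefficients define the expansion. -/
theorem HasPowerExp.exists_hasHeatExpansion {a : ℕ → ℂ} (h : HasPowerExp (theta a)) :
    ∃ c α, HasHeatExpansion a c α := by
  choose p C hp using fun n : ℕ => h n
  have hstab : ∀ m n : ℕ, m ≤ n → ∀ x : ℝ, x < m → (p m).coeff x = (p n).coeff x := by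
    intro m n hmn x hx
    have hb : ∀ t ∈ Set.Ioo (0 : ℝ) 1, ‖evalPow t (p m - p n)‖ ≤ (|C m| + |C n|) * t ^ (m : ℝ) := by
      intro t ht
      have h1 : evalPow t (p m - p n) =
          (theta a t - evalPow t (p n)) - (theta a t - evalPow t (p m)) := by
        rw [map_sub]; ring
      have h2 : t ^ (n : ℝ) ≤ t ^ (m : ℝ) :=
        Real.rpow_le_rpow_of_exponent_ge ht.1 ht.2.le (by exact_mod_cast hmn)
      rw [h1]
      calc _ ≤ C n * t ^ (n : ℝ) + C m * t ^ (m : ℝ) :=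
            (norm_sub_le _ _).trans (add_le_add (hp n t ht) (hp m t ht))
        _ ≤ |C n| * t ^ (m : ℝ) + |C m| * t ^ (m : ℝ) := by
            have := Real.rpow_nonneg ht.1.le (m : ℝ)
            have := Real.rpow_nonneg ht.1.le (n : ℝ)
            gcongr
            · exact le_abs_self _
            · exact le_abs_self _
        _ = _ := by ring
    have h3 : x ∉ (p m - p n).coeff.support := fun hmem =>
      (le_of_norm_evalPow_le hb hmem).not_gt hx
    have h4 : (p m - p n).coeff x = 0 := Finsupp.notMem_support_iff.1 h3
    have h5 : (p m - p n).coeff x = (p m).coeff x - (p n).coeff x := by simp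
    rw [h5] at h4
    exact sub_eq_zero.1 h4
  -- The coefficient at `x` is stable from any order above `x`, and `⌊x⌋₊ + 1` is such an order.
  let d : ℝ → ℂ := fun x => (p (⌊x⌋₊ + 1)).coeff x
  have hd : ∀ (n : ℕ) (x : ℝ), x < n → d x = (p n).coeff x := by
    intro n x hx
    by_cases hn : n = 0
    · subst hn
      have hfl : ⌊x⌋₊ = 0 := Nat.floor_of_nonpos (by simpa using hx.le)
      simp only [d, hfl]
      exact (hstab 0 1 (Nat.zero_le _) x hx).symm
    · refine hstab _ _ ?_ x (by exact_mod_cast Nat.lt_floor_add_one x)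
      rw [Nat.succ_le_iff]
      exact (Nat.floor_lt' hn).2 hx
  -- The natural numbers are added, possibly with coefficient `0`, so that there are infinitely many
  -- exponents even when the expansion is finite.
  let S : Set ℝ := {x | d x ≠ 0} ∪ Set.range ((↑) : ℕ → ℝ)
  have hfin : ∀ r : ℝ, (S ∩ Set.Iio r).Finite := by
    intro r
    obtain ⟨n, hn⟩ := exists_nat_ge r
    refine (((p n).coeff.support.finite_toSet).union
      ((Finset.range n).finite_toSet.image ((↑) : ℕ → ℝ))).subset ?_
    rintro x ⟨hx | ⟨k, rfl⟩, hxr⟩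
    · left
      rw [Finset.mem_coe, Finsupp.mem_support_iff, ← hd n x (lt_of_lt_of_le hxr hn)]
      exact hx
    · right
      refine ⟨k, ?_, rfl⟩
      have : (k : ℝ) < n := lt_of_lt_of_le hxr hn
      simpa using this
  have hunb : ∀ r : ℝ, ∃ x ∈ S, r < x := fun r => by
    obtain ⟨n, hn⟩ := exists_nat_gt r
    exact ⟨n, Or.inr ⟨n, rfl⟩, hn⟩
  obtain ⟨α, hmono, htend, hrange⟩ := exists_strictMono_range_eq hfin hunb
  refine ⟨fun ν => d (α ν), α, hmono.monotone, htend, fun N => ?_⟩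
  obtain ⟨n, hn⟩ := exists_nat_ge (α (N + 1))
  classical
  set T := (p n).coeff.support.filter fun x => α (N + 1) ≤ x
  refine ⟨|C n| + ∑ x ∈ T, ‖(p n).coeff x‖, fun t ht => ?_⟩
  have hlow : ∑ ν ∈ Finset.range (N + 1), d (α ν) * ((t ^ α ν : ℝ) : ℂ) =
      ∑ x ∈ (p n).coeff.support.filter fun x => ¬ α (N + 1) ≤ x,
        (p n).coeff x * ((t ^ x : ℝ) : ℂ) := by
    rw [← Finset.sum_image (s := Finset.range (N + 1)) (g := α)
      (f := fun x => d x * ((t ^ x : ℝ) : ℂ)) (fun x _ y _ h => hmono.injective h)]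
    symm
    refine Finset.sum_subset_zero_on_sdiff ?_ ?_ ?_
    · intro x hx
      rw [Finset.mem_filter, not_le] at hx
      have hxd : d x ≠ 0 := by
        rw [hd n x (hx.2.trans_le hn)]
        exact Finsupp.mem_support_iff.1 hx.1
      have : x ∈ Set.range α := hrange ▸ Or.inl hxd
      obtain ⟨ν, rfl⟩ := this
      exact Finset.mem_image_of_mem _ (Finset.mem_range.2 (hmono.lt_iff_lt.1 hx.2))
    · intro x hx
      rw [Finset.mem_sdiff, Finset.mem_image] at hx
      obtain ⟨⟨ν, hν, rfl⟩, h2⟩ := hx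
      have hlt : α ν < α (N + 1) := hmono (Finset.mem_range.1 hν)
      rw [Finset.mem_filter, not_and, not_not] at h2
      have : α ν ∉ (p n).coeff.support := fun h => (h2 h).not_gt hlt
      rw [hd n _ (hlt.trans_le hn), Finsupp.notMem_support_iff.1 this, zero_mul]
    · intro x hx
      rw [Finset.mem_filter, not_le] at hx
      rw [hd n x (hx.2.trans_le hn)]
  have hsplit := Finset.sum_filter_add_sum_filter_not (p n).coeff.support
    (fun x => α (N + 1) ≤ x) (fun x => (p n).coeff x * ((t ^ x : ℝ) : ℂ))
  rw [← evalPow_apply ht.1, ← hlow] at hsplit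
  have h1 : theta a t - ∑ ν ∈ Finset.range (N + 1), d (α ν) * ((t ^ α ν : ℝ) : ℂ) =
      (theta a t - evalPow t (p n)) + ∑ x ∈ T, (p n).coeff x * ((t ^ x : ℝ) : ℂ) := by
    rw [← hsplit]; ring
  rw [h1, add_mul]
  refine (norm_add_le _ _).trans (add_le_add ?_ ?_)
  · refine (hp n t ht).trans (mul_le_mul (le_abs_self _) ?_ (Real.rpow_nonneg ht.1.le _)
      (abs_nonneg _))
    exact Real.rpow_le_rpow_of_exponent_ge ht.1 ht.2.le hn
  · exact norm_sum_pow_le _ (fun x hx => (Finset.mem_filter.1 hx).2) ht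

end RegDet
end

noncomputable section
namespace RegDet
open Filter Topology

/-! ### Sequences with a theta series -/

/-- The conditions on a sequence in the definition of admissibility that are insensitive to
translations and to changing finitely many terms. -/
structure IsThetaSeq (b : ℕ → ℂ) : Prop where
  summable_inv_pow : ∃ k : ℕ, Summable fun n => ‖((b n) ^ k)⁻¹‖
  summable_theta : ∀ t : ℝ, 0 < t → Summable fun n => Complex.exp (-(t : ℂ) * b n)
  hasPowerExp : HasPowerExp (theta b)

theorem IsAdmissibleSeq.isThetaSeq {θ : ℝ} {a : ℕ → ℂ} (h : IsAdmissibleSeq θ a) :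
    IsThetaSeq a := by
  obtain ⟨c, α, hc⟩ := h.expansion
  exact ⟨h.summable_inv_pow, h.summable_theta, hc.hasPowerExp⟩

theorem norm_exp_neg_mul (t : ℝ) (z : ℂ) :
    ‖Complex.exp (-(t : ℂ) * z)‖ = Real.exp (-t * z.re) := by
  rw [Complex.norm_exp]; simp

theorem theta_comp_perm (b : ℕ → ℂ) (σ : Equiv.Perm ℕ) : theta (b ∘ σ) = theta b := by
  funext t
  exact σ.tsum_eq fun n => Complex.exp (-(t : ℂ) * b n)

theorem theta_add_const (b : ℕ → ℂ) (l : ℂ) (t : ℝ) :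
    theta (fun n => b n + l) t = Complex.exp (-(t : ℂ) * l) * theta b t := by
  rw [theta, theta, ← tsum_mul_left]
  refine tsum_congr fun n => ?_
  rw [← Complex.exp_add]
  ring_nf

theorem sum_add_theta_tail {b : ℕ → ℂ} {t : ℝ}
    (h : Summable fun n => Complex.exp (-(t : ℂ) * b n)) (M : ℕ) :
    ∑ n ∈ Finset.range M, Complex.exp (-(t : ℂ) * b n) + theta (fun n => b (n + M)) t =
      theta b t :=
  h.sum_add_tsum_nat_add M

namespace IsThetaSeq

variable {b : ℕ → ℂ}

/-- The terms of the series at `t = 1` tend to `0` and have norm `exp (-Re b_n)`. Hence every right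
half plane contains all but finitely many terms. -/
theorem tendsto_re (hb : IsThetaSeq b) : Tendsto (fun n => (b n).re) atTop atTop := by
  have h := (hb.summable_theta 1 one_pos).norm.tendsto_atTop_zero
  simp_rw [norm_exp_neg_mul] at h
  have := Real.tendsto_exp_comp_nhds_zero.1 h
  simpa [Function.comp_def] using tendsto_neg_atBot_atTop.comp this

theorem tendsto_norm (hb : IsThetaSeq b) : Tendsto (fun n => ‖b n‖) atTop atTop :=
  tendsto_atTop_mono (fun n => Complex.re_le_norm (b n)) hb.tendsto_re

theorem comp_perm (hb : IsThetaSeq b) (σ : Equiv.Perm ℕ) : IsThetaSeq (b ∘ σ) := by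
  obtain ⟨k, hk⟩ := hb.summable_inv_pow
  refine ⟨⟨k, (σ.summable_iff (f := fun n => ‖((b n) ^ k)⁻¹‖)).2 hk⟩, fun t ht =>
    (σ.summable_iff (f := fun n => Complex.exp (-(t : ℂ) * b n))).2 (hb.summable_theta t ht), ?_⟩
  rw [theta_comp_perm]
  exact hb.hasPowerExp

theorem hasPowerExp_sum_exp (b : ℕ → ℂ) (c : ℂ) (M : ℕ) : HasPowerExp fun t =>
    c * ∑ n ∈ Finset.range M, Complex.exp (-(t : ℂ) * b n) := by
  induction M with
  | zero => simpa using hasPowerExp_const 0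
  | succ M ih =>
    refine (ih.add ((hasPowerExp_const c).mul (hasPowerExp_exp (b M)))).congr fun t _ => ?_
    rw [Finset.sum_range_succ, mul_add]

theorem tail_iff (M : ℕ) : IsThetaSeq (fun n => b (n + M)) ↔ IsThetaSeq b := by
  have h1 : ∀ k : ℕ, (Summable fun n => ‖((b (n + M)) ^ k)⁻¹‖) ↔
      Summable fun n => ‖((b n) ^ k)⁻¹‖ := fun k =>
    summable_nat_add_iff (f := fun n => ‖((b n) ^ k)⁻¹‖) M
  have h2 : ∀ t : ℝ, (Summable fun n => Complex.exp (-(t : ℂ) * b (n + M))) ↔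
      Summable fun n => Complex.exp (-(t : ℂ) * b n) := fun t =>
    summable_nat_add_iff (f := fun n => Complex.exp (-(t : ℂ) * b n)) M
  constructor
  · rintro ⟨⟨k, hk⟩, h, hp⟩
    refine ⟨⟨k, (h1 k).1 hk⟩, fun t ht => (h2 t).1 (h t ht), ?_⟩
    refine ((hasPowerExp_sum_exp b 1 M).add hp).congr fun t ht => ?_
    rw [one_mul]
    exact sum_add_theta_tail ((h2 t).1 (h t ht)) M
  · rintro ⟨⟨k, hk⟩, h, hp⟩
    refine ⟨⟨k, (h1 k).2 hk⟩, fun t ht => (h2 t).2 (h t ht), ?_⟩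
    refine ((hasPowerExp_sum_exp b (-1) M).add hp).congr fun t ht => ?_
    rw [← sum_add_theta_tail (h t ht) M]
    ring

theorem add_const (hb : IsThetaSeq b) (l : ℂ) : IsThetaSeq fun n => b n + l := by
  refine ⟨?_, fun t ht => ?_, ?_⟩
  · obtain ⟨k, hk⟩ := hb.summable_inv_pow
    refine ⟨k, Summable.of_norm_bounded_eventually_nat (hk.mul_left (2 ^ k)) ?_⟩
    -- Once `‖b n‖ > 2 ‖l‖`, translation at most halves the norm, which accounts for the factor `2 ^
    -- k`.
    filter_upwards [hb.tendsto_norm.eventually_gt_atTop (2 * ‖l‖)] with n hn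
    have h0 : 0 < ‖b n‖ := lt_of_le_of_lt (by positivity) hn
    have h1 : ‖b n‖ / 2 ≤ ‖b n + l‖ := by
      have := norm_sub_le (b n + l) l
      rw [add_sub_cancel_right] at this
      linarith
    rw [norm_norm, norm_inv, norm_inv, norm_pow, norm_pow, ← inv_pow, ← inv_pow, ← mul_pow]
    refine pow_le_pow_left₀ (by positivity) ?_ k
    have : (‖b n + l‖)⁻¹ ≤ (‖b n‖ / 2)⁻¹ := inv_anti₀ (by positivity) h1
    rwa [inv_div, div_eq_mul_inv] at this
  · refine ((hb.summable_theta t ht).mul_left (Complex.exp (-(t : ℂ) * l))).congr fun n => ?_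
    rw [← Complex.exp_add]
    ring_nf
  · exact ((hasPowerExp_exp l).mul hb.hasPowerExp).congr fun t _ => (theta_add_const b l t).symm

theorem tail (hb : IsThetaSeq b) (M : ℕ) : IsThetaSeq fun n => b (n + M) := (tail_iff M).2 hb

theorem exists_le_re (hb : IsThetaSeq b) : ∃ R : ℝ, ∀ n, -R ≤ (b n).re := by
  obtain ⟨m, hm⟩ := bddBelow_range_of_tendsto_atTop_atTop hb.tendsto_re
  exact ⟨-m, fun n => by rw [neg_neg]; exact hm ⟨n, rfl⟩⟩

theorem exists_tail_le_re (hb : IsThetaSeq b) (R : ℝ) : ∃ M : ℕ, ∀ n, R ≤ (b (n + M)).re := by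
  obtain ⟨M, hM⟩ := eventually_atTop.1 (hb.tendsto_re.eventually_ge_atTop R)
  exact ⟨M, fun n => hM _ (Nat.le_add_left _ _)⟩

theorem isAdmissibleSeq (hb : IsThetaSeq b) {θ : ℝ} (h0 : ∀ n, b n ≠ 0)
    (hs : ∃ ε > 0, ∀ n, |(b n).arg| < θ - ε) : IsAdmissibleSeq θ b :=
  ⟨h0, hs, hb.summable_inv_pow, hb.summable_theta, hb.hasPowerExp.exists_hasHeatExpansion⟩

/-- All but finitely many terms satisfy `Re ≥ 0`, that is `|arg| ≤ π / 2`. The finitely many others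
have `|arg| < π`, so one `ε` serves for all. -/
theorem isAdmissibleSeq_pi (hb : IsThetaSeq b) (h : ∀ n, b n ∈ Complex.slitPlane) :
    IsAdmissibleSeq Real.pi b := by
  refine hb.isAdmissibleSeq (fun n => Complex.slitPlane_ne_zero (h n)) ?_
  obtain ⟨M, hM⟩ := hb.exists_tail_le_re 0
  have hfin : ∃ x < Real.pi, ∀ n < M, |(b n).arg| ≤ x := by
    clear hM
    induction M with
    | zero => exact ⟨0, Real.pi_pos, by simp⟩
    | succ M ih =>
      obtain ⟨x, hx, hxn⟩ := ih
      refine ⟨max x |(b M).arg|, max_lt hx ?_, fun n hn => ?_⟩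
      · have h1 := Complex.mem_slitPlane_iff_arg.1 (h M)
        exact abs_lt.2 ⟨Complex.neg_pi_lt_arg _, lt_of_le_of_ne (Complex.arg_le_pi _) h1.1⟩
      · rcases Nat.lt_succ_iff_lt_or_eq.1 hn with hn | rfl
        · exact (hxn n hn).trans (le_max_left _ _)
        · exact le_max_right _ _
  obtain ⟨x, hx, hxn⟩ := hfin
  have hy : max x (Real.pi / 2) < Real.pi := max_lt hx (by linarith [Real.pi_pos])
  refine ⟨(Real.pi - max x (Real.pi / 2)) / 2, by linarith, fun n => ?_⟩
  have : |(b n).arg| ≤ max x (Real.pi / 2) := by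
    by_cases hn : n < M
    · exact (hxn n hn).trans (le_max_left _ _)
    · refine le_trans ?_ (le_max_right _ _)
      rw [Complex.abs_arg_le_pi_div_two_iff]
      have := hM (n - M)
      rwa [Nat.sub_add_cancel (not_lt.1 hn)] at this
  linarith

theorem continuousOn_theta (hb : IsThetaSeq b) : ContinuousOn (theta b) (Set.Ioi 0) := by
  intro t (ht : 0 < t)
  have hU : Set.Ioo (t / 2) (2 * t) ∈ 𝓝 t := Ioo_mem_nhds (by linarith) (by linarith)
  refine ContinuousAt.continuousWithinAt (ContinuousOn.continuousAt ?_ hU)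
  -- On `]t/2, 2t[` a term is dominated by its value at the left or the right endpoint, according to
  -- the sign of `Re b_n`; the sum of both is a summable majorant.
  refine continuousOn_tsum (u := fun n => ‖Complex.exp (-((t / 2 : ℝ) : ℂ) * b n)‖ +
      ‖Complex.exp (-((2 * t : ℝ) : ℂ) * b n)‖) (fun n => by fun_prop) ?_ ?_
  · exact (hb.summable_theta _ (by linarith)).norm.add (hb.summable_theta _ (by linarith)).norm
  · intro n x hx
    rw [norm_exp_neg_mul, norm_exp_neg_mul, norm_exp_neg_mul]
    rcases le_total 0 (b n).re with h | h
    · refine le_trans (Real.exp_le_exp.2 ?_) (le_add_of_nonneg_right (Real.exp_nonneg _))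
      nlinarith [hx.1]
    · refine le_trans (Real.exp_le_exp.2 ?_) (le_add_of_nonneg_left (Real.exp_nonneg _))
      nlinarith [hx.2]

theorem exists_norm_theta_le (hb : IsThetaSeq b) {R : ℝ} (hR : ∀ n, -R ≤ (b n).re) :
    ∃ D : ℝ, 0 ≤ D ∧ ∀ t : ℝ, 1 ≤ t → ‖theta b t‖ ≤ D * Real.exp (R * t) := by
  have hs := (hb.summable_theta 1 one_pos).norm
  refine ⟨(∑' n, ‖Complex.exp (-((1 : ℝ) : ℂ) * b n)‖) * Real.exp (-R), ?_, fun t ht => ?_⟩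
  · exact mul_nonneg (tsum_nonneg fun _ => norm_nonneg _) (Real.exp_nonneg _)
  rw [mul_assoc, ← Real.exp_add, ← tsum_mul_right]
  refine tsum_of_norm_bounded (hs.mul_right _).hasSum fun n => ?_
  rw [norm_exp_neg_mul, norm_exp_neg_mul, ← Real.exp_add]
  refine Real.exp_le_exp.2 ?_
  nlinarith [hR n]

end IsThetaSeq

/-! ### Growth bounds -/

theorem exists_rpow_le_exp (A : ℝ) {ε : ℝ} (hε : 0 < ε) :
    ∃ D : ℝ, 0 ≤ D ∧ ∀ t : ℝ, 1 ≤ t → t ^ A ≤ D * Real.exp (ε * t) := by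
  obtain ⟨m, hm⟩ := exists_nat_ge A
  refine ⟨m.factorial / ε ^ m, by positivity, fun t ht => ?_⟩
  have h1 : t ^ A ≤ t ^ m := by
    rw [← Real.rpow_natCast]
    exact Real.rpow_le_rpow_of_exponent_le ht hm
  have h2 := Real.pow_div_factorial_le_exp (ε * t) (by positivity) m
  rw [div_le_iff₀ (by positivity), mul_pow] at h2
  refine h1.trans ?_
  rw [div_mul_eq_mul_div, le_div_iff₀ (by positivity)]
  linarith

/-- Merges the behaviour at `0` and at infinity into one bound. For `t ≥ 1` the missing factor `t ^
(-r)` is absorbed by enlarging the growth rate from `R` to `R'`. -/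
theorem exists_norm_le_rpow_mul_exp {g : ℝ → ℂ} {r R R' C D : ℝ} (hRR : R < R')
    (h1 : ∀ t ∈ Set.Ioo (0 : ℝ) 1, ‖g t‖ ≤ C * t ^ r)
    (h2 : ∀ t : ℝ, 1 ≤ t → ‖g t‖ ≤ D * Real.exp (R * t)) :
    ∃ C' : ℝ, 0 ≤ C' ∧ ∀ t : ℝ, 0 < t → ‖g t‖ ≤ C' * (t ^ r * Real.exp (R' * t)) := by
  obtain ⟨E, hE, hEt⟩ := exists_rpow_le_exp (-r) (sub_pos.2 hRR)
  refine ⟨|C| * Real.exp |R'| + |D| * E, by positivity, fun t ht => ?_⟩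
  have hpos : 0 ≤ t ^ r * Real.exp (R' * t) := by positivity
  rw [add_mul]
  rcases lt_or_ge t 1 with h | h
  · refine le_trans ?_ (le_add_of_nonneg_right (by positivity))
    have h3 : 1 ≤ Real.exp |R'| * Real.exp (R' * t) := by
      rw [← Real.exp_add]
      refine Real.one_le_exp ?_
      have := neg_abs_le R'
      have := abs_nonneg R'
      nlinarith
    have h4 : 0 ≤ |C| * t ^ r := by positivity
    calc ‖g t‖ ≤ C * t ^ r := h1 t ⟨ht, h⟩
      _ ≤ |C| * t ^ r := by
        have := le_abs_self C
        gcongr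
      _ ≤ |C| * t ^ r * (Real.exp |R'| * Real.exp (R' * t)) := le_mul_of_one_le_right h4 h3
      _ = _ := by ring
  · refine le_trans ?_ (le_add_of_nonneg_left (by positivity))
    calc ‖g t‖ ≤ D * Real.exp (R * t) := h2 t h
      _ ≤ |D| * Real.exp (R * t) := by
        have := le_abs_self D
        gcongr
      _ = |D| * (t ^ (-r) * (t ^ r * Real.exp (R * t))) := by
        rw [← mul_assoc (t ^ (-r)), ← Real.rpow_add ht, neg_add_cancel, Real.rpow_zero, one_mul]
      _ ≤ |D| * (E * Real.exp ((R' - R) * t) * (t ^ r * Real.exp (R * t))) := by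
        have := hEt t h
        gcongr
      _ = |D| * E * (t ^ r * (Real.exp ((R' - R) * t) * Real.exp (R * t))) := by ring
      _ = _ := by rw [← Real.exp_add]; ring_nf

/-- The finite sum `∑_{ν < N} c_ν t ^ α_ν`. -/
def powSum (c : ℕ → ℂ) (α : ℕ → ℝ) (N : ℕ) (t : ℝ) : ℂ :=
  ∑ ν ∈ Finset.range N, c ν * ((t ^ α ν : ℝ) : ℂ)

theorem continuousOn_powSum (c : ℕ → ℂ) (α : ℕ → ℝ) (N : ℕ) :
    ContinuousOn (powSum c α N) (Set.Ioi 0) := by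
  refine continuousOn_finsetSum _ fun ν _ => continuousOn_const.mul ?_
  exact Complex.continuous_ofReal.comp_continuousOn
    (continuousOn_id.rpow_const fun t ht => Or.inl (ne_of_gt ht))

theorem exists_norm_powSum_le (c : ℕ → ℂ) (α : ℕ → ℝ) (N : ℕ) {ε : ℝ} (hε : 0 < ε) :
    ∃ D : ℝ, 0 ≤ D ∧ ∀ t : ℝ, 1 ≤ t → ‖powSum c α N t‖ ≤ D * Real.exp (ε * t) := by
  choose D hD hDt using fun ν => exists_rpow_le_exp (α ν) hε
  refine ⟨∑ ν ∈ Finset.range N, ‖c ν‖ * D ν,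
    Finset.sum_nonneg fun ν _ => mul_nonneg (norm_nonneg _) (hD ν), fun t ht => ?_⟩
  rw [Finset.sum_mul]
  refine (norm_sum_le _ _).trans (Finset.sum_le_sum fun ν _ => ?_)
  rw [norm_mul, Complex.norm_real, Real.norm_of_nonneg (by positivity), mul_assoc]
  exact mul_le_mul_of_nonneg_left (hDt ν t ht) (norm_nonneg _)

/-- Even when `Θ_b` decays (`R < 0`), the subtracted powers of `t` need not, so the rate `R'` has to
be positive as well as larger than `R`. -/
theorem IsThetaSeq.exists_norm_sub_le {b : ℕ → ℂ} (hb : IsThetaSeq b) {R R' : ℝ}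
    (hR : ∀ n, -R ≤ (b n).re) (hRR : R < R') (hR' : 0 < R') {c : ℕ → ℂ} {α : ℕ → ℝ} {N : ℕ}
    {r C : ℝ} (h : ∀ t ∈ Set.Ioo (0 : ℝ) 1, ‖theta b t - powSum c α N t‖ ≤ C * t ^ r) :
    ∃ C' : ℝ, 0 ≤ C' ∧
      ∀ t : ℝ, 0 < t → ‖theta b t - powSum c α N t‖ ≤ C' * (t ^ r * Real.exp (R' * t)) := by
  obtain ⟨x, hx1, hx2⟩ := exists_between (max_lt hRR hR')
  have hRx := (le_max_left R 0).trans_lt hx1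
  obtain ⟨D, hD0, hD⟩ := hb.exists_norm_theta_le hR
  obtain ⟨E, hE0, hE⟩ := exists_norm_powSum_le c α N ((le_max_right R 0).trans_lt hx1)
  refine exists_norm_le_rpow_mul_exp (g := fun t => theta b t - powSum c α N t) (D := D + E)
    hx2 h fun t ht => ?_
  rw [add_mul]
  refine (norm_sub_le _ _).trans (add_le_add ((hD t ht).trans ?_) (hE t ht))
  have : R * t ≤ x * t := by nlinarith
  gcongr

end RegDet
end

noncomputable section
namespace RegDet
open Filter Topology MeasureTheory

/-! ### Laplace and Mellin transforms -/

theorem integrableOn_rpow_mul_exp {x y : ℝ} (hx : 0 < x) (hy : 0 < y) :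
    IntegrableOn (fun t : ℝ => t ^ (x - 1) * Real.exp (-(y * t))) (Set.Ioi 0) := by
  have := integrableOn_rpow_mul_exp_neg_mul_rpow (p := 1) (s := x - 1) (b := y) (by linarith)
    one_pos hy
  simpa using this

/-- The Mellin transform `∫₀^∞ t ^ (s - 1) exp (-t l) f t dt`. -/
def laplaceMellin (f : ℝ → ℂ) (l s : ℂ) : ℂ :=
  ∫ t in Set.Ioi (0 : ℝ), (t : ℂ) ^ (s - 1) * (Complex.exp (-(t : ℂ) * l) * f t)

section

variable {f : ℝ → ℂ} {C r R : ℝ}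

theorem norm_laplaceMellin_integrand_le
    (hfb : ∀ t : ℝ, 0 < t → ‖f t‖ ≤ C * (t ^ r * Real.exp (R * t))) (l s : ℂ) {t : ℝ}
    (ht : 0 < t) :
    ‖(t : ℂ) ^ (s - 1) * (Complex.exp (-(t : ℂ) * l) * f t)‖ ≤
      C * (t ^ (s.re + r - 1) * Real.exp (-((l.re - R) * t))) := by
  rw [norm_mul, norm_mul, Complex.norm_cpow_eq_rpow_re_of_pos ht, norm_exp_neg_mul]
  have h1 : t ^ (s.re + r - 1) = t ^ (s - 1).re * t ^ r := by
    rw [← Real.rpow_add ht]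
    congr 1
    simp; ring
  have h2 : Real.exp (-((l.re - R) * t)) = Real.exp (-t * l.re) * Real.exp (R * t) := by
    rw [← Real.exp_add]; ring_nf
  rw [h1, h2]
  calc _ ≤ t ^ (s - 1).re * (Real.exp (-t * l.re) * (C * (t ^ r * Real.exp (R * t)))) := by
        have := hfb t ht
        gcongr
    _ = _ := by ring

theorem continuousOn_laplaceMellin_integrand (hf : ContinuousOn f (Set.Ioi 0)) (l s : ℂ) :
    ContinuousOn (fun t : ℝ => (t : ℂ) ^ (s - 1) * (Complex.exp (-(t : ℂ) * l) * f t))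
      (Set.Ioi 0) := by
  refine ContinuousOn.mul ?_ (ContinuousOn.mul (by fun_prop) hf)
  exact ContinuousOn.cpow_const (by fun_prop) fun t ht => Complex.ofReal_mem_slitPlane.2 ht

theorem integrableOn_laplaceMellin (hf : ContinuousOn f (Set.Ioi 0))
    (hfb : ∀ t : ℝ, 0 < t → ‖f t‖ ≤ C * (t ^ r * Real.exp (R * t))) {l s : ℂ} (hl : R < l.re)
    (hs : 0 < s.re + r) :
    IntegrableOn (fun t : ℝ => (t : ℂ) ^ (s - 1) * (Complex.exp (-(t : ℂ) * l) * f t))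
      (Set.Ioi 0) := by
  refine Integrable.mono' ((integrableOn_rpow_mul_exp hs (sub_pos.2 hl)).const_mul C)
    ((continuousOn_laplaceMellin_integrand hf l s).aestronglyMeasurable measurableSet_Ioi) ?_
  filter_upwards [ae_restrict_mem measurableSet_Ioi] with t ht
  exact norm_laplaceMellin_integrand_le hfb l s ht

theorem norm_laplaceMellin_le
    (hfb : ∀ t : ℝ, 0 < t → ‖f t‖ ≤ C * (t ^ r * Real.exp (R * t))) {l s : ℂ} (hl : R < l.re)
    (hs : 0 < s.re + r) :
    ‖laplaceMellin f l s‖ ≤ C * Real.Gamma (s.re + r) * (l.re - R) ^ (-(s.re + r)) := by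
  refine (norm_integral_le_of_norm_le
    ((integrableOn_rpow_mul_exp hs (sub_pos.2 hl)).const_mul C) ?_).trans (le_of_eq ?_)
  · filter_upwards [ae_restrict_mem measurableSet_Ioi] with t ht
    exact norm_laplaceMellin_integrand_le hfb l s ht
  · rw [integral_const_mul, Real.integral_rpow_mul_exp_neg_mul_Ioi hs (sub_pos.2 hl), one_div,
      Real.inv_rpow (sub_pos.2 hl).le, ← Real.rpow_neg (sub_pos.2 hl).le]
    ring

theorem differentiableAt_laplaceMellin_right (hf : ContinuousOn f (Set.Ioi 0))
    (hfb : ∀ t : ℝ, 0 < t → ‖f t‖ ≤ C * (t ^ r * Real.exp (R * t))) {l s : ℂ} (hl : R < l.re)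
    (hs : 0 < s.re + r) : DifferentiableAt ℂ (laplaceMellin f l) s := by
  set g : ℝ → ℂ := fun t => Complex.exp (-(t : ℂ) * l) * f t with hg
  have hgc : ContinuousOn g (Set.Ioi 0) := ContinuousOn.mul (by fun_prop) hf
  have hgb : ∀ t : ℝ, 0 < t → ‖g t‖ ≤ C * (t ^ r * Real.exp (-((l.re - R) * t))) := by
    intro t ht
    have := norm_laplaceMellin_integrand_le hfb l 1 ht
    simpa [hg] using this
  obtain ⟨E, hE, hEt⟩ := exists_rpow_le_exp r (half_pos (sub_pos.2 hl))
  have htop : g =O[atTop] fun t => Real.exp (-((l.re - R) / 2) * t) := by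
    refine Asymptotics.IsBigO.of_bound (|C| * E) ?_
    filter_upwards [eventually_ge_atTop 1] with t ht
    rw [Real.norm_of_nonneg (Real.exp_nonneg _)]
    calc ‖g t‖ ≤ C * (t ^ r * Real.exp (-((l.re - R) * t))) := hgb t (by linarith)
      _ ≤ |C| * (E * Real.exp ((l.re - R) / 2 * t) * Real.exp (-((l.re - R) * t))) := by
        have h1 := hEt t ht
        have h2 := le_abs_self C
        have h3 : 0 ≤ t ^ r := by positivity
        gcongr
      _ = |C| * E * (Real.exp ((l.re - R) / 2 * t) * Real.exp (-((l.re - R) * t))) := by ring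
      _ = _ := by rw [← Real.exp_add]; ring_nf
  have hbot : g =O[𝓝[>] 0] fun t : ℝ => t ^ (-(-r)) := by
    refine Asymptotics.IsBigO.of_bound |C| ?_
    filter_upwards [self_mem_nhdsWithin] with t (ht : 0 < t)
    rw [Real.norm_of_nonneg (by positivity), neg_neg]
    refine (hgb t ht).trans (mul_le_mul (le_abs_self C) ?_ (by positivity) (abs_nonneg C))
    refine mul_le_of_le_one_right (by positivity) (Real.exp_le_one_iff.2 ?_)
    have := mul_pos (sub_pos.2 hl) ht
    linarith
  exact mellin_differentiableAt_of_isBigO_rpow_exp (half_pos (sub_pos.2 hl))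
    (hgc.locallyIntegrableOn measurableSet_Ioi) htop hbot (by linarith)

theorem differentiableAt_laplaceMellin_left (hf : ContinuousOn f (Set.Ioi 0))
    (hfb : ∀ t : ℝ, 0 < t → ‖f t‖ ≤ C * (t ^ r * Real.exp (R * t))) {l s : ℂ} (hl : R < l.re)
    (hs : 0 < s.re + r) : DifferentiableAt ℂ (fun l => laplaceMellin f l s) l := by
  -- Giving up half of the gap `Re l - R` produces a majorant valid for all parameters near `l`.
  -- Differentiating in the parameter brings down `-t`, hence the exponent `r + 1`.
  set ρ := (l.re - R) / 2 with hρ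
  have hρ0 : 0 < ρ := half_pos (sub_pos.2 hl)
  have hU : {z : ℂ | R + ρ < z.re} ∈ 𝓝 l :=
    (isOpen_lt continuous_const Complex.continuous_re).mem_nhds (by simp [hρ]; linarith)
  refine (hasDerivAt_integral_of_dominated_loc_of_deriv_le
    (F := fun l (t : ℝ) => (t : ℂ) ^ (s - 1) * (Complex.exp (-(t : ℂ) * l) * f t))
    (F' := fun l (t : ℝ) => (t : ℂ) ^ (s - 1) * (Complex.exp (-(t : ℂ) * l) * (-(t : ℂ) * f t)))
    (bound := fun t => C * (t ^ (s.re + (r + 1) - 1) * Real.exp (-(ρ * t))))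
    hU ?_ ?_ ?_ ?_ ?_ ?_).2.differentiableAt
  · exact Eventually.of_forall fun z =>
      (continuousOn_laplaceMellin_integrand hf z s).aestronglyMeasurable measurableSet_Ioi
  · exact integrableOn_laplaceMellin hf hfb hl hs
  · exact (continuousOn_laplaceMellin_integrand (f := fun t : ℝ => -(t : ℂ) * f t)
      (ContinuousOn.mul (by fun_prop) hf) l s).aestronglyMeasurable measurableSet_Ioi
  · filter_upwards [ae_restrict_mem measurableSet_Ioi] with t (ht : 0 < t) z hz
    have hz : R + ρ < z.re := hz
    have h1 : ∀ t : ℝ, 0 < t → ‖-(t : ℂ) * f t‖ ≤ C * (t ^ (r + 1) * Real.exp (R * t)) := by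
      intro t ht
      rw [norm_mul, norm_neg, Complex.norm_real, Real.norm_of_nonneg ht.le, Real.rpow_add_one ht.ne']
      calc t * ‖f t‖ ≤ t * (C * (t ^ r * Real.exp (R * t))) :=
            mul_le_mul_of_nonneg_left (hfb t ht) ht.le
        _ = _ := by ring
    have hC : 0 ≤ C := by
      have h2 := (norm_nonneg _).trans (hfb t ht)
      exact nonneg_of_mul_nonneg_left h2 (by positivity)
    refine (norm_laplaceMellin_integrand_le h1 z s ht).trans ?_
    have : ρ * t ≤ (z.re - R) * t := mul_le_mul_of_nonneg_right (by linarith) ht.le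
    gcongr
  · exact (integrableOn_rpow_mul_exp (by linarith) hρ0).const_mul C
  · refine Eventually.of_forall fun t z _ => ?_
    have h1 : HasDerivAt (fun z => Complex.exp (-(t : ℂ) * z))
        (Complex.exp (-(t : ℂ) * z) * (-(t : ℂ) * 1)) z :=
      ((hasDerivAt_id z).const_mul (-(t : ℂ))).cexp
    have h2 := (h1.mul_const (f t)).const_mul ((t : ℂ) ^ (s - 1))
    rwa [mul_one, mul_assoc (Complex.exp _)] at h2

end

theorem integrableOn_cpow_mul_exp {l s : ℂ} (hl : 0 < l.re) (hs : 0 < s.re) :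
    IntegrableOn (fun t : ℝ => (t : ℂ) ^ (s - 1) * Complex.exp (-(t : ℂ) * l)) (Set.Ioi 0) := by
  have := integrableOn_laplaceMellin (f := fun _ => 1) (C := 1) (r := 0) (R := 0) (l := l) (s := s)
    continuousOn_const (fun t _ => by simp) hl (by simpa using hs)
  simpa using this

/-- For real `l > 0` this is Euler's integral. Both sides are holomorphic in `Re l > 0`, so the
identity theorem extends it from the real points near `1`. -/
theorem integral_cpow_mul_exp {l s : ℂ} (hl : 0 < l.re) (hs : 0 < s.re) :
    ∫ t in Set.Ioi (0 : ℝ), (t : ℂ) ^ (s - 1) * Complex.exp (-(t : ℂ) * l) =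
      Complex.Gamma s * l ^ (-s) := by
  have hopen : IsOpen {z : ℂ | 0 < z.re} := isOpen_lt continuous_const Complex.continuous_re
  have h1 : AnalyticOnNhd ℂ (fun z => laplaceMellin (fun _ => 1) z s) {z | 0 < z.re} := by
    refine DifferentiableOn.analyticOnNhd (fun z hz => ?_) hopen
    exact (differentiableAt_laplaceMellin_left (C := 1) (r := 0) (R := 0)
      continuousOn_const (fun t _ => by simp) hz (by simpa using hs)).differentiableWithinAt
  have h2 : AnalyticOnNhd ℂ (fun z : ℂ => Complex.Gamma s * z ^ (-s)) {z | 0 < z.re} := by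
    refine DifferentiableOn.analyticOnNhd (fun z hz => ?_) hopen
    exact ((differentiableAt_id.cpow_const (Or.inl hz)).const_mul _).differentiableWithinAt
  have hfreq : ∃ᶠ z in 𝓝[≠] (1 : ℂ), laplaceMellin (fun _ => 1) z s =
      Complex.Gamma s * z ^ (-s) := by
    have ht : Tendsto (fun x : ℝ => (x : ℂ)) (𝓝[≠] 1) (𝓝[≠] 1) := by
      refine tendsto_nhdsWithin_of_tendsto_nhds_of_eventually_within _ ?_ ?_
      · exact (Complex.continuous_ofReal.tendsto' 1 1 (by simp)).mono_left nhdsWithin_le_nhds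
      · filter_upwards [self_mem_nhdsWithin] with x hx
        simpa using hx
    refine ht.frequently (Eventually.frequently ?_)
    filter_upwards [nhdsWithin_le_nhds (lt_mem_nhds (one_pos : (0 : ℝ) < 1))] with x hx
    have := Complex.integral_cpow_mul_exp_neg_mul_Ioi hs hx
    rw [laplaceMellin]
    simp only [mul_one]
    rw [Complex.cpow_neg, ← Complex.inv_cpow _ _ (by
      rw [Complex.arg_ofReal_of_nonneg hx.le]; exact Real.pi_pos.ne), mul_comm (Complex.Gamma s)]
    rw [one_div] at this
    rw [← this]
    refine setIntegral_congr_fun measurableSet_Ioi fun t _ => ?_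
    congr 2
    ring
  have := h1.eqOn_of_preconnected_of_frequently_eq h2
    (convex_halfSpace_re_gt 0).isPreconnected (by simp) hfreq hl
  simpa [laplaceMellin] using this

theorem norm_cpow_neg_le {z : ℂ} (hz : 0 < z.re) (s : ℂ) :
    ‖z ^ (-s)‖ ≤ Real.exp (Real.pi * |s.im|) * ‖z‖ ^ (-s.re) := by
  have hz0 : z ≠ 0 := fun h => by simp [h] at hz
  rw [Complex.norm_cpow_of_ne_zero hz0, div_eq_mul_inv, ← Real.exp_neg, mul_comm, Complex.neg_re]
  refine mul_le_mul_of_nonneg_right (Real.exp_le_exp.2 ?_) (by positivity)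
  calc -(z.arg * (-s).im) ≤ |z.arg * (-s).im| := neg_le_abs _
    _ = |z.arg| * |s.im| := by rw [abs_mul, Complex.neg_im, abs_neg]
    _ ≤ _ := mul_le_mul_of_nonneg_right (Complex.abs_arg_le_pi z) (abs_nonneg _)

/-- The zeta series is the Mellin transform of the theta series. -/
theorem IsThetaSeq.exists_hasSum_cpow {a : ℕ → ℂ} (ha : IsThetaSeq a) {η : ℝ} (hη : 0 < η)
    (hre : ∀ n, η ≤ (a n).re) :
    ∃ σ : ℝ, ∀ s : ℂ, σ < s.re → HasSum (fun n => a n ^ (-s))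
      ((Complex.Gamma s)⁻¹ * laplaceMellin (theta a) 0 s) := by
  obtain ⟨k, hk⟩ := ha.summable_inv_pow
  obtain ⟨r₀, C₀, -, hC₀⟩ := ha.hasPowerExp.exists_norm_le
  obtain ⟨D, -, hD⟩ := ha.exists_norm_theta_le (R := -η) (by simpa using hre)
  -- A nonpositive exponent makes `(t + δ) ^ r ≤ t ^ r`, so a single majorant works for all `δ > 0`
  -- below.
  set r := min r₀ 0 with hr
  have hr0 : r ≤ 0 := min_le_right _ _
  obtain ⟨C, hC, hCt⟩ := exists_norm_le_rpow_mul_exp (g := theta a) (r := r) (R := -η)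
    (R' := -(η / 2)) (C := |C₀|) (D := D) (by linarith) (fun t ht => (hC₀ t ht).trans
      (mul_le_mul (le_abs_self _) (Real.rpow_le_rpow_of_exponent_ge ht.1 ht.2.le
        (min_le_left _ _)) (Real.rpow_nonneg ht.1.le _) (abs_nonneg _))) hD
  refine ⟨max (max k 0) (-r), fun s hs => ?_⟩
  have hsk : (k : ℝ) < s.re := lt_of_le_of_lt ((le_max_left _ _).trans (le_max_left _ _)) hs
  have hs0 : 0 < s.re := lt_of_le_of_lt ((le_max_right _ _).trans (le_max_left _ _)) hs
  have hsr : -r < s.re := lt_of_le_of_lt (le_max_right _ _) hs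
  have hΓ : Complex.Gamma s ≠ 0 := Complex.Gamma_ne_zero_of_re_pos hs0
  have hpos : ∀ n, 0 < (a n).re := fun n => hη.trans_le (hre n)
  -- absolute convergence of the zeta series
  have hsum : Summable fun n => ‖a n ^ (-s)‖ := by
    refine Summable.of_nonneg_of_le (fun _ => norm_nonneg _) (fun n => ?_)
      (hk.mul_left (Real.exp (Real.pi * |s.im|) * η ^ ((k : ℝ) - s.re)))
    refine (norm_cpow_neg_le (hpos n) s).trans ?_
    have hn : η ≤ ‖a n‖ := (hre n).trans (Complex.re_le_norm _)
    have hn0 : 0 < ‖a n‖ := hη.trans_le hn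
    have h1 : ‖a n‖ ^ (-s.re) = ‖a n‖ ^ ((k : ℝ) - s.re) * ‖((a n) ^ k)⁻¹‖ := by
      rw [norm_inv, norm_pow, ← Real.rpow_natCast, ← Real.rpow_neg hn0.le, ← Real.rpow_add hn0]
      congr 1; ring
    have h2 : ‖a n‖ ^ ((k : ℝ) - s.re) ≤ η ^ ((k : ℝ) - s.re) :=
      Real.rpow_le_rpow_of_nonpos hη hn (by linarith)
    rw [h1, mul_assoc]
    gcongr
  -- the identity for the translated theta series
  have hδ : ∀ δ : ℝ, 0 < δ →
      ∫ t in Set.Ioi (0 : ℝ), (t : ℂ) ^ (s - 1) * theta a (t + δ) =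
        ∑' n, Complex.exp (-(δ : ℂ) * a n) * (Complex.Gamma s * a n ^ (-s)) := by
    intro δ hδ
    have hF : ∀ n, (fun t : ℝ => (t : ℂ) ^ (s - 1) * Complex.exp (-((t + δ : ℝ) : ℂ) * a n)) =
        fun t : ℝ => Complex.exp (-(δ : ℂ) * a n) *
          ((t : ℂ) ^ (s - 1) * Complex.exp (-(t : ℂ) * a n)) := by
      intro n; funext t
      rw [Complex.ofReal_add, neg_add, add_mul, Complex.exp_add]; ring
    -- Without `δ`, interchanging sum and integral in this way would need summability of `(Re a_n) ^
    -- (-Re s)`, whereas only `‖a_n‖ ^ (-k)` is known to be summable and `Re a_n` may be much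
    -- smaller than `‖a_n‖`. The summable factor `e^{-δ a_n}` repairs this; afterwards `δ → 0`.
    have h := hasSum_integral_of_summable_integral_norm (μ := volume.restrict (Set.Ioi (0 : ℝ)))
      (F := fun n (t : ℝ) => (t : ℂ) ^ (s - 1) * Complex.exp (-((t + δ : ℝ) : ℂ) * a n))
      (fun n => ?_) ?_
    · have h2 := h.tsum_eq
      simp only [tsum_mul_left] at h2
      simp only [theta]
      rw [← h2]
      refine tsum_congr fun n => ?_
      rw [hF, integral_const_mul, integral_cpow_mul_exp (hpos n) hs0]
    · rw [hF]
      exact (integrableOn_cpow_mul_exp (hpos n) hs0).const_mul _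
    · refine Summable.of_nonneg_of_le (fun n => integral_nonneg fun _ => norm_nonneg _) (fun n => ?_)
        ((ha.summable_theta δ hδ).norm.mul_right (Real.Gamma s.re * η ^ (-s.re)))
      have h3 : ∫ t in Set.Ioi (0 : ℝ), ‖(t : ℂ) ^ (s - 1) * Complex.exp (-((t + δ : ℝ) : ℂ) * a n)‖ =
          ‖Complex.exp (-(δ : ℂ) * a n)‖ * (Real.Gamma s.re * (a n).re ^ (-s.re)) := by
        rw [Real.rpow_neg (hpos n).le, ← Real.inv_rpow (hpos n).le, ← one_div,
          mul_comm (Real.Gamma s.re), ← Real.integral_rpow_mul_exp_neg_mul_Ioi hs0 (hpos n),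
          ← integral_const_mul]
        refine setIntegral_congr_fun measurableSet_Ioi fun t ht => ?_
        have ht : (0 : ℝ) < t := ht
        have h4 := congrFun (hF n) t
        rw [h4, norm_mul, norm_mul, Complex.norm_cpow_eq_rpow_re_of_pos ht, norm_exp_neg_mul t,
          Complex.sub_re, Complex.one_re, mul_comm (a n).re, neg_mul, neg_mul]
      rw [h3]
      have h5 := Real.rpow_le_rpow_of_nonpos hη (hre n) (neg_nonpos.2 hs0.le)
      have h6 := (Real.Gamma_pos_of_pos hs0).le
      gcongr
  -- the limit `δ → 0`
  have hlim1 : Tendsto (fun δ : ℝ => ∫ t in Set.Ioi (0 : ℝ), (t : ℂ) ^ (s - 1) * theta a (t + δ))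
      (𝓝[>] 0) (𝓝 (∫ t in Set.Ioi (0 : ℝ), (t : ℂ) ^ (s - 1) * theta a t)) := by
    refine tendsto_integral_filter_of_dominated_convergence
      (fun t => C * (t ^ (s.re + r - 1) * Real.exp (-(η / 2 * t)))) ?_ ?_ ?_ ?_
    · filter_upwards [self_mem_nhdsWithin] with δ (hδ : 0 < δ)
      refine ContinuousOn.aestronglyMeasurable (ContinuousOn.mul ?_ ?_) measurableSet_Ioi
      · exact ContinuousOn.cpow_const (by fun_prop) fun t ht => Complex.ofReal_mem_slitPlane.2 ht
      · exact ha.continuousOn_theta.comp (by fun_prop) fun t (ht : 0 < t) => add_pos ht hδ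
    · filter_upwards [self_mem_nhdsWithin] with δ (hδ : 0 < δ)
      filter_upwards [ae_restrict_mem measurableSet_Ioi] with t (ht : 0 < t)
      rw [norm_mul, Complex.norm_cpow_eq_rpow_re_of_pos ht]
      have h1 : t ^ (s.re + r - 1) = t ^ (s - 1).re * t ^ r := by
        rw [← Real.rpow_add ht]
        congr 1
        simp; ring
      have h2 : (t + δ) ^ r ≤ t ^ r := Real.rpow_le_rpow_of_nonpos ht (by linarith) hr0
      have h3 : Real.exp (-(η / 2) * (t + δ)) ≤ Real.exp (-(η / 2 * t)) :=
        Real.exp_le_exp.2 (by nlinarith)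
      rw [h1]
      calc _ ≤ t ^ (s - 1).re * (C * ((t + δ) ^ r * Real.exp (-(η / 2) * (t + δ)))) := by
            have := hCt (t + δ) (by linarith)
            gcongr
        _ ≤ t ^ (s - 1).re * (C * (t ^ r * Real.exp (-(η / 2 * t)))) := by gcongr
        _ = _ := by ring
    · exact (integrableOn_rpow_mul_exp (by linarith) (half_pos hη)).const_mul C
    · filter_upwards [ae_restrict_mem measurableSet_Ioi] with t (ht : 0 < t)
      refine Tendsto.const_mul _ ?_
      have h1 : ContinuousAt (theta a) t := ha.continuousOn_theta.continuousAt (Ioi_mem_nhds ht)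
      have h2 : Tendsto (fun δ : ℝ => t + δ) (𝓝[>] 0) (𝓝 t) :=
        (Continuous.tendsto' (by fun_prop) 0 t (by simp)).mono_left nhdsWithin_le_nhds
      exact h1.tendsto.comp h2
  have hlim2 : Tendsto (fun δ : ℝ =>
      ∑' n, Complex.exp (-(δ : ℂ) * a n) * (Complex.Gamma s * a n ^ (-s)))
      (𝓝[>] 0) (𝓝 (∑' n, Complex.Gamma s * a n ^ (-s))) := by
    refine tendsto_tsum_of_dominated_convergence
      (bound := fun n => ‖Complex.Gamma s‖ * ‖a n ^ (-s)‖) (hsum.mul_left _) (fun n => ?_) ?_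
    · have : Tendsto (fun δ : ℝ => Complex.exp (-(δ : ℂ) * a n)) (𝓝[>] 0) (𝓝 1) :=
        (Continuous.tendsto' (by fun_prop) 0 1 (by simp)).mono_left nhdsWithin_le_nhds
      simpa using this.mul_const (Complex.Gamma s * a n ^ (-s))
    · filter_upwards [self_mem_nhdsWithin] with δ (hδ : 0 < δ) n
      rw [norm_mul, norm_mul, norm_exp_neg_mul]
      refine mul_le_of_le_one_left (by positivity) (Real.exp_le_one_iff.2 ?_)
      have := mul_pos hδ (hpos n)
      linarith
  have hev : (fun δ : ℝ => ∑' n, Complex.exp (-(δ : ℂ) * a n) * (Complex.Gamma s * a n ^ (-s)))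
      =ᶠ[𝓝[>] 0] fun δ : ℝ => ∫ t in Set.Ioi (0 : ℝ), (t : ℂ) ^ (s - 1) * theta a (t + δ) := by
    filter_upwards [self_mem_nhdsWithin] with δ h
    exact (hδ δ h).symm
  have heq := tendsto_nhds_unique hlim1 (hlim2.congr' hev)
  have hlm : laplaceMellin (theta a) 0 s = Complex.Gamma s * ∑' n, a n ^ (-s) := by
    rw [← tsum_mul_left, ← heq]
    simp [laplaceMellin]
  rw [hlm, inv_mul_cancel_left₀ hΓ]
  exact hsum.of_norm.hasSum

theorem laplaceMellin_theta_add_const (b : ℕ → ℂ) (l s : ℂ) :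
    laplaceMellin (theta fun n => b n + l) 0 s = laplaceMellin (theta b) l s := by
  simp [laplaceMellin, theta_add_const]

end RegDet
end

noncomputable section
namespace RegDet
open Filter Topology MeasureTheory

/-! ### Gamma quotients -/

/-- The meromorphic function `Γ (s + α) / Γ s`, without removable singularities at `s = 0`. -/
def gammaQuot (α : ℝ) (s : ℂ) : ℂ :=
  if α = -(⌊-α⌋₊ : ℝ) then ∏ j ∈ Finset.range ⌊-α⌋₊, (s - (j + 1 : ℕ))⁻¹
  else Complex.Gamma (s + α) * (Complex.Gamma s)⁻¹

theorem analyticAt_inv_Gamma (s : ℂ) : AnalyticAt ℂ (fun s => (Complex.Gamma s)⁻¹) s :=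
  Complex.differentiable_one_div_Gamma.analyticAt s

theorem meromorphicAt_Gamma_add (α s : ℂ) : MeromorphicAt (fun s => Complex.Gamma (s + α)) s := by
  have h : AnalyticAt ℂ (fun s => (Complex.Gamma (s + α))⁻¹) s :=
    (analyticAt_inv_Gamma (s + α)).comp_of_eq (by fun_prop) rfl
  have := h.meromorphicAt.inv
  refine this.congr (Eventually.of_forall fun z => ?_)
  simp

theorem meromorphicAt_gammaQuot (α : ℝ) (s : ℂ) : MeromorphicAt (gammaQuot α) s := by
  by_cases h : α = -(⌊-α⌋₊ : ℝ)
  · have : gammaQuot α = fun s : ℂ => ∏ j ∈ Finset.range ⌊-α⌋₊, (s - (j + 1 : ℕ))⁻¹ := by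
      funext s; rw [gammaQuot, if_pos h]
    rw [this]
    have : ∀ n : ℕ, MeromorphicAt (fun s : ℂ => ∏ j ∈ Finset.range n, (s - (j + 1 : ℕ))⁻¹) s := by
      intro n
      induction n with
      | zero => simp
      | succ n ih =>
        simp only [Finset.prod_range_succ]
        refine ih.mul (MeromorphicAt.inv (AnalyticAt.meromorphicAt ?_))
        fun_prop
    exact this _
  · have : gammaQuot α = fun s => Complex.Gamma (s + α) * (Complex.Gamma s)⁻¹ := by
      funext s; rw [gammaQuot, if_neg h]
    rw [this]
    exact (meromorphicAt_Gamma_add _ _).mul (analyticAt_inv_Gamma s).meromorphicAt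

theorem Gamma_eq_prod_mul (k : ℕ) {s : ℂ} (hs : (k : ℝ) < s.re) :
    Complex.Gamma s =
      (∏ j ∈ Finset.range k, (s - (j + 1 : ℕ))) * Complex.Gamma (s - (k : ℕ)) := by
  induction k with
  | zero => simp
  | succ k ih =>
    push_cast at hs
    rw [ih (by linarith), Finset.prod_range_succ, mul_assoc]
    congr 1
    have h : s - ((k + 1 : ℕ) : ℂ) ≠ 0 := by
      intro h
      have := congrArg Complex.re h
      simp at this
      linarith
    rw [← Complex.Gamma_add_one _ h]
    congr 1
    push_cast; ring

/-- The condition on `s` keeps away from the poles, where `Complex.Gamma` takes the value `0`: at `s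
= 0`, `α = -k` the right-hand side would be `0` and not the limit `(-1)^k / k!`. -/
theorem gammaQuot_eq {α : ℝ} {s : ℂ} (hs : 0 < s.re + α) :
    gammaQuot α s = Complex.Gamma (s + α) * (Complex.Gamma s)⁻¹ := by
  rw [gammaQuot]
  split_ifs with h
  · have hk : ((⌊-α⌋₊ : ℕ) : ℝ) < s.re := by
      have := h.symm
      linarith
    have h2 : s + (α : ℂ) = s - ((⌊-α⌋₊ : ℕ) : ℂ) := by
      rw [sub_eq_add_neg]
      congr 1
      conv_lhs => rw [h]
      push_cast; rfl
    have h3 : Complex.Gamma (s + α) ≠ 0 := Complex.Gamma_ne_zero_of_re_pos (by simpa using hs)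
    rw [Gamma_eq_prod_mul _ hk, mul_inv, Finset.prod_inv_distrib, ← h2]
    field_simp
  · rfl

theorem ne_neg_nat_of_not {α : ℝ} (h : ¬ α = -(⌊-α⌋₊ : ℝ)) (m : ℕ) : (α : ℂ) ≠ -(m : ℂ) := by
  intro hm
  have hm' : α = -(m : ℝ) := by exact_mod_cast hm
  refine h ?_
  rw [hm', neg_neg, Nat.floor_natCast]

theorem analyticAt_gammaQuot_zero (α : ℝ) : AnalyticAt ℂ (gammaQuot α) 0 := by
  by_cases h : α = -(⌊-α⌋₊ : ℝ)
  · have : gammaQuot α = fun s : ℂ => ∏ j ∈ Finset.range ⌊-α⌋₊, (s - (j + 1 : ℕ))⁻¹ := by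
      funext s; rw [gammaQuot, if_pos h]
    rw [this]
    refine Finset.analyticAt_fun_prod _ fun j _ => AnalyticAt.inv (by fun_prop) ?_
    rw [zero_sub, neg_ne_zero]
    exact Nat.cast_ne_zero.2 j.succ_ne_zero
  · have : gammaQuot α = fun s => ((Complex.Gamma (s + α))⁻¹)⁻¹ * (Complex.Gamma s)⁻¹ := by
      funext s; rw [gammaQuot, if_neg h, inv_inv]
    rw [this]
    refine AnalyticAt.mul (AnalyticAt.inv ?_ ?_) (analyticAt_inv_Gamma 0)
    · exact (analyticAt_inv_Gamma (0 + α)).comp_of_eq (by fun_prop) rfl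
    · rw [zero_add]
      exact inv_ne_zero (Complex.Gamma_ne_zero (ne_neg_nat_of_not h))

/-- From `1/Γ(s) = s/Γ(s+1)`. The value `0` and derivative `1` at `s = 0` turn differentiation of
`f(s)/Γ(s)` at `0` into evaluation of `f` there. -/
theorem hasDerivAt_inv_Gamma_zero : HasDerivAt (fun s => (Complex.Gamma s)⁻¹) 1 0 := by
  have h1 : (fun s => (Complex.Gamma s)⁻¹) = fun s => s * (Complex.Gamma (s + 1))⁻¹ := by
    funext s; exact Complex.one_div_Gamma_eq_self_mul_one_div_Gamma_add_one s
  have h2 : DifferentiableAt ℂ (fun s => (Complex.Gamma (s + 1))⁻¹) 0 :=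
    ((analyticAt_inv_Gamma (0 + 1)).comp_of_eq (f := fun s : ℂ => s + 1)
      (by fun_prop) rfl).differentiableAt
  have h3 := (hasDerivAt_id (0 : ℂ)).mul h2.hasDerivAt
  rw [h1]
  refine h3.congr_deriv ?_
  simp

/-- The logarithmic derivative of `∏ 1/(s - j)` at `0` is `∑ 1/j`, the source of the harmonic
numbers in `detTerm`. -/
theorem hasDerivAt_prod_inv (k : ℕ) :
    HasDerivAt (fun s : ℂ => ∏ j ∈ Finset.range k, (s - (j + 1 : ℕ))⁻¹)
      ((-1) ^ k / (k.factorial : ℂ) * ∑ j ∈ Finset.Icc 1 k, (1 : ℂ) / (j : ℂ)) 0 ∧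
    ∏ j ∈ Finset.range k, ((0 : ℂ) - (j + 1 : ℕ))⁻¹ = (-1) ^ k / (k.factorial : ℂ) := by
  induction k with
  | zero => simpa using hasDerivAt_const (0 : ℂ) (1 : ℂ)
  | succ k ih =>
    have hk : ((k + 1 : ℕ) : ℂ) ≠ 0 := Nat.cast_ne_zero.2 k.succ_ne_zero
    have hf : (k.factorial : ℂ) ≠ 0 := Nat.cast_ne_zero.2 k.factorial_ne_zero
    have hprod : ∏ j ∈ Finset.range (k + 1), ((0 : ℂ) - (j + 1 : ℕ))⁻¹ =
        (-1) ^ (k + 1) / ((k + 1).factorial : ℂ) := by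
      rw [Finset.prod_range_succ, ih.2, Nat.factorial_succ, Nat.cast_mul, zero_sub, pow_succ]
      field_simp
    refine ⟨?_, hprod⟩
    have h1 : HasDerivAt (fun s : ℂ => (s - (k + 1 : ℕ))⁻¹) (-1 / (0 - ((k + 1 : ℕ) : ℂ)) ^ 2) 0 :=
      ((hasDerivAt_id (0 : ℂ)).sub_const _).inv (by
        rw [id, zero_sub, neg_ne_zero]; exact hk)
    have h2 := ih.1.mul h1
    rw [ih.2] at h2
    simp only [Finset.prod_range_succ]
    refine h2.congr_deriv ?_
    rw [Finset.sum_Icc_succ_top (by omega), Nat.factorial_succ, Nat.cast_mul, zero_sub, pow_succ]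
    field_simp
    ring

/-- Explains the two cases of `detTerm`. If `α` is not a pole of `Γ`, the zero of `1/Γ` leaves only
`c Γ(α) l^{-α}`. If `α = -k`, the quotient is nonzero at `0`, and the product rule yields the
harmonic number and `-log l`. -/
theorem deriv_gammaQuot_mul_cpow (c : ℂ) (α : ℝ) {l : ℂ} (hl : l ≠ 0) :
    HasDerivAt (fun s => c * (gammaQuot α s * l ^ (-(s + α)))) (detTerm c α l) 0 := by
  have hp : HasDerivAt (fun s : ℂ => l ^ (-(s + α))) (l ^ (-(0 + (α : ℂ))) * Complex.log l * -1) 0 :=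
    (((hasDerivAt_id (0 : ℂ)).add_const (α : ℂ)).neg).const_cpow (Or.inl hl)
  rw [detTerm]
  split_ifs with h
  · have h1 : gammaQuot α = fun s : ℂ => ∏ j ∈ Finset.range ⌊-α⌋₊, (s - (j + 1 : ℕ))⁻¹ := by
      funext s; rw [gammaQuot, if_pos h]
    rw [h1]
    obtain ⟨hd, hv⟩ := hasDerivAt_prod_inv ⌊-α⌋₊
    have h2 := (hd.mul hp).const_mul c
    refine h2.congr_deriv ?_
    have h3 : l ^ (-(0 + (α : ℂ))) = l ^ ⌊-α⌋₊ := by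
      rw [← Complex.cpow_natCast]
      congr 1
      rw [zero_add]
      conv_lhs => rw [h]
      push_cast; ring
    simp only [hv, h3]
    ring
  · have h1 : gammaQuot α = fun s => Complex.Gamma (s + α) * (Complex.Gamma s)⁻¹ := by
      funext s; rw [gammaQuot, if_neg h]
    rw [h1]
    have hG : DifferentiableAt ℂ (fun s => Complex.Gamma (s + α)) 0 := by
      refine DifferentiableAt.comp (g := Complex.Gamma) (0 : ℂ) ?_ (by fun_prop)
      rw [zero_add]
      exact Complex.differentiableAt_Gamma _ (ne_neg_nat_of_not h)
    have h2 := ((hG.hasDerivAt.mul hasDerivAt_inv_Gamma_zero).mul hp).const_mul c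
    refine h2.congr_deriv ?_
    simp
    ring

/-! ### Continuation of the zeta function -/

/-- The continuation of `∑ (b_n + l) ^ (-s)` obtained by splitting off the terms `ν < N` of the
expansion of the theta series. -/
def zetaCont (b : ℕ → ℂ) (l : ℂ) (c : ℕ → ℂ) (α : ℕ → ℝ) (N : ℕ) (s : ℂ) : ℂ :=
  ∑ ν ∈ Finset.range N, c ν * (gammaQuot (α ν) s * l ^ (-(s + α ν))) +
    (Complex.Gamma s)⁻¹ * laplaceMellin (fun t => theta b t - powSum c α N t) l s

theorem hasPowerExp_powSum (z : ℂ) (c : ℕ → ℂ) (α : ℕ → ℝ) (N : ℕ) :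
    HasPowerExp (fun t => z * powSum c α N t) := by
  refine (hasPowerExp_const z).mul fun r =>
    ⟨∑ ν ∈ Finset.range N, AddMonoidAlgebra.single (α ν) (c ν), 0, fun t ht => ?_⟩
  rw [map_sum, Finset.sum_congr rfl fun ν _ => evalPow_single ht.1 (α ν) (c ν)]
  simp [powSum]

/-- Reindexes the defining bounds by the number of terms removed. The empty sum is not among them;
its bound by `t ^ α 0` is recovered from that for one term. -/
theorem HasHeatExpansion.exists_norm_sub_powSum_le {b c : ℕ → ℂ} {α : ℕ → ℝ}
    (h : HasHeatExpansion b c α) (N : ℕ) : ∃ C : ℝ, ∀ t ∈ Set.Ioo (0 : ℝ) 1,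
      ‖theta b t - powSum c α N t‖ ≤ C * t ^ α N := by
  cases N with
  | succ N => exact h.bound N
  | zero =>
    obtain ⟨C, hC⟩ := h.bound 0
    refine ⟨|C| + ‖c 0‖, fun t ht => ?_⟩
    have h1 : t ^ α (0 + 1) ≤ t ^ α 0 :=
      Real.rpow_le_rpow_of_exponent_ge ht.1 ht.2.le (h.mono (Nat.le_succ 0))
    have h2 := hC t ht
    simp only [Nat.zero_add, Finset.sum_range_one] at h2 h1
    have h3 : theta b t - powSum c α 0 t =
        (theta b t - c 0 * ((t ^ α 0 : ℝ) : ℂ)) + c 0 * ((t ^ α 0 : ℝ) : ℂ) := by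
      simp [powSum]
    have h4 : ‖c 0 * ((t ^ α 0 : ℝ) : ℂ)‖ = ‖c 0‖ * t ^ α 0 := by
      rw [norm_mul, Complex.norm_real, Real.norm_of_nonneg (Real.rpow_nonneg ht.1.le _)]
    rw [h3, add_mul]
    refine (norm_add_le _ _).trans (add_le_add (h2.trans ?_) h4.le)
    have := Real.rpow_nonneg ht.1.le (α 1)
    have := le_abs_self C
    gcongr

section

variable {b : ℕ → ℂ} {R : ℝ} {l : ℂ} (hb : IsThetaSeq b) (hR : ∀ n, -R ≤ (b n).re)
  (hRl : R < l.re) (hl : 0 < l.re) {c : ℕ → ℂ} {α : ℕ → ℝ}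

include hb

theorem continuousOn_theta_sub_powSum (c : ℕ → ℂ) (α : ℕ → ℝ) (N : ℕ) :
    ContinuousOn (fun t => theta b t - powSum c α N t) (Set.Ioi 0) :=
  hb.continuousOn_theta.sub (continuousOn_powSum c α N)

include hR hRl hl

theorem exists_norm_theta_sub_le {N : ℕ} {r C : ℝ}
    (h : ∀ t ∈ Set.Ioo (0 : ℝ) 1, ‖theta b t - powSum c α N t‖ ≤ C * t ^ r) :
    ∃ C' R' : ℝ, R' < l.re ∧
      ∀ t : ℝ, 0 < t → ‖theta b t - powSum c α N t‖ ≤ C' * (t ^ r * Real.exp (R' * t)) := by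
  obtain ⟨R', h1, h2⟩ := exists_between (max_lt hRl hl)
  obtain ⟨C', -, hC'⟩ := hb.exists_norm_sub_le hR ((le_max_left _ _).trans_lt h1)
    ((le_max_right _ _).trans_lt h1) h
  exact ⟨C', R', h2, hC'⟩

/-- Where the integrals converge, removing one more power from the theta series lowers the Mellin
integral by exactly what the new `gammaQuot` term restores. -/
theorem zetaCont_succ {N : ℕ} {r C : ℝ} {s : ℂ}
    (h : ∀ t ∈ Set.Ioo (0 : ℝ) 1, ‖theta b t - powSum c α N t‖ ≤ C * t ^ r)
    (hs : 0 < s.re + r) (hsα : 0 < s.re + α N) :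
    zetaCont b l c α (N + 1) s = zetaCont b l c α N s := by
  obtain ⟨C', R', hR', hC'⟩ := exists_norm_theta_sub_le hb hR hRl hl h
  have hint := integrableOn_laplaceMellin (continuousOn_theta_sub_powSum hb c α N) hC' hR' hs
  have hsα' : 0 < (s + (α N : ℂ)).re := by simpa using hsα
  have hint2 := (integrableOn_cpow_mul_exp hl hsα').const_mul (c N)
  have h1 : laplaceMellin (fun t => theta b t - powSum c α (N + 1) t) l s =
      laplaceMellin (fun t => theta b t - powSum c α N t) l s -
        c N * (Complex.Gamma (s + α N) * l ^ (-(s + α N))) := by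
    rw [laplaceMellin, laplaceMellin, ← integral_cpow_mul_exp hl hsα', ← integral_const_mul,
      ← integral_sub hint hint2]
    refine setIntegral_congr_fun measurableSet_Ioi fun t (ht : 0 < t) => ?_
    have h2 : (t : ℂ) ^ (s + (α N : ℂ) - 1) = (t : ℂ) ^ (s - 1) * ((t ^ α N : ℝ) : ℂ) := by
      rw [Complex.ofReal_cpow ht.le, ← Complex.cpow_add _ _ (by exact_mod_cast ht.ne')]
      congr 1; ring
    simp only [powSum, Finset.sum_range_succ, h2]
    ring
  rw [zetaCont, zetaCont, h1, Finset.sum_range_succ, gammaQuot_eq hsα]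
  ring

/-- Holds for arbitrary `c` and `α`: far to the right any remainder is integrable at `0`. For `N =
0` it is the Mellin representation of the zeta series. -/
theorem hasSum_zetaCont (c : ℕ → ℂ) (α : ℕ → ℝ) (N : ℕ) : ∃ σ : ℝ, ∀ s : ℂ, σ < s.re →
    HasSum (fun n => (b n + l) ^ (-s)) (zetaCont b l c α N s) := by
  induction N with
  | zero =>
    obtain ⟨σ, hσ⟩ := (hb.add_const l).exists_hasSum_cpow (sub_pos.2 hRl) fun n => by
      have := hR n
      simp only [Complex.add_re]; linarith
    refine ⟨σ, fun s hs => ?_⟩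
    have := hσ s hs
    rw [laplaceMellin_theta_add_const] at this
    simpa [zetaCont, powSum] using this
  | succ N ih =>
    obtain ⟨σ, hσ⟩ := ih
    obtain ⟨r, C, -, hr⟩ := (hb.hasPowerExp.add (hasPowerExp_powSum (-1) c α N)).exists_norm_le
    refine ⟨max σ (max (-r) (-α N)), fun s hs => ?_⟩
    obtain ⟨h1, h2⟩ := max_lt_iff.1 hs
    obtain ⟨h2, h3⟩ := max_lt_iff.1 h2
    rw [zetaCont_succ hb hR hRl hl (r := r) (C := C) (fun t ht => ?_) (by linarith) (by linarith)]
    · exact hσ s h1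
    · have := hr t ht
      rwa [neg_one_mul, ← sub_eq_add_neg] at this

theorem analyticOnNhd_laplaceMellin {N : ℕ} {r C : ℝ}
    (h : ∀ t ∈ Set.Ioo (0 : ℝ) 1, ‖theta b t - powSum c α N t‖ ≤ C * t ^ r) :
    AnalyticOnNhd ℂ (laplaceMellin (fun t => theta b t - powSum c α N t) l) {s | -r < s.re} := by
  obtain ⟨C', R', hR', hC'⟩ := exists_norm_theta_sub_le hb hR hRl hl h
  refine DifferentiableOn.analyticOnNhd (fun s (hs : -r < s.re) => ?_)
    (isOpen_lt continuous_const Complex.continuous_re)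
  exact (differentiableAt_laplaceMellin_right (continuousOn_theta_sub_powSum hb c α N) hC' hR'
    (by linarith)).differentiableWithinAt

omit hb hR hRl in
theorem analyticAt_cpow_neg_add (α s : ℂ) : AnalyticAt ℂ (fun s => l ^ (-(s + α))) s := by
  have h0 : l ≠ 0 := fun h => by simp [h] at hl
  refine Differentiable.analyticAt (fun s => ?_) s
  exact DifferentiableAt.const_cpow (by fun_prop) (Or.inl h0)

theorem meromorphicOn_zetaCont {N : ℕ} {r C : ℝ}
    (h : ∀ t ∈ Set.Ioo (0 : ℝ) 1, ‖theta b t - powSum c α N t‖ ≤ C * t ^ r) :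
    MeromorphicOn (zetaCont b l c α N) {s | -r < s.re} := by
  intro s hs
  refine MeromorphicAt.add (MeromorphicAt.fun_sum fun ν _ => ?_) (MeromorphicAt.mul ?_ ?_)
  · exact (MeromorphicAt.const _ _).mul
      ((meromorphicAt_gammaQuot _ _).mul (analyticAt_cpow_neg_add hl _ _).meromorphicAt)
  · exact (analyticAt_inv_Gamma s).meromorphicAt
  · exact (analyticOnNhd_laplaceMellin hb hR hRl hl h s hs).meromorphicAt

theorem analyticAt_zetaCont_zero {N : ℕ} {r C : ℝ} (hr : 0 < r)
    (h : ∀ t ∈ Set.Ioo (0 : ℝ) 1, ‖theta b t - powSum c α N t‖ ≤ C * t ^ r) :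
    AnalyticAt ℂ (zetaCont b l c α N) 0 := by
  refine AnalyticAt.add (Finset.analyticAt_fun_sum _ fun ν _ => ?_)
    ((analyticAt_inv_Gamma 0).mul
      (analyticOnNhd_laplaceMellin hb hR hRl hl h 0 (by simpa using hr)))
  exact analyticAt_const.mul
    ((analyticAt_gammaQuot_zero _).mul (analyticAt_cpow_neg_add hl _ _))

theorem deriv_zetaCont_zero {N : ℕ} {r C : ℝ} (hr : 0 < r)
    (h : ∀ t ∈ Set.Ioo (0 : ℝ) 1, ‖theta b t - powSum c α N t‖ ≤ C * t ^ r) :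
    deriv (zetaCont b l c α N) 0 = ∑ ν ∈ Finset.range N, detTerm (c ν) (α ν) l +
      laplaceMellin (fun t => theta b t - powSum c α N t) l 0 := by
  have h0 : l ≠ 0 := fun h => by simp [h] at hl
  have h1 : HasDerivAt (fun s => ∑ ν ∈ Finset.range N,
      c ν * (gammaQuot (α ν) s * l ^ (-(s + α ν)))) (∑ ν ∈ Finset.range N,
        detTerm (c ν) (α ν) l) 0 :=
    HasDerivAt.fun_sum fun ν _ => deriv_gammaQuot_mul_cpow (c ν) (α ν) h0
  have h2 := hasDerivAt_inv_Gamma_zero.mul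
    (analyticOnNhd_laplaceMellin hb hR hRl hl h 0 (by simpa using hr)).differentiableAt.hasDerivAt
  have h3 := (h1.add h2).deriv
  refine h3.trans ?_
  simp

end

end RegDet
end

noncomputable section
namespace RegDet
open Filter Topology MeasureTheory

/-! ### The regularized product -/

theorem isZetaContinuation_toMeromorphicNFOn {a : ℕ → ℂ} {Z : ℂ → ℂ}
    (hZ : MeromorphicOn Z Set.univ) {σ : ℝ} (han : ∀ s : ℂ, σ < s.re → AnalyticAt ℂ Z s)
    (hs : ∀ s : ℂ, σ < s.re → HasSum (fun n => a n ^ (-s)) (Z s)) :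
    IsZetaContinuation a (toMeromorphicNFOn Z Set.univ) := by
  refine ⟨meromorphicNFOn_toMeromorphicNFOn Z Set.univ, σ, fun s h => ?_⟩
  rw [toMeromorphicNFOn_eq_toMeromorphicNFAt hZ (Set.mem_univ s),
    toMeromorphicNFAt_eq_self.2 (han s h).meromorphicNFAt]
  exact hs s h

theorem zeta_spec {a : ℕ → ℂ} (h : ∃ Z, IsZetaContinuation a Z) :
    IsZetaContinuation a (zeta a) := by
  rw [zeta, dif_pos h]
  exact h.choose_spec

theorem analyticAt_const_cpow_neg {z : ℂ} (hz : z ≠ 0) (s : ℂ) :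
    AnalyticAt ℂ (fun s => z ^ (-s)) s := by
  refine Differentiable.analyticAt (fun s => ?_) s
  exact DifferentiableAt.const_cpow (by fun_prop) (Or.inl hz)

theorem analyticAt_sum_cpow_neg {a : ℕ → ℂ} (h0 : ∀ n, a n ≠ 0) (M : ℕ) (s : ℂ) :
    AnalyticAt ℂ (fun s : ℂ => ∑ n ∈ Finset.range M, a n ^ (-s)) s :=
  Finset.analyticAt_fun_sum _ fun n _ => analyticAt_const_cpow_neg (h0 n) s

theorem hasSum_of_hasSum_tail {a : ℕ → ℂ} {M : ℕ} {s z : ℂ}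
    (h : HasSum (fun n => a (n + M) ^ (-s)) z) :
    HasSum (fun n => a n ^ (-s)) (∑ n ∈ Finset.range M, a n ^ (-s) + z) := by
  rw [add_comm]
  exact (hasSum_nat_add_iff (f := fun n => a n ^ (-s)) M).1 h

/-- The functions `zetaCont b l c α N` live on the half planes `Re s > -α_N`, which exhaust the
plane, and agree on overlaps. Choosing `N` separately for each `s` therefore glues them. -/
theorem IsThetaSeq.exists_meromorphicOn {b : ℕ → ℂ} (hb : IsThetaSeq b) {R : ℝ} {l : ℂ}
    (hR : ∀ n, -R ≤ (b n).re) (hRl : R < l.re) (hl : 0 < l.re) :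
    ∃ (Z : ℂ → ℂ) (σ : ℝ), MeromorphicOn Z Set.univ ∧ (∀ s : ℂ, σ < s.re → AnalyticAt ℂ Z s) ∧
      ∀ s : ℂ, σ < s.re → HasSum (fun n => (b n + l) ^ (-s)) (Z s) := by
  obtain ⟨c, α, hc⟩ := hb.hasPowerExp.exists_hasHeatExpansion
  choose C hC using hc.exists_norm_sub_powSum_le
  have hex : ∀ s : ℂ, ∃ N, -α N < s.re := fun s => by
    obtain ⟨N, hN⟩ := (hc.tendsto.eventually_gt_atTop (-s.re)).exists
    exact ⟨N, by linarith⟩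
  have hmono : ∀ (N k : ℕ) (s : ℂ), -α N < s.re →
      zetaCont b l c α (N + k) s = zetaCont b l c α N s := by
    intro N k s hs
    induction k with
    | zero => rfl
    | succ k ih =>
      have h1 := hc.mono (Nat.le_add_right N k)
      rw [← add_assoc, zetaCont_succ hb hR hRl hl (hC (N + k)) (by linarith) (by linarith), ih]
  have huniq : ∀ (N N' : ℕ) (s : ℂ), -α N < s.re → -α N' < s.re →
      zetaCont b l c α N s = zetaCont b l c α N' s := by
    intro N N' s h h'
    rcases le_total N N' with hN | hN
    · obtain ⟨k, rfl⟩ := Nat.exists_eq_add_of_le hN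
      exact (hmono N k s h).symm
    · obtain ⟨k, rfl⟩ := Nat.exists_eq_add_of_le hN
      exact hmono N' k s h'
  choose N hN using hex
  have hev : ∀ (K : ℕ) (s : ℂ), -α K < s.re →
      zetaCont b l c α K =ᶠ[𝓝 s] fun s => zetaCont b l c α (N s) s := by
    intro K s hs
    filter_upwards [(isOpen_lt continuous_const Complex.continuous_re).mem_nhds hs] with z hz
    exact huniq _ _ z hz (hN z)
  obtain ⟨σ, hσ⟩ := hasSum_zetaCont hb hR hRl hl c α 0
  refine ⟨fun s => zetaCont b l c α (N s) s, max σ (-α 0), fun s _ => ?_, fun s hs => ?_,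
    fun s hs => ?_⟩
  · exact (meromorphicOn_zetaCont hb hR hRl hl (hC (N s)) s (hN s)).congr
      ((hev (N s) s (hN s)).filter_mono nhdsWithin_le_nhds)
  · have h0 : -α 0 < s.re := (le_max_right _ _).trans_lt hs
    refine AnalyticAt.congr ?_ (hev 0 s h0)
    have h1 := (analyticAt_inv_Gamma s).mul
      (analyticOnNhd_laplaceMellin hb hR hRl hl (hC 0) s h0)
    refine h1.congr (Eventually.of_forall fun z => ?_)
    simp [zetaCont]
  · change HasSum _ (zetaCont b l c α (N s) s)
    rw [huniq (N s) 0 s (hN s) ((le_max_right _ _).trans_lt hs)]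
    exact hσ s ((le_max_left _ _).trans_lt hs)

theorem IsThetaSeq.exists_isZetaContinuation {a : ℕ → ℂ} (ha : IsThetaSeq a) (h0 : ∀ n, a n ≠ 0) :
    ∃ Z, IsZetaContinuation a Z := by
  obtain ⟨M, hM⟩ := ha.exists_tail_le_re 1
  -- The continuation requires a translation by some `l` with `Re l > 0`. A tail with real parts at
  -- least `1` is written as `(a_n - 1) + 1`.
  obtain ⟨Z, σ, hZ, han, hs⟩ := ((ha.tail M).add_const (-1)).exists_meromorphicOn (R := 0) (l := 1)
    (fun n => by have := hM n; simp; linarith) (by simp) (by simp)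
  simp only [neg_add_cancel_right] at hs
  have hfin := analyticAt_sum_cpow_neg h0 M
  refine ⟨_, isZetaContinuation_toMeromorphicNFOn (σ := σ)
    (Z := fun s : ℂ => ∑ n ∈ Finset.range M, a n ^ (-s) + Z s) ?_ ?_ ?_⟩
  · exact fun s hs => (hfin s).meromorphicAt.add (hZ s hs)
  · exact fun s h => (hfin s).add (han s h)
  · exact fun s h => hasSum_of_hasSum_tail (hs s h)

/-- `Y` is a continuation of the zeta series to a half plane containing `0`, analytic at `0`. -/
structure IsZetaGerm (a : ℕ → ℂ) (Y : ℂ → ℂ) : Prop where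
  meromorphicOn : ∃ δ > 0, MeromorphicOn Y {s | -δ < s.re}
  hasSum : ∃ σ : ℝ, ∀ s : ℂ, σ < s.re → HasSum (fun n => a n ^ (-s)) (Y s)
  analyticAt : AnalyticAt ℂ Y 0

/-- `zeta a` and `Y` coincide far to the right, hence meromorphically on the connected half plane
`Re s > -δ`. Normal form and analyticity of `Y` turn agreement on a punctured neighbourhood of `0`
into agreement at `0`. -/
theorem IsZetaGerm.logRegProd_eq {a : ℕ → ℂ} {Y : ℂ → ℂ} (hY : IsZetaGerm a Y)
    (h : ∃ Z, IsZetaContinuation a Z) : logRegProd a = -deriv Y 0 := by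
  obtain ⟨hZ, σ, hσ⟩ := zeta_spec h
  obtain ⟨δ, hδ, hm⟩ := hY.meromorphicOn
  obtain ⟨σ', hσ'⟩ := hY.hasSum
  set U : Set ℂ := {s | -δ < s.re} with hU
  have hd : MeromorphicOn (zeta a - Y) U := fun s hs =>
    (hZ.meromorphicOn s (Set.mem_univ s)).sub (hm s hs)
  have h0 : (0 : ℂ) ∈ U := by simpa [hU] using hδ
  have hzero : meromorphicOrderAt (zeta a - Y) 0 = ⊤ := by
    by_contra hne
    set x : ℂ := ((max (max σ σ') 0 + 1 : ℝ) : ℂ) with hx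
    have hx1 : σ < x.re := by
      have := (le_max_left σ σ').trans (le_max_left _ (0 : ℝ))
      simp only [hx, Complex.ofReal_re]; linarith
    have hx2 : σ' < x.re := by
      have := (le_max_right σ σ').trans (le_max_left _ (0 : ℝ))
      simp only [hx, Complex.ofReal_re]; linarith
    have hxU : x ∈ U := by
      have := le_max_right (max σ σ') (0 : ℝ)
      simp only [hU, Set.mem_ofPred_eq, hx, Complex.ofReal_re]; linarith
    refine hd.meromorphicOrderAt_ne_top_of_isPreconnected
      (convex_halfSpace_re_gt (-δ)).isPreconnected h0 hxU hne ?_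
    rw [meromorphicOrderAt_eq_top_iff]
    refine Filter.Eventually.filter_mono nhdsWithin_le_nhds ?_
    filter_upwards [(isOpen_lt continuous_const Complex.continuous_re).mem_nhds hx1,
      (isOpen_lt continuous_const Complex.continuous_re).mem_nhds hx2] with z h1 h2
    rw [Pi.sub_apply, sub_eq_zero]
    exact (hσ z h1).unique (hσ' z h2)
  rw [meromorphicOrderAt_eq_top_iff] at hzero
  have hev : zeta a =ᶠ[𝓝[≠] 0] Y := by
    filter_upwards [hzero] with z hz
    exact sub_eq_zero.1 hz
  have hev' := ((hZ (Set.mem_univ 0)).eventuallyEq_nhdsNE_iff_eventuallyEq_nhds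
    hY.analyticAt.meromorphicNFAt).1 hev
  rw [logRegProd, hev'.deriv_eq]

theorem logRegProd_comp_perm (a : ℕ → ℂ) (σ : Equiv.Perm ℕ) :
    logRegProd (a ∘ σ) = logRegProd a := by
  have h : IsZetaContinuation (a ∘ σ) = IsZetaContinuation a := by
    funext Z
    refine propext (and_congr Iff.rfl (exists_congr fun x => forall₂_congr fun s _ => ?_))
    exact σ.hasSum_iff (f := fun n => a n ^ (-s))
  rw [logRegProd, logRegProd, zeta, zeta, h]

section

variable {b : ℕ → ℂ} {R : ℝ} {l : ℂ} {c : ℕ → ℂ} {α : ℕ → ℝ}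

theorem IsThetaSeq.isZetaGerm (hb : IsThetaSeq b) (hR : ∀ n, -R ≤ (b n).re) (hRl : R < l.re)
    (hl : 0 < l.re) {N : ℕ} {r C : ℝ} (hr : 0 < r)
    (h : ∀ t ∈ Set.Ioo (0 : ℝ) 1, ‖theta b t - powSum c α N t‖ ≤ C * t ^ r) :
    IsZetaGerm (fun n => b n + l) (zetaCont b l c α N) :=
  ⟨⟨r, hr, meromorphicOn_zetaCont hb hR hRl hl h⟩, hasSum_zetaCont hb hR hRl hl c α N,
    analyticAt_zetaCont_zero hb hR hRl hl hr h⟩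

/-- The exact formula from which analyticity and both asymptotic expansions are read off. -/
theorem IsThetaSeq.neg_logRegProd_add_const (hb : IsThetaSeq b) (hR : ∀ n, -R ≤ (b n).re)
    (hRl : R < l.re) (hl : 0 < l.re) {N : ℕ} {r C : ℝ} (hr : 0 < r)
    (h : ∀ t ∈ Set.Ioo (0 : ℝ) 1, ‖theta b t - powSum c α N t‖ ≤ C * t ^ r) :
    -logRegProd (fun n => b n + l) = ∑ ν ∈ Finset.range N, detTerm (c ν) (α ν) l +
      laplaceMellin (fun t => theta b t - powSum c α N t) l 0 := by
  rw [(hb.isZetaGerm hR hRl hl hr h).logRegProd_eq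
    ((hb.add_const l).exists_isZetaContinuation fun n h0 => ?_), neg_neg,
    deriv_zetaCont_zero hb hR hRl hl hr h]
  have h1 := congrArg Complex.re h0
  have h2 := hR n
  simp only [Complex.add_re, Complex.zero_re] at h1
  linarith

theorem IsThetaSeq.exists_powSum (hb : IsThetaSeq b) (r₀ : ℝ) : ∃ (c : ℕ → ℂ) (α : ℕ → ℝ) (N : ℕ)
    (r C : ℝ), r₀ < r ∧ ∀ t ∈ Set.Ioo (0 : ℝ) 1, ‖theta b t - powSum c α N t‖ ≤ C * t ^ r := by
  obtain ⟨c, α, hc⟩ := hb.hasPowerExp.exists_hasHeatExpansion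
  obtain ⟨N, hN⟩ := (hc.tendsto.eventually_gt_atTop r₀).exists
  obtain ⟨C, hC⟩ := hc.exists_norm_sub_powSum_le N
  exact ⟨c, α, N, α N, C, hN, hC⟩

/-- A sequence in a half plane `Re ≥ η > 0` has a zeta function that is analytic at `0`. -/
theorem IsThetaSeq.exists_isZetaGerm {a : ℕ → ℂ} (ha : IsThetaSeq a) {η : ℝ} (hη : 0 < η)
    (hre : ∀ n, η ≤ (a n).re) : ∃ Y, IsZetaGerm a Y := by
  obtain ⟨c, α, N, r, C, hr, hC⟩ := (ha.add_const (-(η / 2 : ℝ))).exists_powSum 0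
  have := (ha.add_const (-(η / 2 : ℝ))).isZetaGerm (R := 0) (l := ((η / 2 : ℝ) : ℂ))
    (fun n => by
      have := hre n
      simp only [Complex.add_re, Complex.neg_re, Complex.ofReal_re]; linarith)
    (by rw [Complex.ofReal_re]; linarith) (by rw [Complex.ofReal_re]; linarith) hr hC
  simp only [neg_add_cancel_right] at this
  exact ⟨_, this⟩

/-- A single factor adds the entire function `a_n ^ (-s)` to the zeta function, with derivative
`-log a_n` at `0`. The tail lies in a half plane `Re ≥ η > 0`, so its zeta function is analytic at
`0`. -/
theorem logRegProd_eq_sum_log_add {a : ℕ → ℂ} (ha : IsThetaSeq a) (h0 : ∀ n, a n ≠ 0) {M : ℕ}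
    {η : ℝ} (hη : 0 < η) (hre : ∀ n, η ≤ (a (n + M)).re) :
    logRegProd a = ∑ n ∈ Finset.range M, Complex.log (a n) + logRegProd fun n => a (n + M) := by
  obtain ⟨Y, hY⟩ := (ha.tail M).exists_isZetaGerm hη hre
  have hfin := analyticAt_sum_cpow_neg h0 M
  have hY' : IsZetaGerm a fun s : ℂ => ∑ n ∈ Finset.range M, a n ^ (-s) + Y s := by
    obtain ⟨δ, hδ, hm⟩ := hY.meromorphicOn
    obtain ⟨σ, hσ⟩ := hY.hasSum
    exact ⟨⟨δ, hδ, fun s hs => (hfin s).meromorphicAt.add (hm s hs)⟩,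
      ⟨σ, fun s hs => hasSum_of_hasSum_tail (hσ s hs)⟩, (hfin 0).add hY.analyticAt⟩
  rw [hY'.logRegProd_eq (ha.exists_isZetaContinuation h0),
    hY.logRegProd_eq ((ha.tail M).exists_isZetaContinuation fun n => h0 _)]
  have h1 : HasDerivAt (fun s : ℂ => ∑ n ∈ Finset.range M, a n ^ (-s))
      (∑ n ∈ Finset.range M, a n ^ (-(0 : ℂ)) * Complex.log (a n) * -1) 0 :=
    HasDerivAt.fun_sum fun n _ => (hasDerivAt_neg (0 : ℂ)).const_cpow (Or.inl (h0 n))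
  have h2 := (h1.add hY.analyticAt.differentiableAt.hasDerivAt).deriv
  have h3 : deriv (fun s : ℂ => ∑ n ∈ Finset.range M, a n ^ (-s) + Y s) 0 =
      ∑ n ∈ Finset.range M, a n ^ (-(0 : ℂ)) * Complex.log (a n) * -1 + deriv Y 0 := h2
  rw [h3]
  simp [add_comm]

/-- The regularized product of `b_n + l` is analytic in `l`. -/
theorem IsThetaSeq.analyticAt_logRegProd (hb : IsThetaSeq b) {l : ℂ} {η : ℝ} (hη : 0 < η)
    (hre : ∀ n, η ≤ (b n + l).re) : AnalyticAt ℂ (fun l => logRegProd fun n => b n + l) l := by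
  -- Recentring: `b_n + m` has nonnegative real part, while `z - m` stays in `Re > η / 4` for `z`
  -- near `l`. Thus the exact formula applies to `b + m` on a whole neighbourhood.
  set m : ℂ := l - ((η / 2 : ℝ) : ℂ) with hm
  have hb' := hb.add_const m
  have hR : ∀ n, -(0 : ℝ) ≤ (b n + m).re := fun n => by
    have := hre n
    simp only [hm, Complex.add_re, Complex.sub_re, Complex.ofReal_re] at this ⊢
    linarith
  obtain ⟨c, α, N, r, C, hr, hC⟩ := hb'.exists_powSum 0
  have hopen : IsOpen {z : ℂ | η / 4 < (z - m).re} :=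
    isOpen_lt continuous_const (Complex.continuous_re.comp (by fun_prop))
  have hl : l ∈ {z : ℂ | η / 4 < (z - m).re} := by
    simp only [Set.mem_ofPred_eq, hm, sub_sub_cancel, Complex.ofReal_re]; linarith
  obtain ⟨C', -, hC'⟩ := hb'.exists_norm_sub_le (R' := η / 4) hR (by linarith) (by linarith) hC
  have hev : ∀ z ∈ {z : ℂ | η / 4 < (z - m).re}, -(∑ ν ∈ Finset.range N,
      detTerm (c ν) (α ν) (z - m) + laplaceMellin (fun t => theta (fun n => b n + m) t -
        powSum c α N t) (z - m) 0) = logRegProd fun n => b n + z := by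
    intro z hz
    have hz : η / 4 < (z - m).re := hz
    rw [← hb'.neg_logRegProd_add_const hR (by linarith) (by linarith) hr hC, neg_neg]
    simp only [add_assoc, add_sub_cancel]
  refine AnalyticAt.congr ?_ (eventually_of_mem (hopen.mem_nhds hl) hev)
  refine DifferentiableOn.analyticAt (s := {z : ℂ | η / 4 < (z - m).re}) (fun z hz => ?_)
    (hopen.mem_nhds hl)
  have hz : η / 4 < (z - m).re := hz
  refine DifferentiableAt.differentiableWithinAt (DifferentiableAt.neg
    (DifferentiableAt.add (DifferentiableAt.fun_sum fun ν _ => ?_) ?_))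
  · have hs : z - m ∈ Complex.slitPlane := Or.inl (by linarith)
    have hd : DifferentiableAt ℂ (fun z => z - m) z := by fun_prop
    unfold detTerm
    split_ifs
    · exact ((((hd.clog hs).const_sub _).const_mul _).mul (hd.pow _))
    · exact (hd.cpow_const hs).const_mul _
  · exact DifferentiableAt.comp (g := fun l => laplaceMellin (fun t =>
      theta (fun n => b n + m) t - powSum c α N t) l 0) z
      (differentiableAt_laplaceMellin_left (continuousOn_theta_sub_powSum hb' c α N) hC' hz
        (by simpa using hr)) (by fun_prop)

end

end RegDet
end

noncomputable section
namespace RegDet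
open Filter Topology MeasureTheory

/-! ### The characteristic function -/

/-- `∏_{n < M} (b_n + l)` times the regularized product of the remaining factors. -/
def charFunPart (b : ℕ → ℂ) (M : ℕ) (l : ℂ) : ℂ :=
  (∏ n ∈ Finset.range M, (b n + l)) * Complex.exp (logRegProd fun n => b (n + M) + l)

theorem analyticOrderAt_prod_add (b : ℕ → ℂ) (M : ℕ) (z : ℂ) :
    AnalyticAt ℂ (fun l => ∏ n ∈ Finset.range M, (b n + l)) z ∧
    analyticOrderAt (fun l => ∏ n ∈ Finset.range M, (b n + l)) z =
      {n | n < M ∧ b n = -z}.encard := by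
  induction M with
  | zero =>
    refine ⟨by simpa using analyticAt_const, ?_⟩
    have h : AnalyticAt ℂ (fun _ : ℂ => (1 : ℂ)) z := analyticAt_const
    simpa using h.analyticOrderAt_eq_zero.2 one_ne_zero
  | succ M ih =>
    have hf : AnalyticAt ℂ (fun l => b M + l) z := by fun_prop
    have hprod : (fun l => ∏ n ∈ Finset.range (M + 1), (b n + l)) =
        (fun l => ∏ n ∈ Finset.range M, (b n + l)) * fun l => b M + l := by
      funext l
      rw [Finset.prod_range_succ]; rfl
    rw [hprod]
    refine ⟨ih.1.mul hf, ?_⟩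
    rw [analyticOrderAt_mul ih.1 hf, ih.2]
    by_cases h : b M = -z
    · have h1 : analyticOrderAt (fun l => b M + l) z = 1 := by
        rw [← Nat.cast_one, hf.analyticOrderAt_eq_natCast]
        exact ⟨fun _ => 1, analyticAt_const, one_ne_zero,
          Eventually.of_forall fun w => by rw [h, smul_eq_mul]; ring⟩
      have h2 : {n | n < M + 1 ∧ b n = -z} = insert M {n | n < M ∧ b n = -z} := by
        ext n
        simp only [Set.mem_ofPred_eq, Set.mem_insert_iff, Nat.lt_succ_iff_lt_or_eq]
        constructor
        · rintro ⟨h1 | h1, h2⟩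
          · exact Or.inr ⟨h1, h2⟩
          · exact Or.inl h1
        · rintro (rfl | ⟨h1, h2⟩)
          · exact ⟨Or.inr rfl, h⟩
          · exact ⟨Or.inl h1, h2⟩
      rw [h1, h2, Set.encard_insert_of_notMem (by simp)]
    · have h1 : analyticOrderAt (fun l => b M + l) z = 0 :=
        hf.analyticOrderAt_eq_zero.2 fun h0 => h (eq_neg_of_add_eq_zero_left h0)
      have h2 : {n | n < M + 1 ∧ b n = -z} = {n | n < M ∧ b n = -z} := by
        ext n
        simp only [Set.mem_ofPred_eq, Nat.lt_succ_iff_lt_or_eq]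
        constructor
        · rintro ⟨h1 | rfl, h2⟩
          · exact ⟨h1, h2⟩
          · exact absurd h2 h
        · rintro ⟨h1, h2⟩
          exact ⟨Or.inl h1, h2⟩
      rw [h1, h2, add_zero]

section

variable {b : ℕ → ℂ} (hb : IsThetaSeq b)
include hb

theorem analyticAt_charFunPart {M : ℕ} {l : ℂ} {η : ℝ} (hη : 0 < η)
    (hre : ∀ n, η ≤ (b (n + M) + l).re) : AnalyticAt ℂ (charFunPart b M) l :=
  (analyticOrderAt_prod_add b M l).1.mul ((hb.tail M).analyticAt_logRegProd hη hre).cexp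

/-- The exponential never vanishes, and no index beyond `M` satisfies `b n = -l` because those terms
have `Re (b n + l) > 0`; so the finite product sees every zero. -/
theorem analyticOrderAt_charFunPart {M : ℕ} {l : ℂ} {η : ℝ} (hη : 0 < η)
    (hre : ∀ n, η ≤ (b (n + M) + l).re) :
    analyticOrderAt (charFunPart b M) l = {n | b n = -l}.encard := by
  have h1 : AnalyticAt ℂ (fun l => Complex.exp (logRegProd fun n => b (n + M) + l)) l :=
    ((hb.tail M).analyticAt_logRegProd hη hre).cexp
  have h2 : charFunPart b M = (fun l => ∏ n ∈ Finset.range M, (b n + l)) *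
      fun l => Complex.exp (logRegProd fun n => b (n + M) + l) := rfl
  rw [h2, analyticOrderAt_mul (analyticOrderAt_prod_add b M l).1 h1,
    h1.analyticOrderAt_eq_zero.2 (Complex.exp_ne_zero _), add_zero,
    (analyticOrderAt_prod_add b M l).2]
  congr 1
  ext n
  refine ⟨fun h => h.2, fun h => ⟨?_, h⟩⟩
  by_contra! hn
  have h3 := hre (n - M)
  rw [Nat.sub_add_cancel hn, show b n = -l from h, neg_add_cancel, Complex.zero_re] at h3
  linarith

/-- Factors move between the product and the regularized product through `exp (log z) = z`, so no
choice of branch survives. -/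
theorem charFunPart_eq_of_le {M M' : ℕ} (hMM : M ≤ M') {l : ℂ} {η : ℝ} (hη : 0 < η)
    (hre : ∀ n, η ≤ (b (n + M) + l).re) : charFunPart b M' l = charFunPart b M l := by
  obtain ⟨k, rfl⟩ := Nat.exists_eq_add_of_le hMM
  have h0 : ∀ n, b (n + M) + l ≠ 0 := fun n h => by
    have := hre n
    rw [h, Complex.zero_re] at this
    linarith
  have h1 := logRegProd_eq_sum_log_add ((hb.tail M).add_const l) h0 (M := k) hη
    fun n => hre (n + k)
  rw [charFunPart, charFunPart, h1, Complex.exp_add, Complex.exp_sum, Finset.prod_range_add,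
    mul_assoc]
  congr 2
  · refine Finset.prod_congr rfl fun n _ => ?_
    rw [Complex.exp_log (h0 n), add_comm M n]
  · congr 3
    funext n
    congr 2
    ring

theorem exists_charFun : ∃ F : ℂ → ℂ, Differentiable ℂ F ∧
    (∀ l, (∀ n, b n + l ≠ 0) → F l = regProd fun n => b n + l) ∧
    ∀ z, analyticOrderAt F z = {n | b n = -z}.encard := by
  have hex : ∀ l : ℂ, ∃ M, ∀ n, 1 ≤ (b (n + M) + l).re := fun l => by
    obtain ⟨M, hM⟩ := hb.exists_tail_le_re (1 - l.re)
    exact ⟨M, fun n => by have := hM n; rw [Complex.add_re]; linarith⟩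
  choose M hM using hex
  have hev : ∀ l, (fun z => charFunPart b (M z) z) =ᶠ[𝓝 l] charFunPart b (M l) := by
    intro l
    -- Moving left by less than `1/2` keeps the tail beyond `M l` in `Re ≥ 1/2`, so the choice at
    -- `l` remains legitimate nearby and can be compared with that at `z`.
    have hU : {z : ℂ | l.re - 1 / 2 < z.re} ∈ 𝓝 l :=
      (isOpen_lt continuous_const Complex.continuous_re).mem_nhds (by simp)
    filter_upwards [hU] with z hz
    have hz : l.re - 1 / 2 < z.re := hz
    have h1 : ∀ n, 1 / 2 ≤ (b (n + M l) + z).re := fun n => by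
      have := hM l n
      rw [Complex.add_re] at this ⊢
      linarith
    rcases le_total (M l) (M z) with h | h
    · exact charFunPart_eq_of_le hb h one_half_pos h1
    · exact (charFunPart_eq_of_le hb h one_pos (hM z)).symm
  refine ⟨fun z => charFunPart b (M z) z, fun l => ?_, fun l h0 => ?_, fun z => ?_⟩
  · exact ((analyticAt_charFunPart hb one_pos (hM l)).congr (hev l).symm).differentiableAt
  · change charFunPart b (M l) l = _
    rw [regProd, logRegProd_eq_sum_log_add (hb.add_const l) h0 one_pos (hM l), Complex.exp_add,
      Complex.exp_sum, charFunPart]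
    congr 1
    exact Finset.prod_congr rfl fun n _ => (Complex.exp_log (h0 n)).symm
  · rw [analyticOrderAt_congr (hev z), analyticOrderAt_charFunPart hb one_pos (hM z)]

end

end RegDet
end

noncomputable section
namespace RegDet
open Filter Topology MeasureTheory

/-! ### Asymptotic expansions -/

theorem exists_norm_detTerm_le (c : ℂ) (α : ℝ) : ∃ D : ℝ, 0 ≤ D ∧ ∀ u : ℂ,
    ‖detTerm c α u‖ ≤ D * (1 + ‖Complex.log u‖) * ‖u‖ ^ (-α) := by
  by_cases h : α = -(⌊-α⌋₊ : ℝ)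
  · set H : ℂ := ∑ j ∈ Finset.Icc 1 ⌊-α⌋₊, (1 : ℂ) / (j : ℂ)
    set K : ℂ := c * ((-1) ^ ⌊-α⌋₊ / (Nat.factorial ⌊-α⌋₊ : ℂ))
    refine ⟨‖K‖ * (1 + ‖H‖), by positivity, fun u => ?_⟩
    rw [detTerm, if_pos h, norm_mul, norm_mul, norm_pow]
    have h1 : ‖u‖ ^ (-α) = ‖u‖ ^ ⌊-α⌋₊ := by
      rw [← Real.rpow_natCast, ← neg_eq_iff_eq_neg.2 h]
    rw [h1]
    have h2 : ‖H - Complex.log u‖ ≤ (1 + ‖H‖) * (1 + ‖Complex.log u‖) := by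
      refine (norm_sub_le _ _).trans ?_
      nlinarith [norm_nonneg H, norm_nonneg (Complex.log u),
        mul_nonneg (norm_nonneg H) (norm_nonneg (Complex.log u))]
    change ‖K‖ * ‖H - Complex.log u‖ * ‖u‖ ^ ⌊-α⌋₊ ≤ _
    calc _ ≤ ‖K‖ * ((1 + ‖H‖) * (1 + ‖Complex.log u‖)) * ‖u‖ ^ ⌊-α⌋₊ := by gcongr
      _ = _ := by ring
  · refine ⟨‖c * Complex.Gamma α‖, norm_nonneg _, fun u => ?_⟩
    rw [detTerm, if_neg h, norm_mul, ← Complex.ofReal_neg, Complex.norm_cpow_real]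
    have : 0 ≤ ‖c * Complex.Gamma α‖ * ‖u‖ ^ (-α) := by positivity
    nlinarith [mul_nonneg this (norm_nonneg (Complex.log u))]

theorem tendsto_detTerm_zero (c : ℂ) {α : ℝ} (hα : 0 < α) :
    Tendsto (detTerm c α) (comap norm atTop) (𝓝 0) := by
  have h : ¬ α = -(⌊-α⌋₊ : ℝ) := fun h => by
    have : (0 : ℝ) ≤ ⌊-α⌋₊ := Nat.cast_nonneg _
    linarith
  rw [tendsto_zero_iff_norm_tendsto_zero]
  have h1 : (fun u => ‖detTerm c α u‖) =
      (fun x : ℝ => ‖c * Complex.Gamma α‖ * x ^ (-α)) ∘ norm := by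
    funext u
    rw [detTerm, if_neg h, norm_mul, ← Complex.ofReal_neg, Complex.norm_cpow_real]
    rfl
  rw [h1]
  have h2 := (tendsto_rpow_neg_atTop hα).const_mul ‖c * Complex.Gamma α‖
  rw [mul_zero] at h2
  exact h2.comp tendsto_comap

theorem continuousAt_detTerm (c : ℂ) (α : ℝ) {u : ℂ} (hu : u ∈ Complex.slitPlane) :
    ContinuousAt (detTerm c α) u := by
  unfold detTerm
  split_ifs
  · exact ((continuousAt_const.sub (continuousAt_clog hu)).const_mul _).mul (continuousAt_id.pow _)
  · exact (continuousAt_cpow_const hu).const_mul _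

theorem isBigO_detTerm_ofReal (c : ℂ) {α β : ℝ} (h : β ≤ α) :
    (fun l : ℝ => detTerm c α (l : ℂ)) =O[atTop] fun l : ℝ => l ^ (-β) * Real.log l := by
  obtain ⟨D, hD, hDu⟩ := exists_norm_detTerm_le c α
  refine Asymptotics.IsBigO.of_bound (D * 2) ?_
  filter_upwards [eventually_ge_atTop (Real.exp 1)] with l hl
  have hl1 : 1 ≤ l := le_trans (Real.one_le_exp zero_le_one) hl
  have hl0 : 0 < l := by linarith
  have hlog : 1 ≤ Real.log l := (Real.le_log_iff_exp_le hl0).2 hl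
  have h1 := hDu l
  rw [← Complex.ofReal_log hl0.le, Complex.norm_real, Complex.norm_real,
    Real.norm_of_nonneg hl0.le, Real.norm_of_nonneg (by linarith)] at h1
  have h2 : l ^ (-α) ≤ l ^ (-β) := Real.rpow_le_rpow_of_exponent_le hl1 (by linarith)
  rw [Real.norm_of_nonneg (by positivity)]
  calc _ ≤ D * (1 + Real.log l) * l ^ (-α) := h1
    _ ≤ D * (2 * Real.log l) * l ^ (-β) := by
      gcongr
      linarith
    _ = _ := by ring

/-- The expansion of the regularized product along the positive real axis. -/
theorem IsThetaSeq.isBigO_logRegProd {b c : ℕ → ℂ} {α : ℕ → ℝ} (hb : IsThetaSeq b)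
    (hc : HasHeatExpansion b c α) (N : ℕ) :
    (fun l : ℝ => -logRegProd (fun n => b n + (l : ℂ)) -
      ∑ ν ∈ Finset.range N, detTerm (c ν) (α ν) (l : ℂ))
      =O[atTop] fun l : ℝ => l ^ (-α N) * Real.log l := by
  obtain ⟨R, hR⟩ := hb.exists_le_re
  -- The exact formula needs a positive exponent, which `α N` need not be. It is applied with a
  -- later `M`; the extra terms `N ≤ ν < M` are themselves of the claimed order.
  obtain ⟨M, hM, hNM⟩ := ((hc.tendsto.eventually_gt_atTop (max (α N) 0)).and
    (eventually_ge_atTop N)).exists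
  obtain ⟨hMN, hM0⟩ := max_lt_iff.1 hM
  obtain ⟨C, hC⟩ := hc.exists_norm_sub_powSum_le M
  set R' := |R| + 1 with hR'
  have hRR : R < R' := by have := le_abs_self R; linarith
  have hR'0 : 0 < R' := by positivity
  obtain ⟨C', hC'0, hC'⟩ := hb.exists_norm_sub_le hR hRR hR'0 hC
  have hsum : (fun l : ℝ => ∑ ν ∈ Finset.Ico N M, detTerm (c ν) (α ν) (l : ℂ))
      =O[atTop] fun l : ℝ => l ^ (-α N) * Real.log l :=
    Asymptotics.IsBigO.fun_sum fun ν hν =>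
      isBigO_detTerm_ofReal _ (hc.mono (Finset.mem_Ico.1 hν).1)
  have hrem : (fun l : ℝ => laplaceMellin (fun t => theta b t - powSum c α M t) (l : ℂ) 0)
      =O[atTop] fun l : ℝ => l ^ (-α N) * Real.log l := by
    refine Asymptotics.IsBigO.of_bound (C' * Real.Gamma (α M) * 2 ^ α M) ?_
    filter_upwards [eventually_ge_atTop (Real.exp 1), eventually_gt_atTop (2 * R')] with l hl hlR
    have hl1 : 1 ≤ l := le_trans (Real.one_le_exp zero_le_one) hl
    have hl0 : 0 < l := by linarith
    have hlog : 1 ≤ Real.log l := (Real.le_log_iff_exp_le hl0).2 hl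
    have h1 := norm_laplaceMellin_le hC' (l := (l : ℂ)) (s := 0)
      (by rw [Complex.ofReal_re]; linarith) (by simpa using hM0)
    rw [Complex.zero_re, zero_add, Complex.ofReal_re] at h1
    have h2 : (l - R') ^ (-α M) ≤ (l / 2) ^ (-α M) :=
      Real.rpow_le_rpow_of_nonpos (by linarith) (by linarith) (by linarith)
    have h3 : (l / 2) ^ (-α M) = 2 ^ α M * l ^ (-α M) := by
      rw [div_eq_mul_inv, Real.mul_rpow hl0.le (by norm_num), Real.inv_rpow (by norm_num),
        Real.rpow_neg (by norm_num : (0 : ℝ) ≤ 2), inv_inv]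
      ring
    have h4 : l ^ (-α M) ≤ l ^ (-α N) * Real.log l := by
      have h5 : l ^ (-α M) ≤ l ^ (-α N) := Real.rpow_le_rpow_of_exponent_le hl1 (by linarith)
      have h6 : 0 ≤ l ^ (-α N) := by positivity
      nlinarith
    have hΓ := (Real.Gamma_pos_of_pos hM0).le
    rw [Real.norm_of_nonneg (by positivity)]
    calc _ ≤ C' * Real.Gamma (α M) * (l - R') ^ (-α M) := h1
      _ ≤ C' * Real.Gamma (α M) * (2 ^ α M * (l ^ (-α N) * Real.log l)) := by
        rw [h3] at h2
        refine mul_le_mul_of_nonneg_left (h2.trans ?_) (by positivity)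
        exact mul_le_mul_of_nonneg_left h4 (by positivity)
      _ = _ := by ring
  refine (hsum.add hrem).congr' ?_ EventuallyEq.rfl
  filter_upwards [eventually_gt_atTop R'] with l hl
  rw [hb.neg_logRegProd_add_const hR (l := (l : ℂ)) (by rw [Complex.ofReal_re]; linarith)
    (by rw [Complex.ofReal_re]; linarith) hM0 hC, ← Finset.sum_range_add_sum_Ico _ hNM]
  ring

end RegDet
end

/-! ### Oscillatory integrals and the Riemann–Lebesgue lemma. -/

noncomputable section
namespace RegDet
open Filter Topology MeasureTheory

theorem continuousOn_rpow_mul_exp (β : ℝ) (z : ℂ) :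
    ContinuousOn (fun t : ℝ => ((t ^ β : ℝ) : ℂ) * Complex.exp (-(t : ℂ) * z)) (Set.Ioi 1) :=
  ContinuousOn.mul (Complex.continuous_ofReal.comp_continuousOn
    (continuousOn_id.rpow_const fun t (ht : 1 < t) => Or.inl (by simp only [id]; linarith)))
    (by fun_prop)

theorem integrableOn_Ioi_one_rpow_mul_exp {α : ℝ} (hα : α ≤ 0) {z : ℂ} (hz : 0 < z.re) :
    IntegrableOn (fun t : ℝ => ((t ^ (α - 1) : ℝ) : ℂ) * Complex.exp (-(t : ℂ) * z))
      (Set.Ioi 1) := by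
  refine Integrable.mono' (exp_neg_integrableOn_Ioi 1 hz)
    ((continuousOn_rpow_mul_exp _ z).aestronglyMeasurable measurableSet_Ioi) ?_
  filter_upwards [ae_restrict_mem measurableSet_Ioi] with t (ht : 1 < t)
  rw [norm_mul, norm_exp_neg_mul, Complex.norm_real,
    Real.norm_of_nonneg (Real.rpow_nonneg (by linarith) _), neg_mul, neg_mul, mul_comm t]
  exact mul_le_of_le_one_left (Real.exp_nonneg _)
    (Real.rpow_le_one_of_one_le_of_nonpos ht.le (by linarith))

/-- `∫₁^∞ t ^ (α - 1) exp (-t z) dt` is at most `2 / |z|` if `α ≤ 0`. -/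
theorem norm_integral_Ioi_one_le {α : ℝ} (hα : α ≤ 0) {z : ℂ} (hz : 0 < z.re) :
    ‖∫ t in Set.Ioi (1 : ℝ), ((t ^ (α - 1) : ℝ) : ℂ) * Complex.exp (-(t : ℂ) * z)‖ ≤
      2 / ‖z‖ := by
  have hz0 : z ≠ 0 := fun h => by simp [h] at hz
  have hint1 := integrableOn_Ioi_one_rpow_mul_exp hα hz
  have hle : ∀ t : ℝ, t ∈ Set.Ioi (1 : ℝ) →
      ‖((t ^ (α - 2) : ℝ) : ℂ) * Complex.exp (-(t : ℂ) * z)‖ ≤ t ^ (α - 2) := by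
    intro t (ht : 1 < t)
    rw [norm_mul, norm_exp_neg_mul, Complex.norm_real,
      Real.norm_of_nonneg (Real.rpow_nonneg (by linarith) _)]
    refine mul_le_of_le_one_right (Real.rpow_nonneg (by linarith) _) (Real.exp_le_one_iff.2 ?_)
    nlinarith
  have hrp : IntegrableOn (fun t : ℝ => t ^ (α - 2)) (Set.Ioi 1) :=
    integrableOn_Ioi_rpow_of_lt (by linarith) one_pos
  have hint2 : IntegrableOn
      (fun t : ℝ => ((t ^ (α - 2) : ℝ) : ℂ) * Complex.exp (-(t : ℂ) * z)) (Set.Ioi 1) := by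
    refine Integrable.mono' hrp ((continuousOn_rpow_mul_exp _ z).aestronglyMeasurable measurableSet_Ioi) ?_
    filter_upwards [ae_restrict_mem measurableSet_Ioi] with t ht using hle t ht
  have hderiv : ∀ t ∈ Set.Ioi (1 : ℝ),
      HasDerivAt (fun t : ℝ => ((t ^ (α - 1) : ℝ) : ℂ) * Complex.exp (-(t : ℂ) * z))
        (((α - 1 : ℝ) : ℂ) * (((t ^ (α - 2) : ℝ) : ℂ) * Complex.exp (-(t : ℂ) * z)) -
          z * (((t ^ (α - 1) : ℝ) : ℂ) * Complex.exp (-(t : ℂ) * z))) t := by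
    intro t (ht : 1 < t)
    have h1 : HasDerivAt (fun t : ℝ => ((t ^ (α - 1) : ℝ) : ℂ))
        (((α - 1) * t ^ (α - 1 - 1) : ℝ) : ℂ) t :=
      (Real.hasDerivAt_rpow_const (Or.inl (by linarith))).ofReal_comp
    have h2 : HasDerivAt (fun t : ℝ => Complex.exp (-(t : ℂ) * z))
        (Complex.exp (-(t : ℂ) * z) * (-1 * z)) t :=
      (((hasDerivAt_id t).ofReal_comp.neg).mul_const z).cexp
    refine (h1.mul h2).congr_deriv ?_
    rw [show α - 1 - 1 = α - 2 by ring]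
    push_cast; ring
  have hlim : Tendsto (fun t : ℝ => ((t ^ (α - 1) : ℝ) : ℂ) * Complex.exp (-(t : ℂ) * z)) atTop
      (𝓝 0) := by
    refine squeeze_zero_norm' (a := fun t : ℝ => Real.exp (-(z.re * t))) ?_ ?_
    · filter_upwards [eventually_ge_atTop 1] with t ht
      rw [norm_mul, norm_exp_neg_mul, Complex.norm_real,
        Real.norm_of_nonneg (Real.rpow_nonneg (by linarith) _), neg_mul, mul_comm t]
      exact mul_le_of_le_one_left (Real.exp_nonneg _)
        (Real.rpow_le_one_of_one_le_of_nonpos ht (by linarith))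
    · exact Real.tendsto_exp_neg_atTop_nhds_zero.comp (tendsto_id.const_mul_atTop hz)
  have hcw : ContinuousWithinAt
      (fun t : ℝ => ((t ^ (α - 1) : ℝ) : ℂ) * Complex.exp (-(t : ℂ) * z)) (Set.Ici 1) 1 := by
    refine ContinuousAt.continuousWithinAt (ContinuousAt.mul ?_ (by fun_prop))
    exact Complex.continuous_ofReal.continuousAt.comp
      (Real.continuousAt_rpow_const 1 _ (Or.inl one_ne_zero))
  -- Integration by parts gives `z I = (α - 1) J + e^{-z}`, and both terms on the right have norm at
  -- most `1`.
  have hparts := integral_Ioi_of_hasDerivAt_of_tendsto hcw hderiv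
    ((hint2.const_mul _).sub (hint1.const_mul _)) hlim
  rw [integral_sub (hint2.const_mul _) (hint1.const_mul _), integral_const_mul,
    integral_const_mul] at hparts
  set I := ∫ t in Set.Ioi (1 : ℝ), ((t ^ (α - 1) : ℝ) : ℂ) * Complex.exp (-(t : ℂ) * z)
  set J := ∫ t in Set.Ioi (1 : ℝ), ((t ^ (α - 2) : ℝ) : ℂ) * Complex.exp (-(t : ℂ) * z)
  have hJ : ‖J‖ ≤ 1 / (1 - α) := by
    refine (norm_integral_le_of_norm_le hrp ?_).trans (le_of_eq ?_)
    · filter_upwards [ae_restrict_mem measurableSet_Ioi] with t ht using hle t ht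
    · rw [integral_Ioi_rpow_of_lt (by linarith) one_pos, Real.one_rpow,
        show α - 2 + 1 = -(1 - α) by ring, neg_div_neg_eq]
  have hzI : z * I = ((α - 1 : ℝ) : ℂ) * J + Complex.exp (-((1 : ℝ) : ℂ) * z) := by
    rw [Real.one_rpow, Complex.ofReal_one, one_mul] at hparts
    rw [Complex.ofReal_one]
    linear_combination -hparts
  have hle2 : ‖z‖ * ‖I‖ ≤ 2 := by
    rw [← norm_mul, hzI]
    refine (norm_add_le _ _).trans ?_
    rw [norm_mul, norm_exp_neg_mul, Complex.norm_real, Real.norm_of_nonpos (by linarith)]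
    have h1 : -(α - 1) * ‖J‖ ≤ 1 := by
      have h2 : (1 - α) * ‖J‖ ≤ (1 - α) * (1 / (1 - α)) :=
        mul_le_mul_of_nonneg_left hJ (by linarith)
      rw [mul_one_div_cancel (by linarith)] at h2
      linarith
    have h3 : Real.exp (-1 * z.re) ≤ 1 := Real.exp_le_one_iff.2 (by linarith)
    linarith
  rw [le_div_iff₀ (norm_pos_iff.2 hz0)]
  linarith

theorem tendsto_integral_exp_mul_cocompact (h : ℝ → ℂ) :
    Tendsto (fun y : ℝ => ∫ t : ℝ, Complex.exp (-(t : ℂ) * (Complex.I * y)) * h t)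
      (cocompact ℝ) (𝓝 0) := by
  have h1 : Tendsto (fun y : ℝ => y / (2 * Real.pi)) (cocompact ℝ) (cocompact ℝ) := by
    simp only [div_eq_mul_inv]
    exact tendsto_cocompact_mul_right₀ (inv_ne_zero Real.two_pi_pos.ne')
  refine ((Real.tendsto_integral_exp_smul_cocompact h).comp h1).congr fun y => ?_
  refine integral_congr_ae (Eventually.of_forall fun t => ?_)
  simp only [Circle.smul_def, Real.fourierChar_apply, smul_eq_mul]
  congr 2
  have : (Real.pi : ℂ) ≠ 0 := Complex.ofReal_ne_zero.2 Real.pi_ne_zero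
  push_cast
  field_simp

section

variable {a c : ℕ → ℂ} {α : ℕ → ℝ} {N : ℕ} {r C : ℝ}

/-- The integrable part of `(Θ(t) - ∑_{ν < N} c_ν t ^ α_ν) / t` on `]0,∞[`: the sum is
cut off at `t = 1`. -/
def cutoffTheta (a c : ℕ → ℂ) (α : ℕ → ℝ) (N : ℕ) : ℝ → ℂ :=
  (Set.Ioi (0 : ℝ)).indicator fun t => (t : ℂ) ^ ((0 : ℂ) - 1) *
    (theta a t - (Set.Iic (1 : ℝ)).indicator (powSum c α N) t)

/-- Near `0` the function is `O(t ^ (r - 1))`; beyond `1` only `Θ(t)/t` remains, which decays like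
`e^{-2t}`. Without the cutoff a term with `α = 0` would leave `1/t`, not integrable at infinity. -/
theorem integrable_cutoffTheta (ha : IsThetaSeq a) (hre : ∀ n, 2 ≤ (a n).re) (hr : 0 < r)
    (h : ∀ t ∈ Set.Ioo (0 : ℝ) 1, ‖theta a t - powSum c α N t‖ ≤ C * t ^ r) :
    Integrable (cutoffTheta a c α N) := by
  rw [cutoffTheta, integrable_indicator_iff measurableSet_Ioi,
    ← Set.Ioc_union_Ioi_eq_Ioi (zero_le_one' ℝ)]
  have hpc : ContinuousOn (fun t : ℝ => (t : ℂ) ^ ((0 : ℂ) - 1)) (Set.Ioi 0) :=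
    ContinuousOn.cpow_const (by fun_prop) fun t ht => Complex.ofReal_mem_slitPlane.2 ht
  have hpn : ∀ t : ℝ, 0 < t → ‖(t : ℂ) ^ ((0 : ℂ) - 1)‖ = t ^ (-1 : ℝ) := fun t ht => by
    rw [Complex.norm_cpow_eq_rpow_re_of_pos ht]; simp
  refine IntegrableOn.union ?_ ?_
  · obtain ⟨C', -, hC'⟩ := ha.exists_norm_sub_le (R := -2) (R' := 1) (by simpa using hre)
      (by norm_num) one_pos h
    have hmaj : IntegrableOn (fun t : ℝ => |C'| * Real.exp 1 * t ^ (r - 1)) (Set.Ioc 0 1) :=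
      Integrable.const_mul (intervalIntegral.intervalIntegrable_rpow' (by linarith)).1 _
    have hcg : Set.EqOn (fun t : ℝ => (t : ℂ) ^ ((0 : ℂ) - 1) * (theta a t - powSum c α N t))
        (fun t : ℝ => (t : ℂ) ^ ((0 : ℂ) - 1) *
          (theta a t - (Set.Iic (1 : ℝ)).indicator (powSum c α N) t)) (Set.Ioc 0 1) :=
      fun t ht => by simp only [Set.indicator_of_mem (Set.mem_Iic.2 ht.2)]
    refine IntegrableOn.congr_fun ?_ hcg measurableSet_Ioc
    refine Integrable.mono' hmaj (ContinuousOn.aestronglyMeasurable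
      ((hpc.mul (continuousOn_theta_sub_powSum ha c α N)).mono fun t ht => ht.1)
      measurableSet_Ioc) ?_
    filter_upwards [ae_restrict_mem measurableSet_Ioc] with t ht
    rw [norm_mul, hpn t ht.1]
    have h1 := hC' t ht.1
    have h2 : Real.exp (1 * t) ≤ Real.exp 1 := Real.exp_le_exp.2 (by linarith [ht.2])
    have h3 : 0 ≤ t ^ (-1 : ℝ) := Real.rpow_nonneg ht.1.le _
    have h4 : 0 ≤ t ^ r := Real.rpow_nonneg ht.1.le _
    have h5 : t ^ (r - 1) = t ^ r * t ^ (-1 : ℝ) := by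
      rw [← Real.rpow_add ht.1]; rfl
    calc _ ≤ t ^ (-1 : ℝ) * (|C'| * (t ^ r * Real.exp 1)) := by
          refine mul_le_mul_of_nonneg_left (h1.trans ?_) h3
          have := le_abs_self C'
          gcongr
      _ = _ := by rw [h5]; ring
  · obtain ⟨D, hD0, hD⟩ := ha.exists_norm_theta_le (R := -2) (by simpa using hre)
    have hcg : Set.EqOn (fun t : ℝ => (t : ℂ) ^ ((0 : ℂ) - 1) * theta a t)
        (fun t : ℝ => (t : ℂ) ^ ((0 : ℂ) - 1) *
          (theta a t - (Set.Iic (1 : ℝ)).indicator (powSum c α N) t)) (Set.Ioi 1) :=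
      fun t ht => by
        have h1 : t ∉ Set.Iic (1 : ℝ) := by simpa using ht
        simp only [Set.indicator_of_notMem h1, sub_zero]
    refine IntegrableOn.congr_fun ?_ hcg measurableSet_Ioi
    have hsub : Set.Ioi (1 : ℝ) ⊆ Set.Ioi 0 := Set.Ioi_subset_Ioi zero_le_one
    refine Integrable.mono' ((exp_neg_integrableOn_Ioi 1 two_pos).const_mul D)
      (ContinuousOn.aestronglyMeasurable ((hpc.mul ha.continuousOn_theta).mono hsub)
        measurableSet_Ioi) ?_
    filter_upwards [ae_restrict_mem measurableSet_Ioi] with t (ht : 1 < t)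
    rw [norm_mul, hpn t (by linarith)]
    refine (mul_le_of_le_one_left (norm_nonneg _) ?_).trans (hD t ht.le)
    exact Real.rpow_le_one_of_one_le_of_nonpos ht.le (by norm_num)

theorem norm_exp_mul_cutoffTheta_le {z : ℂ} (hz : 0 ≤ z.re) (t : ℝ) :
    ‖Complex.exp (-(t : ℂ) * z) * cutoffTheta a c α N t‖ ≤ ‖cutoffTheta a c α N t‖ := by
  by_cases ht : t ∈ Set.Ioi (0 : ℝ)
  · rw [norm_mul, norm_exp_neg_mul]
    refine mul_le_of_le_one_left (norm_nonneg _) (Real.exp_le_one_iff.2 ?_)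
    have := mul_nonneg (Set.mem_Ioi.1 ht).le hz
    linarith
  · simp [cutoffTheta, Set.indicator_of_notMem ht]

theorem integrable_exp_mul_cutoffTheta (ha : IsThetaSeq a) (hre : ∀ n, 2 ≤ (a n).re) (hr : 0 < r)
    (h : ∀ t ∈ Set.Ioo (0 : ℝ) 1, ‖theta a t - powSum c α N t‖ ≤ C * t ^ r) {z : ℂ}
    (hz : 0 ≤ z.re) :
    Integrable fun t : ℝ => Complex.exp (-(t : ℂ) * z) * cutoffTheta a c α N t :=
  (integrable_cutoffTheta ha hre hr h).mono
    ((Continuous.aestronglyMeasurable (by fun_prop)).mul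
      (integrable_cutoffTheta ha hre hr h).aestronglyMeasurable)
    (Eventually.of_forall fun t => norm_exp_mul_cutoffTheta_le hz t)

/-- The difference consists of the integrals `∫₁^∞ t ^ (α_ν - 1) e^{-tz} dt` removed by the cutoff.
The bound `2 / ‖z‖` does not degenerate as `Re z → 0`, so it passes to the imaginary axis. -/
theorem norm_laplaceMellin_sub_le (ha : IsThetaSeq a) (hre : ∀ n, 2 ≤ (a n).re) (hr : 0 < r)
    (h : ∀ t ∈ Set.Ioo (0 : ℝ) 1, ‖theta a t - powSum c α N t‖ ≤ C * t ^ r)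
    (hα : ∀ ν < N, α ν ≤ 0) {z : ℂ} (hz : 0 < z.re) :
    ‖laplaceMellin (fun t => theta a t - powSum c α N t) z 0 -
      ∫ t : ℝ, Complex.exp (-(t : ℂ) * z) * cutoffTheta a c α N t‖ ≤
      (∑ ν ∈ Finset.range N, ‖c ν‖) * (2 / ‖z‖) := by
  obtain ⟨C', R', hR', hC'⟩ := exists_norm_theta_sub_le ha (R := -2) (by simpa using hre)
    (by linarith) hz h
  have hint := integrableOn_laplaceMellin (continuousOn_theta_sub_powSum ha c α N) hC' hR' (s := 0)
    (by simpa using hr)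
  have hint2 : Integrable fun t : ℝ => Complex.exp (-(t : ℂ) * z) * cutoffTheta a c α N t :=
    integrable_exp_mul_cutoffTheta ha hre hr h hz.le
  have hind : (fun t : ℝ => Complex.exp (-(t : ℂ) * z) * cutoffTheta a c α N t) =
      (Set.Ioi (0 : ℝ)).indicator fun t => Complex.exp (-(t : ℂ) * z) * ((t : ℂ) ^ ((0 : ℂ) - 1) *
        (theta a t - (Set.Iic (1 : ℝ)).indicator (powSum c α N) t)) := by
    funext t
    by_cases ht : t ∈ Set.Ioi (0 : ℝ) <;> simp [cutoffTheta, Set.indicator, ht]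
  rw [hind] at hint2 ⊢
  rw [integrable_indicator_iff measurableSet_Ioi] at hint2
  rw [integral_indicator measurableSet_Ioi, laplaceMellin, ← integral_sub hint hint2]
  have hd : ∀ t : ℝ, (t : ℂ) ^ ((0 : ℂ) - 1) * (Complex.exp (-(t : ℂ) * z) *
      (theta a t - powSum c α N t)) - Complex.exp (-(t : ℂ) * z) * ((t : ℂ) ^ ((0 : ℂ) - 1) *
        (theta a t - (Set.Iic (1 : ℝ)).indicator (powSum c α N) t)) =
      (Set.Ioi (1 : ℝ)).indicator (fun t : ℝ => -((t : ℂ) ^ ((0 : ℂ) - 1) *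
        (Complex.exp (-(t : ℂ) * z) * powSum c α N t))) t := by
    intro t
    by_cases ht : t ≤ 1
    · simp only [Set.indicator, Set.mem_Iic, Set.mem_Ioi, ht, not_lt.2 ht, if_true, if_false]
      ring
    · simp only [Set.indicator, Set.mem_Iic, Set.mem_Ioi, ht, not_le.1 ht, if_true, if_false]
      ring
  simp only [hd]
  rw [setIntegral_indicator measurableSet_Ioi,
    Set.inter_eq_right.2 (Set.Ioi_subset_Ioi zero_le_one)]
  have hs : ∫ t in Set.Ioi (1 : ℝ), -((t : ℂ) ^ ((0 : ℂ) - 1) *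
      (Complex.exp (-(t : ℂ) * z) * powSum c α N t)) = ∫ t in Set.Ioi (1 : ℝ),
        ∑ ν ∈ Finset.range N, -c ν * (((t ^ (α ν - 1) : ℝ) : ℂ) * Complex.exp (-(t : ℂ) * z)) := by
    refine setIntegral_congr_fun measurableSet_Ioi fun t (ht : 1 < t) => ?_
    have ht0 : 0 < t := by linarith
    simp only [powSum, Finset.mul_sum, ← Finset.sum_neg_distrib]
    refine Finset.sum_congr rfl fun ν _ => ?_
    have h2 : ((t ^ (α ν - 1) : ℝ) : ℂ) = (t : ℂ) ^ ((0 : ℂ) - 1) * ((t ^ α ν : ℝ) : ℂ) := by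
      rw [Real.rpow_sub ht0, Real.rpow_one, zero_sub, Complex.cpow_neg_one]
      push_cast
      rw [div_eq_mul_inv, mul_comm]
    rw [h2]
    ring
  rw [hs, integral_finsetSum _ fun ν hν =>
    (integrableOn_Ioi_one_rpow_mul_exp (hα ν (Finset.mem_range.1 hν)) hz).const_mul _,
    Finset.sum_mul]
  refine (norm_sum_le _ _).trans (Finset.sum_le_sum fun ν hν => ?_)
  rw [integral_const_mul, norm_mul, norm_neg]
  exact mul_le_mul_of_nonneg_left (norm_integral_Ioi_one_le (hα ν (Finset.mem_range.1 hν)) hz)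
    (norm_nonneg _)

end

end RegDet
end

/-! ### Asymptotics along the imaginary axis. -/

noncomputable section
namespace RegDet
open Filter Topology MeasureTheory

/-- The expansion of the regularized product along the imaginary axis, for a sequence in the right
half plane and an expansion of its theta series up to positive powers. -/
theorem IsThetaSeq.tendsto_logRegProd_I_of_le_re {a c : ℕ → ℂ} {α : ℕ → ℝ} {N : ℕ} {r C : ℝ}
    (ha : IsThetaSeq a) (hre : ∀ n, 2 ≤ (a n).re) (hr : 0 < r)
    (h : ∀ t ∈ Set.Ioo (0 : ℝ) 1, ‖theta a t - powSum c α N t‖ ≤ C * t ^ r)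
    (hα : ∀ ν < N, α ν ≤ 0) :
    Tendsto (fun y : ℝ => -logRegProd (fun n => a n + Complex.I * (y : ℂ)) -
      ∑ ν ∈ Finset.range N, detTerm (c ν) (α ν) (Complex.I * (y : ℂ))) (cocompact ℝ) (𝓝 0) := by
  set K := ∑ ν ∈ Finset.range N, ‖c ν‖
  have hbound : ∀ y : ℝ, y ≠ 0 → ‖-logRegProd (fun n => a n + Complex.I * (y : ℂ)) -
      ∑ ν ∈ Finset.range N, detTerm (c ν) (α ν) (Complex.I * (y : ℂ))‖ ≤
      ‖∫ t : ℝ, Complex.exp (-(t : ℂ) * (Complex.I * y)) * cutoffTheta a c α N t‖ +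
        K * (2 / ‖y‖) := by
    intro y hy
    have hre0 : (Complex.I * (y : ℂ)).re = 0 := by simp
    have him : (Complex.I * (y : ℂ)).im = y := by simp
    set z := Complex.I * (y : ℂ) with hz
    have hslit : z ∈ Complex.slitPlane := Or.inr (by rw [him]; exact hy)
    have hzn : ‖z‖ = ‖y‖ := by simp [hz]
    have hz0 : ‖z‖ ≠ 0 := by rw [hzn]; exact norm_ne_zero_iff.2 hy
    -- The exact formula requires `Re z > 0`, so the estimate is proved at `z + ε` and `ε ↓ 0`. The
    -- left side is continuous at `z`, and the integral converges by domination.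
    have hpath : Tendsto (fun ε : ℝ => z + (ε : ℂ)) (𝓝[>] 0) (𝓝 z) :=
      (Continuous.tendsto' (by fun_prop) 0 z (by simp)).mono_left nhdsWithin_le_nhds
    have hG : ContinuousAt (fun z => -logRegProd (fun n => a n + z) -
        ∑ ν ∈ Finset.range N, detTerm (c ν) (α ν) z) z := by
      refine ContinuousAt.sub (ContinuousAt.neg ?_) ?_
      · refine (ha.analyticAt_logRegProd two_pos fun n => ?_).continuousAt
        rw [Complex.add_re, hre0, add_zero]
        exact hre n
      · exact tendsto_finsetSum _ fun ν _ => continuousAt_detTerm _ _ hslit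
    have hH : Tendsto (fun ε : ℝ => ∫ t : ℝ, Complex.exp (-(t : ℂ) * (z + (ε : ℂ))) *
        cutoffTheta a c α N t) (𝓝[>] 0)
        (𝓝 (∫ t : ℝ, Complex.exp (-(t : ℂ) * z) * cutoffTheta a c α N t)) := by
      refine tendsto_integral_filter_of_dominated_convergence (fun t => ‖cutoffTheta a c α N t‖)
        ?_ ?_ (integrable_cutoffTheta ha hre hr h).norm ?_
      · filter_upwards [self_mem_nhdsWithin] with ε (hε : 0 < ε)
        exact (integrable_exp_mul_cutoffTheta ha hre hr h (by
          rw [Complex.add_re, hre0, Complex.ofReal_re]; linarith)).aestronglyMeasurable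
      · filter_upwards [self_mem_nhdsWithin] with ε (hε : 0 < ε)
        refine Eventually.of_forall fun t => norm_exp_mul_cutoffTheta_le ?_ t
        rw [Complex.add_re, hre0, Complex.ofReal_re]; linarith
      · refine Eventually.of_forall fun t => Tendsto.mul_const _ ?_
        have : Continuous fun w : ℂ => Complex.exp (-(t : ℂ) * w) := by fun_prop
        exact (this.tendsto z).comp hpath
    have hL := (hG.tendsto.comp hpath).norm
    have hR := hH.norm.add (((hpath.norm).inv₀ hz0).const_mul (K * 2))
    have hle := le_of_tendsto_of_tendsto hL hR ?_
    · refine hle.trans (le_of_eq ?_)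
      rw [hzn, mul_assoc, div_eq_mul_inv]
    · filter_upwards [self_mem_nhdsWithin] with ε (hε : 0 < ε)
      have hpos : 0 < (z + (ε : ℂ)).re := by
        rw [Complex.add_re, hre0, Complex.ofReal_re]; linarith
      have h1 := norm_laplaceMellin_sub_le ha hre hr h hα hpos
      have h2 := ha.neg_logRegProd_add_const (R := -2) (by simpa using hre) (by linarith) hpos hr h
      simp only [Function.comp_apply]
      rw [h2, add_sub_cancel_left, mul_assoc, ← div_eq_mul_inv]
      have h3 := norm_add_le (laplaceMellin (fun t => theta a t - powSum c α N t) (z + ε) 0 -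
        ∫ t : ℝ, Complex.exp (-(t : ℂ) * (z + ε)) * cutoffTheta a c α N t)
        (∫ t : ℝ, Complex.exp (-(t : ℂ) * (z + ε)) * cutoffTheta a c α N t)
      rw [sub_add_cancel] at h3
      linarith
  have hlim := (tendsto_integral_exp_mul_cocompact (cutoffTheta a c α N)).norm.add
    ((tendsto_norm_cocompact_atTop (E := ℝ)).inv_tendsto_atTop.const_mul (K * 2))
  rw [norm_zero, mul_zero, add_zero] at hlim
  refine squeeze_zero_norm' ?_ hlim
  have hne : ∀ᶠ y : ℝ in cocompact ℝ, y ≠ 0 := by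
    filter_upwards [(tendsto_norm_cocompact_atTop (E := ℝ)).eventually_gt_atTop 0] with y hy
    exact norm_pos_iff.1 hy
  filter_upwards [hne] with y hy
  refine (hbound y hy).trans (le_of_eq ?_)
  rw [Pi.inv_apply, mul_assoc, div_eq_mul_inv]

theorem tendsto_I_mul_cocompact :
    Tendsto (fun y : ℝ => Complex.I * (y : ℂ)) (cocompact ℝ) (comap norm atTop) := by
  rw [tendsto_comap_iff]
  refine (tendsto_norm_cocompact_atTop (E := ℝ)).congr fun y => ?_
  simp

/-- The difference is `log (1 + w / (iy))`: the arguments of `iy` and of `1 + w / (iy)` add up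
within the principal range, being at most `π / 2` and less than `π / 2` in absolute value. -/
theorem tendsto_log_add_sub_log (w : ℂ) :
    Tendsto (fun y : ℝ => Complex.log (w + Complex.I * (y : ℂ)) -
      Complex.log (Complex.I * (y : ℂ))) (cocompact ℝ) (𝓝 0) := by
  have hne : ∀ᶠ y : ℝ in cocompact ℝ, y ≠ 0 := by
    filter_upwards [(tendsto_norm_cocompact_atTop (E := ℝ)).eventually_gt_atTop 0] with y hy
    exact norm_pos_iff.1 hy
  have h1 : Tendsto (fun y : ℝ => 1 + w * (Complex.I * (y : ℂ))⁻¹) (cocompact ℝ) (𝓝 1) := by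
    have h2 : Tendsto (fun y : ℝ => (Complex.I * (y : ℂ))⁻¹) (cocompact ℝ) (𝓝 0) := by
      rw [tendsto_zero_iff_norm_tendsto_zero]
      refine (tendsto_norm_cocompact_atTop (E := ℝ)).inv_tendsto_atTop.congr fun y => ?_
      simp
    simpa using (h2.const_mul w).const_add 1
  have h3 : Tendsto (fun y : ℝ => Complex.log (1 + w * (Complex.I * (y : ℂ))⁻¹))
      (cocompact ℝ) (𝓝 0) := by
    have := (continuousAt_clog Complex.one_mem_slitPlane).tendsto.comp h1
    rwa [Complex.log_one] at this
  refine h3.congr' ?_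
  have hre : ∀ᶠ y : ℝ in cocompact ℝ, 0 < (1 + w * (Complex.I * (y : ℂ))⁻¹).re :=
    h1.eventually ((isOpen_lt continuous_const Complex.continuous_re).mem_nhds
      (by simp : (0 : ℝ) < (1 : ℂ).re))
  filter_upwards [hne, hre] with y hy hy2
  have hz : Complex.I * (y : ℂ) ≠ 0 := mul_ne_zero Complex.I_ne_zero (Complex.ofReal_ne_zero.2 hy)
  have hq : 1 + w * (Complex.I * (y : ℂ))⁻¹ ≠ 0 := fun h => by
    rw [h, Complex.zero_re] at hy2; exact lt_irrefl _ hy2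
  have harg1 := abs_lt.1 (Complex.abs_arg_lt_pi_div_two_iff.2 (Or.inl hy2))
  have harg2 := abs_le.1 ((Complex.abs_arg_le_pi_div_two_iff (z := Complex.I * (y : ℂ))).2
    (by simp))
  have hmul := (Complex.log_mul_eq_add_log_iff hz hq).2 ⟨by linarith, by linarith⟩
  rw [mul_add, mul_one, mul_left_comm, mul_inv_cancel₀ hz, mul_one, add_comm] at hmul
  rw [hmul, add_sub_cancel_left]

/-- The expansion of the regularized product along the imaginary axis. -/
theorem IsThetaSeq.tendsto_logRegProd_I {b c : ℕ → ℂ} {α : ℕ → ℝ} (hb : IsThetaSeq b)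
    (hc : HasHeatExpansion b c α) {N : ℕ} (hN : 0 < α N) :
    Tendsto (fun y : ℝ => -logRegProd (fun n => b n + Complex.I * (y : ℂ)) -
      ∑ ν ∈ Finset.range N, detTerm (c ν) (α ν) (Complex.I * (y : ℂ))) (cocompact ℝ) (𝓝 0) := by
  -- Only the terms before the first positive exponent matter: those with `L ≤ ν < N` tend to `0`,
  -- and nonpositive exponents are what the oscillatory estimate requires.
  obtain ⟨L, hL, hLmin⟩ : ∃ L, 0 < α L ∧ ∀ ν < L, α ν ≤ 0 := by
    classical
    have hex : ∃ L, 0 < α L := ⟨N, hN⟩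
    exact ⟨Nat.find hex, Nat.find_spec hex, fun m hm => not_lt.1 (Nat.find_min hex hm)⟩
  have hLN : L ≤ N := by
    by_contra! hlt
    exact (hLmin N hlt).not_gt hN
  obtain ⟨M, hM⟩ := hb.exists_tail_le_re 2
  -- the expansion of the theta series of the tail
  set c' : ℕ → ℂ := fun ν => if ν < L then c ν else -(M : ℂ) with hc'
  set α' : ℕ → ℝ := fun ν => if ν < L then α ν else 0 with hα'
  have hα'0 : ∀ ν < L + 1, α' ν ≤ 0 := by
    intro ν _
    simp only [hα']
    split_ifs with h
    · exact hLmin ν h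
    · exact le_rfl
  have hsum : ∀ g : ℂ → ℝ → ℂ, ∑ ν ∈ Finset.range (L + 1), g (c' ν) (α' ν) =
      ∑ ν ∈ Finset.range L, g (c ν) (α ν) + g (-(M : ℂ)) 0 := by
    intro g
    rw [Finset.sum_range_succ]
    congr 1
    · refine Finset.sum_congr rfl fun ν hν => ?_
      simp only [hc', hα', Finset.mem_range.1 hν, if_true]
    · simp only [hc', hα', lt_irrefl, if_false]
  obtain ⟨C, hC⟩ := hc.exists_norm_sub_powSum_le L
  -- Each of the `M` removed exponentials is `1 + O(t)`. Together they cost the extra term `-M t ^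
  -- 0` and limit the order of the remainder to `min (α L) 1`.
  have htail : ∀ t ∈ Set.Ioo (0 : ℝ) 1, ‖theta (fun n => b (n + M)) t - powSum c' α' (L + 1) t‖ ≤
      (|C| + ∑ n ∈ Finset.range M, ‖b n‖ * Real.exp ‖b n‖) * t ^ min (α L) 1 := by
    intro t ht
    have h1 : theta (fun n => b (n + M)) t - powSum c' α' (L + 1) t =
        (theta b t - powSum c α L t) -
          ∑ n ∈ Finset.range M, (Complex.exp (-(t : ℂ) * b n) - 1) := by
      rw [← sum_add_theta_tail (hb.summable_theta t ht.1) M, powSum,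
        hsum fun x y => x * ((t ^ y : ℝ) : ℂ), powSum, Finset.sum_sub_distrib]
      simp
      ring
    have h2 : t ^ α L ≤ t ^ min (α L) 1 :=
      Real.rpow_le_rpow_of_exponent_ge ht.1 ht.2.le (min_le_left _ _)
    have h3 : t ≤ t ^ min (α L) 1 := by
      conv_lhs => rw [← Real.rpow_one t]
      exact Real.rpow_le_rpow_of_exponent_ge ht.1 ht.2.le (min_le_right _ _)
    rw [h1, add_mul]
    refine (norm_sub_le _ _).trans (add_le_add ((hC t ht).trans ?_) ?_)
    · have := Real.rpow_nonneg ht.1.le (α L)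
      have := le_abs_self C
      gcongr
    · rw [Finset.sum_mul]
      refine (norm_sum_le _ _).trans (Finset.sum_le_sum fun n _ => ?_)
      have h4 := Complex.norm_exp_sub_sum_le_norm_mul_exp (-(t : ℂ) * b n) 1
      rw [Finset.sum_range_one, pow_zero, Nat.factorial_zero, Nat.cast_one, div_one, pow_one,
        norm_mul, norm_neg, Complex.norm_real, Real.norm_of_nonneg ht.1.le] at h4
      have h5 : Real.exp (t * ‖b n‖) ≤ Real.exp ‖b n‖ :=
        Real.exp_le_exp.2 (mul_le_of_le_one_left (norm_nonneg _) ht.2.le)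
      have h6 := Real.rpow_nonneg ht.1.le (min (α L) 1)
      calc _ ≤ t * ‖b n‖ * Real.exp (t * ‖b n‖) := h4
        _ ≤ t ^ min (α L) 1 * ‖b n‖ * Real.exp ‖b n‖ := by gcongr
        _ = _ := by ring
  have hmain := (hb.tail M).tendsto_logRegProd_I_of_le_re hM (lt_min hL one_pos) htail hα'0
  have hlog : Tendsto (fun y : ℝ => ∑ n ∈ Finset.range M,
      (Complex.log (b n + Complex.I * (y : ℂ)) - Complex.log (Complex.I * (y : ℂ))))
      (cocompact ℝ) (𝓝 0) := by
    simpa using tendsto_finsetSum (Finset.range M) fun n _ => tendsto_log_add_sub_log (b n)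
  have hrest : Tendsto (fun y : ℝ => ∑ ν ∈ Finset.Ico L N,
      detTerm (c ν) (α ν) (Complex.I * (y : ℂ))) (cocompact ℝ) (𝓝 0) := by
    have := tendsto_finsetSum (Finset.Ico L N) fun ν hν => (tendsto_detTerm_zero (c ν)
      (hL.trans_le (hc.mono (Finset.mem_Ico.1 hν).1))).comp tendsto_I_mul_cocompact
    simpa using this
  have htot := (hmain.sub hlog).sub hrest
  rw [sub_zero, sub_zero] at htot
  refine htot.congr' ?_
  -- For such `y` the first `M` factors cannot vanish; the others have real part at least `2`.
  have hbig : ∀ᶠ y : ℝ in cocompact ℝ, ∑ n ∈ Finset.range M, ‖b n‖ < ‖y‖ :=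
    (tendsto_norm_cocompact_atTop (E := ℝ)).eventually_gt_atTop _
  filter_upwards [hbig] with y hy
  have h0 : ∀ n, b n + Complex.I * (y : ℂ) ≠ 0 := by
    intro n hn
    by_cases hnM : n < M
    · have h1 : ‖b n‖ = ‖y‖ := by
        rw [eq_neg_of_add_eq_zero_left hn, norm_neg]; simp
      have h2 := Finset.single_le_sum (f := fun n => ‖b n‖) (fun n _ => norm_nonneg _)
        (Finset.mem_range.2 hnM)
      linarith
    · have h1 := hM (n - M)
      have h2 := congrArg Complex.re hn
      rw [Nat.sub_add_cancel (not_lt.1 hnM)] at h1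
      simp at h2
      linarith
  rw [logRegProd_eq_sum_log_add (hb.add_const (Complex.I * (y : ℂ))) h0 (M := M) two_pos
    (fun n => by simpa using hM n), hsum fun x e => detTerm x e (Complex.I * (y : ℂ)),
    ← Finset.sum_range_add_sum_Ico _ hLN, Finset.sum_sub_distrib]
  -- The extra term yields `M log (iy)`, which cancels against the logarithms of the `M` split-off
  -- factors up to `o(1)`.
  have hd : detTerm (-(M : ℂ)) 0 (Complex.I * (y : ℂ)) = M * Complex.log (Complex.I * (y : ℂ)) := by
    simp [detTerm]
  rw [hd, Finset.sum_const, Finset.card_range, nsmul_eq_mul]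
  ring

end RegDet
end

noncomputable section
namespace RegDet
open Filter Topology

/-! ### Admissible operators -/

/-- With `δ = cos θ`, a sector inside the right half plane becomes a cone `δ ‖z‖ ≤ Re z`, a
condition visibly stable under addition; `abs_arg_le_arccos` goes back. -/
theorem exists_mul_norm_le_re {θ : ℝ} (hθ : θ < Real.pi / 2) :
    ∃ δ > 0, ∀ z : ℂ, |z.arg| < θ → δ * ‖z‖ ≤ z.re := by
  by_cases h0 : 0 ≤ θ
  · refine ⟨Real.cos θ, Real.cos_pos_of_mem_Ioo ⟨by linarith, hθ⟩, fun z hz => ?_⟩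
    rw [← Complex.norm_mul_cos_arg z, mul_comm, ← Real.cos_abs z.arg]
    gcongr
    exact Real.cos_le_cos_of_nonneg_of_le_pi (abs_nonneg _) (by linarith) hz.le
  · exact ⟨1, one_pos, fun z hz => absurd ((abs_nonneg _).trans_lt hz) (by linarith)⟩

theorem abs_arg_le_arccos {z : ℂ} {δ : ℝ} (hz : z ≠ 0) (h : δ * ‖z‖ ≤ z.re) :
    |z.arg| ≤ Real.arccos δ := by
  rw [← Real.arccos_cos (abs_nonneg z.arg) (Complex.abs_arg_le_pi z), Real.cos_abs,
    Complex.cos_arg hz]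
  exact Real.antitone_arccos ((le_div_iff₀ (norm_pos_iff.2 hz)).2 h)

/-- Translation by `l` with `Re l > 0` preserves admissibility with respect to the right half
plane. -/
theorem IsThetaSeq.isAdmissibleSeq_add_of_re_pos {b : ℕ → ℂ} (hb : IsThetaSeq b) {θ : ℝ}
    (hθ : θ < Real.pi / 2) (h : ∀ n, b n = 0 ∨ |(b n).arg| < θ) {l : ℂ} (hl : 0 < l.re) :
    IsAdmissibleSeq (Real.pi / 2) fun n => b n + l := by
  obtain ⟨δ, hδ, H⟩ := exists_mul_norm_le_re hθ
  have hl0 : l ≠ 0 := fun h => by simp [h] at hl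
  have hln : 0 < ‖l‖ := norm_pos_iff.2 hl0
  -- The cone with constant `η` contains `l` and every `b_n`, including `b_n = 0`, hence all sums
  -- `b_n + l`.
  set η := min δ (l.re / ‖l‖)
  have hη : 0 < η := lt_min hδ (div_pos hl hln)
  have hb' : ∀ n, η * ‖b n‖ ≤ (b n).re := fun n => by
    rcases h n with h | h
    · simp [h]
    · exact (mul_le_mul_of_nonneg_right (min_le_left _ _) (norm_nonneg _)).trans (H _ h)
  have hl' : η * ‖l‖ ≤ l.re := (le_div_iff₀ hln).1 (min_le_right _ _)
  have hsum : ∀ n, η * ‖b n + l‖ ≤ (b n + l).re := fun n =>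
    calc η * ‖b n + l‖ ≤ η * (‖b n‖ + ‖l‖) := by gcongr; exact norm_add_le _ _
      _ ≤ (b n + l).re := by rw [Complex.add_re]; linarith [hb' n]
  have hne : ∀ n, b n + l ≠ 0 := fun n h0 => by
    have h1 := hb' n
    have h2 : (b n).re + l.re = 0 := by rw [← Complex.add_re, h0, Complex.zero_re]
    linarith [mul_nonneg hη.le (norm_nonneg (b n))]
  have hη2 : Real.arccos η < Real.pi / 2 := Real.arccos_lt_pi_div_two.2 hη
  refine (hb.add_const l).isAdmissibleSeq hne
    ⟨(Real.pi / 2 - Real.arccos η) / 2, by linarith, fun n => ?_⟩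
  exact (abs_arg_le_arccos (hne n) (hsum n)).trans_lt (by linarith)

variable {H : Type*} [NormedAddCommGroup H] [InnerProductSpace ℂ H] {A : H →ₗ.[ℂ] H}

theorem logDet_shift {b : ℕ → ℂ} (hb : IsEigenvalueSeq A b) (l : ℂ) :
    logDet (shift A l) = logRegProd fun n => b n + l := by
  obtain ⟨σ, hσ⟩ := (eigenvalueSeq_spec (hb.shift l)).exists_perm (hb.shift l)
  rw [logDet, hσ, logRegProd_comp_perm]

theorem det_shift {b : ℕ → ℂ} (hb : IsEigenvalueSeq A b) (l : ℂ) :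
    det (shift A l) = regProd fun n => b n + l :=
  congrArg Complex.exp (logDet_shift hb l)

theorem add_ne_zero_of_isAdmissible_shift {b : ℕ → ℂ} (hb : IsEigenvalueSeq A b) {θ : ℝ} {l : ℂ}
    (h : IsAdmissible θ (shift A l)) (n : ℕ) : b n + l ≠ 0 := by
  obtain ⟨-, a, ha, had⟩ := h
  obtain ⟨σ, hσ⟩ := (hb.shift l).exists_perm ha
  rw [show b n + l = a (σ n) from congrFun hσ n]
  exact had.ne_zero _

/-- The eigenvalues of an operator `A` with finite dimensional generalized kernel and admissible
reduction. -/
theorem IsAdmissibleModKer.exists_isEigenvalueSeq [CompleteSpace H] {θ : ℝ}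
    (hA : IsAdmissibleModKer θ A) (hker : FiniteDimensional ℂ (genKer A)) :
    ∃ b, IsEigenvalueSeq A b ∧ IsThetaSeq b ∧
      ∃ ε > 0, ∀ n, b n = 0 ∨ |(b n).arg| < θ - ε := by
  obtain ⟨-, a, ha, had⟩ := hA
  obtain ⟨m, b, hb, hb0, hba⟩ := exists_isEigenvalueSeq_of_reduced ha had.ne_zero
  obtain ⟨ε, hε, h⟩ := had.sector
  refine ⟨b, hb, (IsThetaSeq.tail_iff m).1 ?_, ε, hε, fun n => ?_⟩
  · rw [show (fun n => b (n + m)) = a from funext hba]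
    exact had.isThetaSeq
  · rcases lt_or_ge n m with hn | hn
    · exact Or.inl (hb0 n hn)
    · obtain ⟨k, rfl⟩ := Nat.exists_eq_add_of_le' hn
      exact Or.inr (by rw [hba]; exact h k)

/-- The characteristic function of an operator with a theta series. -/
theorem exists_charFun_of_isEigenvalueSeq {b : ℕ → ℂ} (hb : IsEigenvalueSeq A b)
    (hbT : IsThetaSeq b) : ∃ F : ℂ → ℂ, Differentiable ℂ F ∧
      (∀ l : ℂ, IsAdmissible Real.pi (shift A l) → F l = det (shift A l)) ∧
      (∀ z : ℂ, F z = 0 ↔ IsEigenvalue (-A) z) ∧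
      (∀ z : ℂ, analyticOrderAt F z = algMult (-A) z) := by
  obtain ⟨F, hF, hdet, hord⟩ := exists_charFun hbT
  have hmult : ∀ z, analyticOrderAt F z = algMult (-A) z := fun z => by
    rw [hord, algMult_neg]
    exact hb (-z)
  refine ⟨F, hF, fun l hl => ?_, fun z => ?_, hmult⟩
  · rw [det_shift hb, hdet l (add_ne_zero_of_isAdmissible_shift hb hl)]
  · rw [isEigenvalue_iff_algMult_ne_zero, ← hmult, (hF.analyticAt z).analyticOrderAt_ne_zero]

end RegDet
end

/-! ### Transfer of the results on sequences to the operator. -/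

theorem proposition1p7 {H : Type*} [NormedAddCommGroup H] [InnerProductSpace ℂ H]
    [CompleteSpace H] (A : H →ₗ.[ℂ] H)
    (hreg : RegDet.IsRegular A) (hker : FiniteDimensional ℂ (RegDet.genKer A))
    (hA : RegDet.IsAdmissibleModKer Real.pi A) :
    -- `A + l` is admissible as soon as it has no eigenvalue on the cut `]-∞, 0]`
    (∀ l : ℂ, (∀ μ : ℂ, RegDet.IsEigenvalue (RegDet.shift A l) μ → μ ∈ Complex.slitPlane) →
      RegDet.IsAdmissible Real.pi (RegDet.shift A l)) ∧
    -- for the angles in the right half plane, `A + l` is admissible whenever `Re l > 0`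
    (RegDet.IsAdmissibleModKer (Real.pi / 2) A → ∀ l : ℂ, 0 < l.re →
      RegDet.IsAdmissible (Real.pi / 2) (RegDet.shift A l)) ∧
    -- the characteristic function is entire, with the eigenvalues of `-A` as its zeros
    (∃ F : ℂ → ℂ, Differentiable ℂ F ∧
      (∀ l : ℂ, RegDet.IsAdmissible Real.pi (RegDet.shift A l) →
        F l = RegDet.det (RegDet.shift A l)) ∧
      (∀ z : ℂ, F z = 0 ↔ RegDet.IsEigenvalue (-A) z) ∧
      (∀ z : ℂ, analyticOrderAt F z = RegDet.algMult (-A) z)) ∧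
    -- the full heat trace of `A`, including the eigenvalue `0`, has an expansion
    (∃ b c α, RegDet.IsEigenvalueSeq A b ∧ RegDet.HasHeatExpansion b c α) ∧
    -- the asymptotic expansions of the determinant
    (∀ (b : ℕ → ℂ) (c : ℕ → ℂ) (α : ℕ → ℝ),
      RegDet.IsEigenvalueSeq A b → RegDet.HasHeatExpansion b c α →
      (∀ N : ℕ,
        (fun l : ℝ => -RegDet.logDet (RegDet.shift A (l : ℂ)) -
          ∑ ν ∈ Finset.range N, RegDet.detTerm (c ν) (α ν) (l : ℂ))
          =O[Filter.atTop] fun l : ℝ => l ^ (-α N) * Real.log l) ∧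
      (∀ N : ℕ, 0 < α N →
        Filter.Tendsto (fun l : ℝ =>
          -RegDet.logDet (RegDet.shift A (Complex.I * (l : ℂ))) -
            ∑ ν ∈ Finset.range N, RegDet.detTerm (c ν) (α ν) (Complex.I * (l : ℂ)))
          Filter.atTop (nhds 0) ∧
        Filter.Tendsto (fun l : ℝ =>
          -RegDet.logDet (RegDet.shift A (-Complex.I * (l : ℂ))) -
            ∑ ν ∈ Finset.range N, RegDet.detTerm (c ν) (α ν) (-Complex.I * (l : ℂ)))
          Filter.atTop (nhds 0))) := by
  obtain ⟨b, hb, hbT, -⟩ := hA.exists_isEigenvalueSeq hker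
  refine ⟨fun l h => ?_, fun hA' l hl => ?_, RegDet.exists_charFun_of_isEigenvalueSeq hb hbT, ?_, fun b₁ c α hb₁ hc => ?_⟩
  · exact ⟨hreg.shift l, _, hb.shift l, (hbT.add_const l).isAdmissibleSeq_pi fun n =>
      h _ ((hb.shift l).isEigenvalue n)⟩
  · obtain ⟨b', hb', hbT', ε, hε, hs⟩ := hA'.exists_isEigenvalueSeq hker
    exact ⟨hreg.shift l, _, hb'.shift l,
      hbT'.isAdmissibleSeq_add_of_re_pos (by linarith) hs hl⟩
  · obtain ⟨c, α, hc⟩ := hbT.hasPowerExp.exists_hasHeatExpansion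
    exact ⟨b, c, α, hb, hc⟩
  -- An arbitrary enumeration is a rearrangement of `b`, so it is again a theta sequence and the
  -- results apply to its own expansion.
  · obtain ⟨σ, rfl⟩ := hb₁.exists_perm hb
    have hbT₁ := hbT.comp_perm σ
    simp only [RegDet.logDet_shift hb₁]
    refine ⟨hbT₁.isBigO_logRegProd hc, fun N hN => ?_⟩
    have h := hbT₁.tendsto_logRegProd_I hc hN
    -- The limit along `cocompact ℝ` contains both signs: `y → +∞` gives `A + iλ`, and `y → -∞` with
    -- `y = -λ` gives `A - iλ`.
    rw [cocompact_eq_atBot_atTop] at h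
    refine ⟨h.mono_left le_sup_right, ?_⟩
    refine ((h.mono_left le_sup_left).comp Filter.tendsto_neg_atTop_atBot).congr fun l => ?_
    simp
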